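/- Let $U$ be the Ulam–Harris tree, with vertex set $\bigcup_{k\ge 0}\mathbb{N}^k$, root $\emptyset$, and an edge between each $(n_1,\dots,n_k)$ and its parent $(n_1,\dots,n_{k-1})$. Independently for each vertex $u$, give the edges from $u$ to its children $(u,1),(u,2),\dots$ as weights the successive atoms of a rate one Poisson process on $[0,\infty)$; write $W(e)$ for the weight of $e$. For $u\in V(U)$ let $T^{(u)}$ be the invasion percolation cluster of $u$: the tree built by starting from $\{u\}$ and repeatedly adding the edge of smallest weight that leaves the current vertex set. Let $T=T^{(\emptyset)}$, and let $M$ be the connected component of $\emptyset$ in $\bigcup_{u\in V(U)}T^{(u)}$. Almost surely there is for each $v\in V(M)$ a unique infinite path $P$ in $M$ leaving $v$; the activation time of $v$ is $x(v)=\sup\{W(e):e\in P\}$, and $x(v)=\infty$ if $v\notin V(M)$. For $v\in V(T)$ let $\mathcal M_v$ be the component of $v$ in $M$ after removal of all edges of $T$, and for $\nu\in(1,\infty]$ let $N_v(\nu)$ be the number of vertices $w$ of $\mathcal M_v$ with $x(w)\le\nu$. For $x>1$ let $\theta(x)$ be the probability that a Galton–Watson tree with Poisson$(x)$ offspring distribution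 is infinite, and let $x^*<1$ be the unique number less than $1$ with $x^*e^{-x^*}=xe^{-x}$. For $\lambda>1$, $\nu\in[\lambda,\infty]$ and $k\ge 1$ put $$n_k(\lambda,\nu)=\int_{\lambda<x_1<\dots<x_k<\nu}\ \prod_{i=1}^k\frac{1-\theta(x_i)}{1-x_i^*}\,dx_1\cdots dx_k ,\qquad n_0(\lambda,\nu)=1 .$$ Then for every $v\in V(U)$, every $\lambda>1$ and every $\nu\in[\lambda,\infty]$, $$\mathbf E\big[N_v(\nu)\,\big|\,v\in V(T),\,x(v)=\lambda\big]=\sum_{k\ge 0}n_k(\lambda,\nu).$$ Since $\{x(v)=\lambda\}$ is a null event, this means both of the following. (The event $\{v\in V(T)\}$ is measurable, and on it $x(v)$ and, for $\nu>1$, $N_v(\nu)$ are random variables up to null sets.) (1) For every $\nu$ and every Borel set $B\subseteq\{\lambda\in\mathbb R:1<\lambda\le\nu\}$, $$\mathbf E\big[N_v(\nu)\mathbf 1_{\{v\in V(T),\,x(v)\in B\}}\big]=\mathbf E\Big[\mathbf 1_{\{v\in V(T),\,x(v)\in B\}}\sum_{k\ge 0}n_k(x(v),\nu)\Big],$$ as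 an identity in $[0,\infty]$. (2) For every $\lambda>1$ and $\nu\in[\lambda,\infty]$, the event $\{v\in V(T),\ x(v)\in(\lambda-\delta,\lambda]\}$ has positive probability for each $\delta>0$, and $$\lim_{\delta\downarrow 0}\mathbf E\big[N_v(\nu)\,\big|\,v\in V(T),\ x(v)\in(\lambda-\delta,\lambda]\big]=\sum_{k\ge 0}n_k(\lambda,\nu).$$ -/

import Mathlib

open MeasureTheory ProbabilityTheory Filter Topology
open scoped ENNReal

noncomputable section

namespace Aggregation

/-! ## Invasion percolation (Prim's algorithm) on a weighted graph -/

section Invasion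

variable {V : Type*} (G : SimpleGraph V) (w : V → V → ℝ)

/-- `ab` is an edge of `G` from `a ∈ S` to `b ∉ S`, of minimal weight among all edges leaving `S`.
When the edge weights are distinct there is at most one such edge. -/
def IsMinExit (S : Set V) (a b : V) : Prop :=
  a ∈ S ∧ b ∉ S ∧ G.Adj a b ∧ ∀ a' ∈ S, ∀ b' ∉ S, G.Adj a' b' → w a b ≤ w a' b'

/-- The set of vertices found by the first `n` steps of Prim's algorithm started from `ρ`. -/
def primSet (ρ : V) : ℕ → Set V
  | 0 => {ρ}
  | n + 1 => primSet ρ n ∪ {b | ∃ a, IsMinExit G w (primSet ρ n) a b}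

/-- The vertex set of the invasion percolation cluster of `(G, ρ, w)`. -/
def invasionVerts (ρ : V) : Set V := ⋃ n, primSet G w ρ n

/-- The edges of the invasion percolation cluster of `(G, ρ, w)`, as a graph on `V`. -/
def invasionGraph (ρ : V) : SimpleGraph V :=
  SimpleGraph.fromRel fun a b => ∃ n, IsMinExit G w (primSet G w ρ n) a b

/-- `p` is an infinite (self-avoiding) path in `G` that leaves `v`. -/
def IsRay (v : V) (p : ℕ → V) : Prop :=
  p 0 = v ∧ Function.Injective p ∧ ∀ n, G.Adj (p n) (p (n + 1))

end Invasion

/-! ## The Poisson-weighted infinite tree -/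

/-- The Ulam-Harris tree: the vertex `(n₁, …, n_k)` is the list `[n_k, …, n₁]`, so that the children
of `u` are the vertices `i :: u`, the parent of `i :: u` is `u`, and the root is `[]`. -/
def ulamHarris : SimpleGraph (List ℕ) :=
  SimpleGraph.fromRel fun u v => ∃ i, v = i :: u

/-- The weight of the edge from a vertex to its parent, if `W u i` is the weight of the edge
between `u` and its child `i :: u` (the value at the root is not used). -/
def parentWeight (W : List ℕ → ℕ → ℝ) : List ℕ → ℝ
  | [] => 0
  | i :: u => W u i

/-- The weight of the edge between two adjacent vertices of the Ulam-Harris tree. -/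
def edgeWeight (W : List ℕ → ℕ → ℝ) (u v : List ℕ) : ℝ :=
  if u.length < v.length then parentWeight W v else parentWeight W u

/-- The increments of the sequence of weights of the edges from `u` to its children. -/
def gap {Ω : Type*} (W : List ℕ → ℕ → Ω → ℝ) (u : List ℕ) : ℕ → Ω → ℝ
  | 0 => W u 0
  | i + 1 => fun ω => W u (i + 1) ω - W u i ω

/-- The random edge weights `W` turn the Ulam-Harris tree into the Poisson-weighted infinite tree:
independently for every vertex `u`, the weights of the edges to the children of `u` are the
successive atoms of a rate one Poisson process on `[0, ∞)`, i.e. the first atom and the distances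
between successive atoms are independent exponential variables with mean one. -/
structure IsPWIT {Ω : Type*} [MeasurableSpace Ω] (W : List ℕ → ℕ → Ω → ℝ) (P : Measure Ω) :
    Prop where
  measurable : ∀ u i, Measurable (W u i)
  indep : iIndepFun (fun q : List ℕ × ℕ => gap W q.1 q.2) P
  law : ∀ u i, P.map (gap W u i) = expMeasure 1

/-! ## The trees `T`, `M` and `M_v(ν)` for given edge weights -/

section Trees

variable (W : List ℕ → ℕ → ℝ)

/-- The vertex set of `T`, the invasion percolation cluster of the root. -/
def TVerts : Set (List ℕ) := invasionVerts ulamHarris (edgeWeight W) []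

/-- The edges of `T`. -/
def TGraph : SimpleGraph (List ℕ) := invasionGraph ulamHarris (edgeWeight W) []

/-- `M₀`, the union of the invasion percolation clusters of all vertices. -/
def forest : SimpleGraph (List ℕ) := ⨆ u, invasionGraph ulamHarris (edgeWeight W) u

/-- The edges of `M`, the connected component of the root in `M₀`. -/
def MGraph : SimpleGraph (List ℕ) :=
  SimpleGraph.fromRel fun a b => (forest W).Adj a b ∧ (forest W).Reachable [] a

/-- The activation time `x(v)`: the largest (supremum) weight along the infinite path in `M` that
leaves `v`. This path is almost surely unique for `v` in `M`; the infimum over all such paths makes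
the definition meaningful on the exceptional null event and gives `x(v) = ∞` for `v` not in `M`. -/
def activationTime (v : List ℕ) : EReal :=
  ⨅ p ∈ {p : ℕ → List ℕ | IsRay (MGraph W) v p}, ⨆ n, (edgeWeight W (p n) (p (n + 1)) : EReal)

/-- The vertices of `M_v(ν)`: those vertices `u` of the component of `v` in `M` without the edges
of `T` that have `x(u) ≤ ν`. -/
def hangingVerts (v : List ℕ) (ν : EReal) : Set (List ℕ) :=
  {u | (MGraph W \ TGraph W).Reachable v u ∧ activationTime W u ≤ ν}

/-- `N_v(ν)`, the number of vertices of `M_v(ν)`. -/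
def hangingSize (v : List ℕ) (ν : EReal) : ℝ≥0∞ := ((hangingVerts W v ν).encard : ℝ≥0∞)

end Trees

/-! ## Survival probability, dual parameter, and the iterated integrals -/

/-- Membership of a vertex in the Galton-Watson tree in which `u` has `N u` children. -/
def InGWTree (N : List ℕ → ℕ) : List ℕ → Prop
  | [] => True
  | i :: u => InGWTree N u ∧ i < N u

/-- `θ(x)`, the probability that a Galton-Watson tree with offspring distribution Poisson(`x`)
is infinite. -/
def theta (x : ℝ) : ℝ :=
  (Measure.infinitePi fun _ : List ℕ => poissonMeasure x.toNNReal).real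
    {N | {u | InGWTree N u}.Infinite}

/-- The dual parameter `c^*` of `c > 1`: the unique `y < 1` with `y e^{-y} = c e^{-c}`. -/
def dual (c : ℝ) : ℝ := sInf {y | y < 1 ∧ y * Real.exp (-y) = c * Real.exp (-c)}

/-- `n_k(l, ν)`, the integral over `l < x₁ < ⋯ < x_k < ν` of the product of the values
`(1 - θ(x_i)) / (1 - x_i^*)`; for `k = 0` it is one. -/
def nInt (k : ℕ) (l : ℝ) (ν : EReal) : ℝ≥0∞ :=
  ∫⁻ x in {x : Fin k → ℝ | StrictMono x ∧ ∀ i, l < x i ∧ (x i : EReal) < ν},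
    ∏ i, ENNReal.ofReal ((1 - theta (x i)) / (1 - dual (x i)))

end Aggregation

end

/-! Fix the weights and, for a level y, keep only the edges of weight less than y. Every object in
the statement is governed by finiteness of the resulting clusters. A child of a vertex of T lies in
T exactly when the parent's cluster at the weight of the connecting edge is finite
(`IsRegular.cons_mem_TVerts_iff`). An edge lies in the union of all invasion clusters exactly when
one of its ends has a finite cluster at the weight of that edge (`IsRegular.forest_adj_iff`). The
activation time of a vertex of M is the threshold `level` at which its cluster becomes infinite
(`IsRegular.activationTime_eq`).

Hence what hangs off a vertex v of T is a branching structure whose types are levels. A child edge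
of weight t above the level of v belongs to it exactly when the child's own subtree has a finite
cluster at level t, and the child then has activation time t. Below a hanging vertex of level y,
edges lighter than y pass on the level y, while a heavier edge of weight t restarts the same picture
at level t (`HangGood`, `IsRegular.hangPath_cons_iff`).

Let q(y) = 1 - θ(y) be the extinction probability and h_n(y) the mean number of hanging vertices at
depth n below a root of level y. Conditioning on the atoms at the root gives h_0 = q and h_{n+1}(y)
= y q(y) h_n(y) + q(y) ∫_y^ν h_n (`hangMean_succ`). The sum H over n therefore satisfies H = r (1 +
∫_y^ν H) with r = q / (1 - y q). Since y q(y) is the dual parameter of y (`dual_eq`), r is the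
integrand of the iterated integrals, and iterating the equation gives H = r ∑ n_k (`tsum_hangMean`).

It remains to condition on v lying in T and on its level. Almost surely, membership of v in T
depends only on weights outside the subtree of v. Whether the i-th child edge exceeds the level of
v, and the level in that case, involve only the earlier children of v and what lies outside its
subtree. The compensator formula `lintegral_block` thus turns the sum over the edges above the level
into a Lebesgue integral (`lintegral_hang`), and the mean is 1 + ∫_λ^ν H = ∑ n_k(λ, ν). For the
limit at a single λ, the sum is finite, decreasing and locally Lipschitz in λ (`chainSum_ne_top`,
`exists_chainSum_le`), and the conditioning events have positive probability (`level_pos`). -/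

noncomputable section

namespace Aggregation

/-! ## Invasion percolation on a locally finite weighted graph -/

section General

variable {V : Type*} {G : SimpleGraph V} {w : V → V → ℝ}

/-- The vertices joined to `a` by a path of edges of weight less than `y`. -/
def cluster (G : SimpleGraph V) (w : V → V → ℝ) (y : ℝ) (a : V) : Set V :=
  {b | Relation.ReflTransGen (fun c d => G.Adj c d ∧ w c d < y) a b}

/-- The weights are symmetric, locally finite and distinct, and every finite set has an exit. -/
structure IsGeneric (G : SimpleGraph V) (w : V → V → ℝ) : Prop where
  symm : ∀ a b, G.Adj a b → w a b = w b a
  locFin : ∀ a y, {b | G.Adj a b ∧ w a b ≤ y}.Finite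
  exit : ∀ S : Set V, S.Finite → S.Nonempty → ∃ a ∈ S, ∃ b ∉ S, G.Adj a b
  inj : ∀ a b a' b', G.Adj a b → G.Adj a' b' → w a b = w a' b' →
    (a = a' ∧ b = b') ∨ (a = b' ∧ b = a')

lemma mem_cluster_self (y : ℝ) (a : V) : a ∈ cluster G w y a := Relation.ReflTransGen.refl

lemma cluster_step {y : ℝ} {a b c : V} (hb : b ∈ cluster G w y a) (h : G.Adj b c)
    (hw : w b c < y) : c ∈ cluster G w y a := Relation.ReflTransGen.tail hb ⟨h, hw⟩

lemma cluster_subset_of_closed {y : ℝ} {a : V} {S : Set V} (ha : a ∈ S)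
    (h : ∀ b ∈ S, ∀ c, G.Adj b c → w b c < y → c ∈ S) : cluster G w y a ⊆ S := by
  intro b hb
  induction hb with
  | refl => exact ha
  | tail _ h2 ih => exact h _ ih _ h2.1 h2.2

lemma exists_exit_of_not_subset {y : ℝ} {a : V} {S : Set V} (ha : a ∈ S)
    (h : ¬ cluster G w y a ⊆ S) : ∃ b ∈ S, ∃ c ∉ S, G.Adj b c ∧ w b c < y := by
  by_contra hc
  push Not at hc
  refine h (cluster_subset_of_closed ha fun b hb c hbc hw => ?_)
  by_contra hcS
  exact absurd hw (not_lt.2 (hc b hb c hcS hbc))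

lemma IsGeneric.mem_cluster_symm (hG : IsGeneric G w) {y : ℝ} {a b : V}
    (h : b ∈ cluster G w y a) : a ∈ cluster G w y b := by
  induction h with
  | refl => exact mem_cluster_self _ _
  | tail _ h2 ih =>
    exact Relation.ReflTransGen.head ⟨h2.1.symm, by rw [← hG.symm _ _ h2.1]; exact h2.2⟩ ih

lemma IsGeneric.cluster_eq (hG : IsGeneric G w) {y : ℝ} {a b : V}
    (h : b ∈ cluster G w y a) : cluster G w y b = cluster G w y a := by
  ext c
  exact ⟨fun hc => Relation.ReflTransGen.trans h hc,
    fun hc => Relation.ReflTransGen.trans (hG.mem_cluster_symm h) hc⟩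

lemma IsGeneric.exists_isMinExit (hG : IsGeneric G w) {S : Set V} (hS : S.Finite)
    (hne : S.Nonempty) : ∃ a b, IsMinExit G w S a b := by
  obtain ⟨a, ha, b, hb, hab⟩ := hG.exit S hS hne
  let E : Set (V × V) := {p | p.1 ∈ S ∧ p.2 ∉ S ∧ G.Adj p.1 p.2 ∧ w p.1 p.2 ≤ w a b}
  have hE : E.Finite := by
    refine Set.Finite.subset (s := ⋃ c ∈ S, (fun d => (c, d)) '' {d | G.Adj c d ∧ w c d ≤ w a b})
      (hS.biUnion fun c _ => (hG.locFin c _).image _) ?_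
    rintro ⟨c, d⟩ ⟨h1, _, h3, h4⟩
    exact Set.mem_biUnion h1 ⟨d, ⟨h3, h4⟩, rfl⟩
  obtain ⟨⟨c, d⟩, ⟨h1, h2, h3, h4⟩, hmin⟩ :=
    Set.exists_min_image E (fun p => w p.1 p.2) hE ⟨(a, b), ha, hb, hab, le_rfl⟩
  refine ⟨c, d, h1, h2, h3, fun a' ha' b' hb' hab' => ?_⟩
  rcases le_total (w a' b') (w a b) with h | h
  · exact hmin (a', b') ⟨ha', hb', hab', h⟩
  · exact h4.trans h

lemma IsGeneric.isMinExit_unique (hG : IsGeneric G w) {S : Set V} {a b a' b' : V}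
    (h : IsMinExit G w S a b) (h' : IsMinExit G w S a' b') : a = a' ∧ b = b' := by
  rcases hG.inj a b a' b' h.2.2.1 h'.2.2.1
    (le_antisymm (h.2.2.2 _ h'.1 _ h'.2.1 h'.2.2.1) (h'.2.2.2 _ h.1 _ h.2.1 h.2.2.1)) with h1 | h1
  · exact h1
  · exact absurd (h1.1 ▸ h.1) h'.2.1

lemma primSet_subset_succ (ρ : V) (n : ℕ) : primSet G w ρ n ⊆ primSet G w ρ (n + 1) :=
  Set.subset_union_left

lemma primSet_mono (ρ : V) : Monotone (primSet G w ρ) := monotone_nat_of_le_succ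
  (primSet_subset_succ ρ)

lemma root_mem_primSet (ρ : V) (n : ℕ) : ρ ∈ primSet G w ρ n :=
  primSet_mono ρ (Nat.zero_le n) rfl

lemma mem_primSet_succ_of_isMinExit {ρ : V} {n : ℕ} {a b : V}
    (h : IsMinExit G w (primSet G w ρ n) a b) : b ∈ primSet G w ρ (n + 1) := Or.inr ⟨a, h⟩

lemma IsGeneric.primSet_succ (hG : IsGeneric G w) {ρ : V} {n : ℕ} {a b : V}
    (h : IsMinExit G w (primSet G w ρ n) a b) :
    primSet G w ρ (n + 1) = insert b (primSet G w ρ n) := by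
  ext c
  constructor
  · rintro (hc | ⟨a', hc⟩)
    · exact Or.inr hc
    · exact Or.inl (hG.isMinExit_unique hc h).2
  · rintro (rfl | hc)
    · exact mem_primSet_succ_of_isMinExit h
    · exact Or.inl hc

/-- Distinct weights make the minimal exit unique, so each step adds exactly one vertex. The
invasion is therefore finite at each stage and leaves every finite set. -/
lemma IsGeneric.primSet_finite_ncard (hG : IsGeneric G w) (ρ : V) (n : ℕ) :
    (primSet G w ρ n).Finite ∧ (primSet G w ρ n).ncard = n + 1 := by
  induction n with
  | zero => exact ⟨Set.finite_singleton ρ, Set.ncard_singleton ρ⟩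
  | succ n ih =>
    obtain ⟨a, b, h⟩ := hG.exists_isMinExit ih.1 ⟨ρ, root_mem_primSet ρ n⟩
    rw [hG.primSet_succ h]
    exact ⟨ih.1.insert b, by rw [Set.ncard_insert_of_notMem h.2.1 ih.1, ih.2]⟩

lemma IsGeneric.primSet_finite (hG : IsGeneric G w) (ρ : V) (n : ℕ) :
    (primSet G w ρ n).Finite := (hG.primSet_finite_ncard ρ n).1

lemma IsGeneric.exists_primSet_not_subset (hG : IsGeneric G w) (ρ : V) {K : Set V}
    (hK : K.Finite) : ∃ n, ¬ primSet G w ρ n ⊆ K := by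
  by_contra hc
  push Not at hc
  have h1 := Set.ncard_le_ncard (hc K.ncard) hK
  rw [(hG.primSet_finite_ncard ρ _).2] at h1
  omega

lemma IsGeneric.exists_isMinExit_primSet (hG : IsGeneric G w) (ρ : V) (n : ℕ) :
    ∃ a b, IsMinExit G w (primSet G w ρ n) a b :=
  hG.exists_isMinExit (hG.primSet_finite ρ n) ⟨ρ, root_mem_primSet ρ n⟩

/-- The first exit from a finite set containing the first stages of an invasion. -/
lemma IsGeneric.exists_last_subset (hG : IsGeneric G w) (ρ : V) {K : Set V} (hK : K.Finite)
    {n₀ : ℕ} (h₀ : primSet G w ρ n₀ ⊆ K) :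
    ∃ n ≥ n₀, ∃ a b, primSet G w ρ n ⊆ K ∧ IsMinExit G w (primSet G w ρ n) a b ∧ b ∉ K := by
  classical
  have hex := hG.exists_primSet_not_subset ρ hK
  have h1 := Nat.find_spec hex
  have h2 : n₀ < Nat.find hex := by
    by_contra hlt
    exact h1 ((primSet_mono ρ (not_lt.1 hlt)).trans h₀)
  obtain ⟨m, hm⟩ : ∃ m, Nat.find hex = m + 1 := ⟨Nat.find hex - 1, by omega⟩
  have h3 : primSet G w ρ m ⊆ K := by
    have := Nat.find_min hex (m := m) (by omega)
    push Not at this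
    exact this
  obtain ⟨a, b, hab⟩ := hG.exists_isMinExit_primSet ρ m
  refine ⟨m, by omega, a, b, h3, hab, fun hb => h1 ?_⟩
  rw [hm, hG.primSet_succ hab]
  exact Set.insert_subset hb h3

/-- A finite stage cannot contain the infinite cluster of `c`, so some edge of weight less than `y`
leaves it, and the minimal exit is no heavier. -/
lemma IsGeneric.lt_of_isMinExit (hG : IsGeneric G w) {ρ : V} {n : ℕ} {a b c : V} {y : ℝ}
    (h : IsMinExit G w (primSet G w ρ n) a b) (hc : c ∈ primSet G w ρ n)
    (hy : (cluster G w y c).Infinite) : w a b < y := by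
  obtain ⟨a', ha', b', hb', hab, hlt⟩ := exists_exit_of_not_subset hc
    (fun hsub => hy ((hG.primSet_finite ρ n).subset hsub))
  exact (h.2.2.2 a' ha' b' hb' hab).trans_lt hlt

lemma invasionGraph_adj {ρ a b : V} : (invasionGraph G w ρ).Adj a b ↔
    (∃ n, IsMinExit G w (primSet G w ρ n) a b) ∨ ∃ n, IsMinExit G w (primSet G w ρ n) b a := by
  rw [invasionGraph, SimpleGraph.fromRel_adj]
  refine ⟨fun h => h.2, fun h => ⟨?_, h⟩⟩
  rcases h with ⟨n, h⟩ | ⟨n, h⟩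
  · exact h.2.2.1.ne
  · exact h.2.2.1.ne'

lemma invasionGraph_le {ρ : V} : invasionGraph G w ρ ≤ G := by
  intro a b h
  rcases invasionGraph_adj.1 h with ⟨n, h⟩ | ⟨n, h⟩
  · exact h.2.2.1
  · exact h.2.2.1.symm

lemma IsGeneric.cluster_finite_of_isMinExit (hG : IsGeneric G w) {ρ a b : V} {n : ℕ}
    (h : IsMinExit G w (primSet G w ρ n) a b) : (cluster G w (w a b) a).Finite := by
  by_contra hc
  exact lt_irrefl _ (hG.lt_of_isMinExit h h.1 hc)

/-- The invasion started at `a` fills the finite cluster before leaving it. When it is full, no exit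
is lighter than `ab`, so `ab` is a minimal exit at that stage. -/
lemma IsGeneric.exists_isMinExit_of_cluster_finite (hG : IsGeneric G w) {a b : V}
    (hab : G.Adj a b) (hfin : (cluster G w (w a b) a).Finite) (hb : b ∉ cluster G w (w a b) a) :
    ∃ n, IsMinExit G w (primSet G w a n) a b := by
  obtain ⟨n, -, c, d, hsub, hmin, hd⟩ := hG.exists_last_subset a hfin (n₀ := 0)
    (by rintro x rfl; exact mem_cluster_self _ _)
  have heq : primSet G w a n = cluster G w (w a b) a := by
    refine hsub.antisymm ?_
    by_contra hns
    obtain ⟨a', ha', b', hb', hab', hlt⟩ := exists_exit_of_not_subset (root_mem_primSet a n) hns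
    exact hd (cluster_step (hsub hmin.1) hmin.2.2.1 ((hmin.2.2.2 _ ha' _ hb' hab').trans_lt hlt))
  refine ⟨n, root_mem_primSet a n, heq ▸ hb, hab, fun a' ha' b' hb' hab' => ?_⟩
  by_contra hlt
  rw [heq] at ha' hb'
  exact hb' (cluster_step ha' hab' (not_le.1 hlt))

/-- Suppose `b` is never added. The edge by which the invasion enters the cluster `C` of `a` weighs
at least `w a b`, so all other exits available at that moment do too. Before leaving the finite set
formed by the old stage and `C`, the invasion must exhaust `C`, and then `ab` is a minimal exit. -/
lemma IsGeneric.mem_invasionVerts_of_cluster_finite (hG : IsGeneric G w) {ρ a b : V}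
    (ha : a ∈ invasionVerts G w ρ) (hab : G.Adj a b) (hfin : (cluster G w (w a b) a).Finite) :
    b ∈ invasionVerts G w ρ := by
  classical
  by_contra hb
  have hbn : ∀ n, b ∉ primSet G w ρ n := fun n hn => hb (Set.mem_iUnion.2 ⟨n, hn⟩)
  set C := cluster G w (w a b) a with hC
  have hCst : ∀ c ∈ C, ∀ d ∉ C, G.Adj c d → w a b ≤ w c d := fun c hc d hd hcd =>
    not_lt.1 fun hlt => hd (cluster_step hc hcd hlt)
  have hmeet : ∃ n, (primSet G w ρ n ∩ C).Nonempty := by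
    obtain ⟨n, hn⟩ := Set.mem_iUnion.1 ha
    exact ⟨n, a, hn, mem_cluster_self _ _⟩
  -- `n` is the first stage meeting `C`, and `K` is the stage just before it, or empty if the
  -- invasion starts inside `C`.
  obtain ⟨n, K, hKfin, hnK, ⟨c, hcn, hcC⟩, hKexit⟩ : ∃ (n : ℕ) (K : Set V), K.Finite ∧
      primSet G w ρ n ⊆ K ∪ C ∧ (primSet G w ρ n ∩ C).Nonempty ∧
      ∀ c ∈ K, ∀ d ∉ primSet G w ρ n, G.Adj c d → w a b ≤ w c d := by
    have h1 := Nat.find_spec hmeet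
    have h2 := fun m => Nat.find_min hmeet (m := m)
    rcases hk : Nat.find hmeet with _ | k
    · rw [hk] at h1
      refine ⟨0, ∅, Set.finite_empty, ?_, h1, by simp⟩
      obtain ⟨x, rfl, hx⟩ := h1
      rintro z rfl
      exact Or.inr hx
    · rw [hk] at h1
      have h3 := h2 k (by omega)
      rw [Set.not_nonempty_iff_eq_empty] at h3
      obtain ⟨c, d, hcd⟩ := hG.exists_isMinExit_primSet ρ k
      have h4 := hG.primSet_succ hcd
      have hdC : d ∈ C := by
        obtain ⟨x, hx, hxC⟩ := h1
        rw [h4] at hx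
        rcases hx with rfl | hx
        · exact hxC
        · exact (h3.subset ⟨hx, hxC⟩).elim
      have hcC : c ∉ C := fun hcC => (h3.subset ⟨hcd.1, hcC⟩).elim
      have hle : w a b ≤ w c d := by
        rw [hG.symm _ _ hcd.2.2.1]
        exact hCst d hdC c hcC hcd.2.2.1.symm
      refine ⟨k + 1, primSet G w ρ k, hG.primSet_finite ρ k, ?_, h1, fun c' hc' d' hd' hcd' => ?_⟩
      · rw [h4]
        rintro x (rfl | hx)
        · exact Or.inr hdC
        · exact Or.inl hx
      · exact hle.trans (hcd.2.2.2 c' hc' d' (fun h => hd' (primSet_subset_succ ρ k h)) hcd')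
  obtain ⟨m, hm, c', d', hsub, hmin, hd'⟩ := hG.exists_last_subset ρ (hKfin.union hfin) hnK
  have hge : w a b ≤ w c' d' := by
    rcases hsub hmin.1 with h | h
    · exact hKexit c' h d' (fun h' => hmin.2.1 (primSet_mono ρ hm h')) hmin.2.2.1
    · exact hCst c' h d' (fun h' => hd' (Or.inr h')) hmin.2.2.1
  have hCsub : C ⊆ primSet G w ρ m := by
    by_contra hns
    rw [hC, ← hG.cluster_eq hcC] at hns
    obtain ⟨a', ha', b', hb', hab', hlt⟩ := exists_exit_of_not_subset (primSet_mono ρ hm hcn) hns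
    exact absurd (hmin.2.2.2 _ ha' _ hb' hab') (not_le.2 (hlt.trans_le hge))
  have ham : a ∈ primSet G w ρ m := hCsub (mem_cluster_self _ _)
  exact hbn (m + 1) (mem_primSet_succ_of_isMinExit ⟨ham, hbn m, hab,
    fun a' ha' b' hb' h => hge.trans (hmin.2.2.2 a' ha' b' hb' h)⟩)

/-! ### Rays in invasion clusters -/

/-- König's lemma for graphs. -/
lemma exists_isRay_of_infinite {K : SimpleGraph V} {v : V} (hfin : ∀ a, {b | K.Adj a b}.Finite)
    (hinf : {u | K.Reachable v u}.Infinite) : ∃ p, IsRay K v p := by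
  classical
  -- `Des a` consists of the vertices with a geodesic from `v` passing through `a`. Following
  -- infinite sets `Des` outwards makes the distance to `v` grow by one at each step, which gives
  -- injectivity.
  let Des : V → Set V := fun a => {u | K.Reachable a u ∧ K.dist v u = K.dist v a + K.dist a u}
  have hstep : ∀ a : {a // K.Reachable v a ∧ (Des a).Infinite},
      ∃ b : {a // K.Reachable v a ∧ (Des a).Infinite},
        K.Adj a.1 b.1 ∧ K.dist v b.1 = K.dist v a.1 + 1 := by
    rintro ⟨a, hva, ha⟩
    have hsub : Des a ⊆ {a} ∪ ⋃ b ∈ {b | K.Adj a b},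
        {u | u ∈ Des b ∧ K.dist v b = K.dist v a + 1} := by
      rintro u ⟨hau, hd⟩
      by_cases hne : u = a
      · exact Or.inl hne
      right
      obtain ⟨p, hp⟩ := hau.exists_walk_length_eq_dist
      cases p with
      | nil => exact absurd rfl hne
      | @cons _ b _ hab p =>
        rw [SimpleGraph.Walk.length_cons] at hp
        have h1 : K.dist b u ≤ p.length := SimpleGraph.dist_le p
        have h2 : K.dist v b ≤ K.dist v a + 1 := by
          obtain ⟨q, hq⟩ := hva.exists_walk_length_eq_dist
          have := SimpleGraph.dist_le (q.concat hab)
          rw [SimpleGraph.Walk.length_concat] at this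
          omega
        have h3 : K.dist v u ≤ K.dist v b + K.dist b u := by
          obtain ⟨q, hq⟩ := (hva.trans hab.reachable).exists_walk_length_eq_dist
          obtain ⟨r, hr⟩ := p.reachable.exists_walk_length_eq_dist
          have := SimpleGraph.dist_le (q.append r)
          rw [SimpleGraph.Walk.length_append] at this
          omega
        refine Set.mem_biUnion (x := b) hab ⟨⟨p.reachable, ?_⟩, ?_⟩ <;> omega
    have : ∃ b, K.Adj a b ∧ {u | u ∈ Des b ∧ K.dist v b = K.dist v a + 1}.Infinite := by
      by_contra hc
      push Not at hc
      exact ha (((Set.finite_singleton a).union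
        ((hfin a).biUnion fun b hb => hc b hb)).subset hsub)
    obtain ⟨b, hab, hb⟩ := this
    obtain ⟨u, -, hu⟩ := hb.nonempty
    exact ⟨⟨b, hva.trans hab.reachable, hb.mono fun _ h => h.1⟩, hab, hu⟩
  choose nxt hn1 hn2 using hstep
  let a₀ : {a // K.Reachable v a ∧ (Des a).Infinite} :=
    ⟨v, SimpleGraph.Reachable.refl v, hinf.mono fun u hu => ⟨hu, by simp⟩⟩
  let p : ℕ → {a // K.Reachable v a ∧ (Des a).Infinite} := fun n => nxt^[n] a₀
  have hp : ∀ n, p (n + 1) = nxt (p n) := fun n => Function.iterate_succ_apply' nxt n a₀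
  have hd : ∀ n, K.dist v (p n).1 = n := by
    intro n
    induction n with
    | zero => simp [p, a₀]
    | succ n ih => rw [hp, hn2, ih]
  refine ⟨fun n => (p n).1, rfl, fun m n hmn => ?_, fun n => ?_⟩
  · have := congrArg (K.dist v) hmn
    simpa [hd] using this
  · change K.Adj (p n).1 (p (n + 1)).1
    rw [hp]
    exact hn1 _

lemma invasionGraph_reachable {v u : V} {n : ℕ} (hu : u ∈ primSet G w v n) :
    (invasionGraph G w v).Reachable v u := by
  induction n generalizing u with
  | zero => obtain rfl : u = v := hu; exact SimpleGraph.Reachable.refl _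
  | succ n ih =>
    rcases hu with hu | ⟨a, hu⟩
    · exact ih hu
    · exact (ih hu.1).trans (invasionGraph_adj.2 (Or.inl ⟨n, hu⟩)).reachable

/-- An infinite cluster at level `z` keeps the invasion from `v` on edges lighter than `z`. The
invasion graph is then locally finite and infinite, so König's lemma applies. -/
lemma IsGeneric.exists_isRay_invasionGraph (hG : IsGeneric G w) {v : V} {z : ℝ}
    (hz : (cluster G w z v).Infinite) :
    ∃ p, IsRay (invasionGraph G w v) v p ∧ ∀ n, w (p n) (p (n + 1)) < z := by
  have hlt : ∀ a b, (invasionGraph G w v).Adj a b → w a b < z := by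
    intro a b hab
    rcases invasionGraph_adj.1 hab with ⟨n, h⟩ | ⟨n, h⟩
    · exact hG.lt_of_isMinExit h (root_mem_primSet v n) hz
    · rw [hG.symm a b h.2.2.1.symm]
      exact hG.lt_of_isMinExit h (root_mem_primSet v n) hz
  obtain ⟨p, hp⟩ := exists_isRay_of_infinite (K := invasionGraph G w v) (v := v)
    (fun a => (hG.locFin a z).subset fun b hb => ⟨invasionGraph_le hb, (hlt a b hb).le⟩)
    (fun hfin => by
      obtain ⟨n, hn⟩ := hG.exists_primSet_not_subset v hfin
      exact hn fun u hu => invasionGraph_reachable hu)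
  exact ⟨p, hp, fun n => hlt _ _ (hp.2.2 n)⟩

end General

/-! ## Clusters of the weighted Ulam-Harris tree -/

/-- The weights of the subtree of descendants of `v`. -/
def shift (v : List ℕ) (f : List ℕ → ℕ → ℝ) : List ℕ → ℕ → ℝ := fun u => f (u ++ v)

@[simp] lemma shift_nil (f : List ℕ → ℕ → ℝ) : shift [] f = f := by
  funext u; simp [shift]

lemma shift_shift (u v : List ℕ) (f : List ℕ → ℕ → ℝ) :
    shift u (shift v f) = shift (u ++ v) f := by
  funext x; simp [shift]

lemma shift_singleton_shift (i : ℕ) (v : List ℕ) (f : List ℕ → ℕ → ℝ) :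
    shift [i] (shift v f) = shift (i :: v) f := shift_shift [i] v f

@[simp] lemma shift_apply_nil (v : List ℕ) (f : List ℕ → ℕ → ℝ) : shift v f [] = f v := rfl

/-- All weights on the path from the root to a vertex are less than `y`. -/
def BelowOpen (f : List ℕ → ℕ → ℝ) (y : ℝ) : List ℕ → Prop
  | [] => True
  | i :: u => BelowOpen f y u ∧ f u i < y

/-- The cluster of the root formed by the edges of weight less than `y` is finite. -/
def FinBelow (f : List ℕ → ℕ → ℝ) (y : ℝ) : Prop := {l | BelowOpen f y l}.Finite

/-- Infinitely many vertices outside the subtree of `v` are joined to `v` by edges of weight less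
than `y`. -/
def UpInf (f : List ℕ → ℕ → ℝ) (y : ℝ) : List ℕ → Prop
  | [] => False
  | i :: u => f u i < y ∧
      (UpInf f y u ∨ ∃ j, j ≠ i ∧ f u j < y ∧ ¬ FinBelow (shift (j :: u) f) y)

/-- The cluster of `v` formed by the edges of weight less than `y` is infinite. -/
def ClusterInf (f : List ℕ → ℕ → ℝ) (y : ℝ) (v : List ℕ) : Prop :=
  UpInf f y v ∨ ¬ FinBelow (shift v f) y

/-- The weights to the children of every vertex increase to infinity, and all weights differ. -/
structure IsRegular (f : List ℕ → ℕ → ℝ) : Prop where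
  strictMono : ∀ u, StrictMono (f u)
  tendsto : ∀ u, Tendsto (f u) atTop atTop
  inj : ∀ u i u' i', f u i = f u' i' → u = u' ∧ i = i'

lemma BelowOpen.mono {f : List ℕ → ℕ → ℝ} {y z : ℝ} (h : y ≤ z) {l : List ℕ}
    (hl : BelowOpen f y l) : BelowOpen f z l := by
  induction l with
  | nil => trivial
  | cons i u ih => exact ⟨ih hl.1, hl.2.trans_le h⟩

lemma FinBelow.anti {f : List ℕ → ℕ → ℝ} {y z : ℝ} (h : y ≤ z) (hz : FinBelow f z) :
    FinBelow f y := Set.Finite.subset hz fun _ hl => hl.mono h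

lemma UpInf.mono {f : List ℕ → ℕ → ℝ} {y z : ℝ} (h : y ≤ z) {v : List ℕ}
    (hv : UpInf f y v) : UpInf f z v := by
  induction v with
  | nil => exact hv
  | cons i u ih =>
    refine ⟨hv.1.trans_le h, hv.2.imp ih ?_⟩
    rintro ⟨j, h1, h2, h3⟩
    exact ⟨j, h1, h2.trans_le h, fun h' => h3 (h'.anti h)⟩

/-- Addresses are stored with the deepest index first, so appending at the end splits off the first
step from the root. -/
lemma belowOpen_append_singleton {f : List ℕ → ℕ → ℝ} {y : ℝ} {l : List ℕ} {i : ℕ} :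
    BelowOpen f y (l ++ [i]) ↔ f [] i < y ∧ BelowOpen (shift [i] f) y l := by
  induction l with
  | nil => simp [BelowOpen]
  | cons j l ih =>
    simp only [List.cons_append, BelowOpen, ih, shift]
    tauto

lemma finite_setOf_le {b : ℕ → ℝ} (hb : Tendsto b atTop atTop) (y : ℝ) : {i | b i ≤ y}.Finite := by
  obtain ⟨n, hn⟩ := eventually_atTop.1 (hb.eventually_gt_atTop y)
  exact (Set.finite_Iio n).subset fun i hi => by
    by_contra h
    exact absurd hi (not_le.2 (hn i (not_lt.1 h)))

/-- The branching recursion at the root: divergence of the weights leaves only finitely many open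
children, so finiteness can be tested child by child. -/
lemma finBelow_iff {f : List ℕ → ℕ → ℝ} {y : ℝ} (hf : Tendsto (f []) atTop atTop) :
    FinBelow f y ↔ ∀ i, f [] i < y → FinBelow (shift [i] f) y := by
  constructor
  · intro h i hi
    refine Set.Finite.of_finite_image (f := (· ++ [i])) (Set.Finite.subset h ?_)
      (fun _ _ _ _ h => List.append_cancel_right h)
    rintro _ ⟨l, hl, rfl⟩
    exact belowOpen_append_singleton.2 ⟨hi, hl⟩
  · intro h
    have hfin : {i | f [] i < y}.Finite := (finite_setOf_le hf y).subset fun i hi => le_of_lt (α := ℝ) hi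
    refine ((Set.finite_singleton []).union (hfin.biUnion (t := fun i => (· ++ [i]) ''
      {l | BelowOpen (shift [i] f) y l}) fun i hi => (h i hi).image _)).subset ?_
    intro l hl
    rcases List.eq_nil_or_concat' l with rfl | ⟨l, i, rfl⟩
    · exact Or.inl rfl
    · have := belowOpen_append_singleton.1 hl
      exact Or.inr (Set.mem_biUnion (x := i) this.1 ⟨l, this.2, rfl⟩)

lemma ulamHarris_adj {a b : List ℕ} :
    ulamHarris.Adj a b ↔ (∃ i, b = i :: a) ∨ ∃ i, a = i :: b := by
  rw [ulamHarris, SimpleGraph.fromRel_adj]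
  refine ⟨fun h => h.2, fun h => ⟨?_, h⟩⟩
  rintro rfl
  rcases h with ⟨i, h⟩ | ⟨i, h⟩ <;> simpa using congrArg List.length h

lemma ulamHarris_adj_cons (i : ℕ) (u : List ℕ) : ulamHarris.Adj u (i :: u) :=
  ulamHarris_adj.2 (Or.inl ⟨i, rfl⟩)

@[simp] lemma edgeWeight_down (f : List ℕ → ℕ → ℝ) (i : ℕ) (u : List ℕ) :
    edgeWeight f u (i :: u) = f u i := by simp [edgeWeight, parentWeight]

@[simp] lemma edgeWeight_up (f : List ℕ → ℕ → ℝ) (i : ℕ) (u : List ℕ) :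
    edgeWeight f (i :: u) u = f u i := by simp [edgeWeight, parentWeight]

lemma IsRegular.isGeneric {f : List ℕ → ℕ → ℝ} (hf : IsRegular f) :
    IsGeneric ulamHarris (edgeWeight f) where
  symm a b h := by
    rcases ulamHarris_adj.1 h with ⟨i, rfl⟩ | ⟨i, rfl⟩ <;> simp
  locFin a y := by
    refine ((Set.finite_singleton a.tail).union
      ((finite_setOf_le (hf.tendsto a) y).image (· :: a))).subset ?_
    rintro b ⟨hb, hy⟩
    rcases ulamHarris_adj.1 hb with ⟨i, rfl⟩ | ⟨i, rfl⟩
    · exact Or.inr ⟨i, by simpa using hy, rfl⟩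
    · exact Or.inl rfl
  exit S hS hne := by
    obtain ⟨a, ha⟩ := hne
    have : ∃ i, i :: a ∉ S := by
      by_contra hc
      push Not at hc
      refine Set.infinite_of_injective_forall_mem (f := fun i : ℕ => i :: a) ?_ hc hS
      intro i j h
      simpa using h
    obtain ⟨i, hi⟩ := this
    exact ⟨a, ha, _, hi, ulamHarris_adj_cons i a⟩
  inj a b a' b' h h' heq := by
    rcases ulamHarris_adj.1 h with ⟨i, rfl⟩ | ⟨i, rfl⟩ <;>
    rcases ulamHarris_adj.1 h' with ⟨j, rfl⟩ | ⟨j, rfl⟩ <;>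
    · simp only [edgeWeight_up, edgeWeight_down] at heq
      obtain ⟨rfl, rfl⟩ := hf.inj _ _ _ _ heq
      simp

/-- The cluster of `v` in the weighted Ulam-Harris tree. -/
abbrev treeCluster (f : List ℕ → ℕ → ℝ) (y : ℝ) (v : List ℕ) : Set (List ℕ) :=
  cluster ulamHarris (edgeWeight f) y v

lemma append_mem_treeCluster {f : List ℕ → ℕ → ℝ} {y : ℝ} {v l : List ℕ}
    (hl : BelowOpen (shift v f) y l) : l ++ v ∈ treeCluster f y v := by
  induction l with
  | nil => exact mem_cluster_self _ _
  | cons i l ih =>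
    exact cluster_step (ih hl.1) (ulamHarris_adj_cons i (l ++ v))
      ((edgeWeight_down f i (l ++ v)).trans_lt hl.2)

lemma IsRegular.treeCluster_cons {f : List ℕ → ℕ → ℝ} (hf : IsRegular f) {y : ℝ} {i : ℕ}
    {u : List ℕ} (h : f u i < y) : treeCluster f y (i :: u) = treeCluster f y u :=
  hf.isGeneric.cluster_eq (cluster_step (mem_cluster_self _ _) (ulamHarris_adj_cons i u)
    (by rwa [edgeWeight_down]))

/-- If the edge to the parent is closed, the cluster cannot leave the subtree of `v`. -/
lemma treeCluster_eq_below {f : List ℕ → ℕ → ℝ} {y : ℝ} {v : List ℕ}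
    (h : ∀ i u, v = i :: u → y ≤ f u i) :
    treeCluster f y v = (· ++ v) '' {l | BelowOpen (shift v f) y l} := by
  have hv : v ∈ (· ++ v) '' {l | BelowOpen (shift v f) y l} := ⟨[], trivial, rfl⟩
  refine (cluster_subset_of_closed hv ?_).antisymm ?_
  · rintro _ ⟨l, hl, rfl⟩ c hc hw
    rcases ulamHarris_adj.1 hc with ⟨i, rfl⟩ | ⟨i, hi⟩
    · have hw' : f (l ++ v) i < y := by simpa using hw
      exact ⟨i :: l, ⟨hl, hw'⟩, rfl⟩
    · cases l with
      | nil =>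
        have hv : v = i :: c := hi
        subst hv
        exact absurd hw (not_lt.2 (by simpa using h i c rfl))
      | cons j l =>
        simp only [List.cons_append, List.cons.injEq] at hi
        exact ⟨l, hl.1, hi.2⟩
  · rintro _ ⟨l, hl, rfl⟩
    exact append_mem_treeCluster hl

lemma treeCluster_infinite_iff_of_le {f : List ℕ → ℕ → ℝ} {y : ℝ} {v : List ℕ}
    (h : ∀ i u, v = i :: u → y ≤ f u i) :
    (treeCluster f y v).Infinite ↔ ¬ FinBelow (shift v f) y := by
  rw [treeCluster_eq_below h, Set.infinite_image_iff]
  · rfl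
  · exact fun _ _ _ _ h => List.append_cancel_right h

lemma upInf_cons {f : List ℕ → ℕ → ℝ} {y : ℝ} {i : ℕ} {u : List ℕ} : UpInf f y (i :: u) ↔
    f u i < y ∧ (UpInf f y u ∨ ∃ j, j ≠ i ∧ f u j < y ∧ ¬ FinBelow (shift (j :: u) f) y) := Iff.rfl

lemma clusterInf_iff {f : List ℕ → ℕ → ℝ} {y : ℝ} {v : List ℕ}
    (hf : Tendsto (f v) atTop atTop) : ClusterInf f y v ↔
    UpInf f y v ∨ ∃ j, f v j < y ∧ ¬ FinBelow (shift (j :: v) f) y := by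
  rw [ClusterInf, finBelow_iff (by simpa using hf)]
  push Not
  simp only [shift_singleton_shift, shift_apply_nil]

/-- Induction on the depth of `v`: an open edge to the parent merges the cluster with that of the
parent, and a closed one confines it to the subtree. -/
lemma IsRegular.clusterInf_iff_infinite {f : List ℕ → ℕ → ℝ} (hf : IsRegular f) {y : ℝ}
    {v : List ℕ} : ClusterInf f y v ↔ (treeCluster f y v).Infinite := by
  induction v with
  | nil =>
    rw [treeCluster_infinite_iff_of_le (by simp), ClusterInf]
    simp [UpInf]
  | cons i u ih =>
    by_cases h : f u i < y
    · rw [hf.treeCluster_cons h, ← ih, clusterInf_iff (hf.tendsto u), ClusterInf, upInf_cons]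
      constructor
      · rintro (⟨_, h1 | ⟨j, _, h2⟩⟩ | h1)
        · exact Or.inl h1
        · exact Or.inr ⟨j, h2⟩
        · exact Or.inr ⟨i, h, h1⟩
      · rintro (h1 | ⟨j, h2⟩)
        · exact Or.inl ⟨h, Or.inl h1⟩
        · by_cases hj : j = i
          · subst hj; exact Or.inr h2.2
          · exact Or.inl ⟨h, Or.inr ⟨j, hj, h2⟩⟩
    · rw [treeCluster_infinite_iff_of_le, ClusterInf, upInf_cons]
      · tauto
      · rintro j w hjw
        simp only [List.cons.injEq] at hjw
        obtain ⟨rfl, rfl⟩ := hjw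
        exact not_lt.1 h

lemma ClusterInf.mono {f : List ℕ → ℕ → ℝ} {y z : ℝ} (h : y ≤ z) {v : List ℕ}
    (hv : ClusterInf f y v) : ClusterInf f z v :=
  hv.imp (UpInf.mono h) fun h' h'' => h' (h''.anti h)

/-! ### Thresholds and activation levels -/

/-- The infimum of the real numbers with a given property. -/
def thr (A : ℝ → Prop) : EReal := ⨅ (y : ℝ) (_ : A y), (y : EReal)

lemma thr_lt_iff {A : ℝ → Prop} {c : EReal} : thr A < c ↔ ∃ y, A y ∧ (y : EReal) < c := by
  simp [thr, iInf_lt_iff]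

lemma thr_le {A : ℝ → Prop} {y : ℝ} (h : A y) : thr A ≤ y := iInf₂_le y h

/-- A threshold below `t` is determined by what happens below `t`. This localisation later removes
the children with weights at least `t` from the level of a vertex. -/
lemma thr_congr_of_lt {A B : ℝ → Prop} {t : ℝ} (h : ∀ y < t, A y ↔ B y)
    (hA : thr A < t) : thr A = thr B := by
  have key : ∀ {A B : ℝ → Prop}, (∀ y < t, A y ↔ B y) → thr A < t → thr B ≤ thr A := by
    intro A B h hA
    refine le_of_forall_gt fun c hc => ?_
    obtain ⟨y, hy, hyc⟩ := thr_lt_iff.1 (lt_min hc hA)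
    exact thr_lt_iff.2 ⟨y, (h y (by exact_mod_cast (lt_min_iff.1 hyc).2)).1 hy,
      (lt_min_iff.1 hyc).1⟩
  have h1 := key h hA
  exact (key (fun y hy => (h y hy).symm) (h1.trans_lt hA)).antisymm h1

lemma thr_lt_congr {A B : ℝ → Prop} {t : ℝ} (h : ∀ y < t, A y ↔ B y) :
    thr A < t ↔ thr B < t := by
  simp only [thr_lt_iff, EReal.coe_lt_coe_iff]
  exact ⟨fun ⟨y, h1, h2⟩ => ⟨y, (h y h2).1 h1, h2⟩, fun ⟨y, h1, h2⟩ => ⟨y, (h y h2).2 h1, h2⟩⟩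

/-- The smallest level above which the cluster of `v` is infinite. -/
def level (f : List ℕ → ℕ → ℝ) (v : List ℕ) : EReal := thr fun y => ClusterInf f y v

/-- An explicit description of the vertices of `T`. -/
def InvasionMem (f : List ℕ → ℕ → ℝ) : List ℕ → Prop
  | [] => True
  | i :: u => InvasionMem f u ∧ ¬ ClusterInf f (f u i) u


/-! ## The trees `T` and `M` in terms of clusters -/

section Forest

variable {f : List ℕ → ℕ → ℝ}

/-- From the root, a vertex can only be entered through its parent: entering it from one of its
children would require that child, and hence the vertex itself, to be present already. -/
lemma exists_isMinExit_of_cons_mem {i n : ℕ} {u : List ℕ}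
    (h : i :: u ∈ primSet ulamHarris (edgeWeight f) [] n) :
    u ∈ primSet ulamHarris (edgeWeight f) [] n ∧
      ∃ m, IsMinExit ulamHarris (edgeWeight f) (primSet ulamHarris (edgeWeight f) [] m) u
        (i :: u) := by
  induction n generalizing i u with
  | zero => exact absurd h (List.cons_ne_nil i u)
  | succ n ih =>
    rcases h with h | ⟨a, h⟩
    · exact ⟨primSet_subset_succ _ _ (ih h).1, (ih h).2⟩
    · rcases ulamHarris_adj.1 h.2.2.1 with ⟨j, hj⟩ | ⟨j, rfl⟩
      · simp only [List.cons.injEq] at hj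
        obtain ⟨rfl, rfl⟩ := hj
        exact ⟨primSet_subset_succ _ _ h.1, n, h⟩
      · exact absurd (ih h.1).1 h.2.1

lemma mem_TVerts_of_cons {i : ℕ} {u : List ℕ} (h : i :: u ∈ TVerts f) : u ∈ TVerts f := by
  obtain ⟨n, hn⟩ := Set.mem_iUnion.1 h
  exact Set.mem_iUnion.2 ⟨n, (exists_isMinExit_of_cons_mem hn).1⟩

lemma IsRegular.cons_mem_TVerts_iff (hf : IsRegular f) {i : ℕ} {u : List ℕ} (hu : u ∈ TVerts f) :
    i :: u ∈ TVerts f ↔ ¬ ClusterInf f (f u i) u := by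
  rw [hf.clusterInf_iff_infinite, Set.not_infinite]
  constructor
  · intro h
    obtain ⟨n, hn⟩ := Set.mem_iUnion.1 h
    obtain ⟨-, m, hm⟩ := exists_isMinExit_of_cons_mem hn
    simpa using hf.isGeneric.cluster_finite_of_isMinExit hm
  · intro h
    exact hf.isGeneric.mem_invasionVerts_of_cluster_finite hu (ulamHarris_adj_cons i u)
      (by simpa using h)

lemma IsRegular.mem_TVerts_iff (hf : IsRegular f) {v : List ℕ} :
    v ∈ TVerts f ↔ InvasionMem f v := by
  induction v with
  | nil => exact ⟨fun _ => trivial, fun _ => Set.mem_iUnion.2 ⟨0, rfl⟩⟩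
  | cons i u ih =>
    rw [InvasionMem, ← ih]
    exact ⟨fun h => ⟨mem_TVerts_of_cons h, (hf.cons_mem_TVerts_iff (mem_TVerts_of_cons h)).1 h⟩,
      fun h => (hf.cons_mem_TVerts_iff h.1).2 h.2⟩

lemma TGraph_adj_of_cons_mem {i : ℕ} {u : List ℕ} (h : i :: u ∈ TVerts f) :
    (TGraph f).Adj u (i :: u) := by
  obtain ⟨n, hn⟩ := Set.mem_iUnion.1 h
  obtain ⟨-, m, hm⟩ := exists_isMinExit_of_cons_mem hn
  exact invasionGraph_adj.2 (Or.inl ⟨m, hm⟩)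

lemma mem_TVerts_of_adj {u v : List ℕ} (h : (TGraph f).Adj u v) : v ∈ TVerts f := by
  rcases invasionGraph_adj.1 h with ⟨n, h⟩ | ⟨n, h⟩
  · exact Set.mem_iUnion.2 ⟨n + 1, mem_primSet_succ_of_isMinExit h⟩
  · exact Set.mem_iUnion.2 ⟨n, h.1⟩

lemma forest_reachable {v : List ℕ} (h : v ∈ TVerts f) : (forest f).Reachable [] v := by
  obtain ⟨n, hn⟩ := Set.mem_iUnion.1 h
  exact (invasionGraph_reachable hn).mono
    (le_iSup (fun u => invasionGraph ulamHarris (edgeWeight f) u) [])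

/-- Openness is strict, so at the level of its own weight the edge to the parent is closed and only
the subtree matters. -/
lemma IsRegular.treeCluster_child_infinite_iff (i : ℕ) (u : List ℕ) :
    (treeCluster f (f u i) (i :: u)).Infinite ↔ ¬ FinBelow (shift (i :: u) f) (f u i) := by
  refine treeCluster_infinite_iff_of_le ?_
  rintro j w hjw
  simp only [List.cons.injEq] at hjw
  obtain ⟨rfl, rfl⟩ := hjw
  exact le_rfl

lemma parent_notMem_treeCluster (i : ℕ) (u : List ℕ) : u ∉ treeCluster f (f u i) (i :: u) := by
  rw [treeCluster_eq_below]
  · rintro ⟨l, -, hl⟩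
    have := congrArg List.length hl
    simp only [List.length_append, List.length_cons] at this
    omega
  · rintro j w hjw
    simp only [List.cons.injEq] at hjw
    obtain ⟨rfl, rfl⟩ := hjw
    exact le_rfl

/-- An invasion that crosses the edge has a finite cluster at the end it comes from. Conversely, an
end with a finite cluster crosses the edge in its own invasion. -/
lemma IsRegular.forest_adj_iff (hf : IsRegular f) {i : ℕ} {u : List ℕ} :
    (forest f).Adj u (i :: u) ↔
      ¬ ClusterInf f (f u i) u ∨ FinBelow (shift (i :: u) f) (f u i) := by
  rw [hf.clusterInf_iff_infinite, Set.not_infinite,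
    ← not_iff_not.2 (IsRegular.treeCluster_child_infinite_iff i u |>.trans Iff.rfl) |>.trans not_not,
    Set.not_infinite, forest, SimpleGraph.iSup_adj]
  constructor
  · rintro ⟨ρ, h⟩
    rcases invasionGraph_adj.1 h with ⟨n, h⟩ | ⟨n, h⟩
    · exact Or.inl (by simpa using hf.isGeneric.cluster_finite_of_isMinExit h)
    · exact Or.inr (by simpa using hf.isGeneric.cluster_finite_of_isMinExit h)
  · rintro (h | h)
    · obtain ⟨n, hn⟩ := hf.isGeneric.exists_isMinExit_of_cluster_finite (ulamHarris_adj_cons i u)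
        (by simpa using h) (by
          rw [edgeWeight_down]
          exact fun h' => parent_notMem_treeCluster i u (hf.isGeneric.mem_cluster_symm h'))
      exact ⟨u, invasionGraph_adj.2 (Or.inl ⟨n, hn⟩)⟩
    · obtain ⟨n, hn⟩ := hf.isGeneric.exists_isMinExit_of_cluster_finite
        (ulamHarris_adj_cons i u).symm (by simpa using h) (by
          rw [edgeWeight_up]
          exact parent_notMem_treeCluster i u)
      exact ⟨i :: u, invasionGraph_adj.2 (Or.inr ⟨n, hn⟩)⟩

lemma forest_le : forest f ≤ ulamHarris := iSup_le fun _ => invasionGraph_le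

lemma MGraph_adj {a b : List ℕ} :
    (MGraph f).Adj a b ↔ (forest f).Adj a b ∧ (forest f).Reachable [] a := by
  rw [MGraph, SimpleGraph.fromRel_adj]
  constructor
  · rintro ⟨-, h | h⟩
    · exact h
    · exact ⟨h.1.symm, h.2.trans h.1.reachable⟩
  · exact fun h => ⟨h.1.ne, Or.inl h⟩

/-- If the cluster at `z` is infinite, the invasion of `v` contains a ray lying in M with all
weights below `z`. Conversely, a ray whose supremum is below `z` puts infinitely many vertices in
the cluster at `z`. -/
lemma IsRegular.activationTime_eq (hf : IsRegular f) {v : List ℕ}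
    (hv : (forest f).Reachable [] v) : activationTime f v = level f v := by
  apply le_antisymm
  · refine le_iInf₂ fun z hz => ?_
    obtain ⟨p, hp, hlt⟩ :=
      hf.isGeneric.exists_isRay_invasionGraph (hf.clusterInf_iff_infinite.1 hz)
    have hadj : ∀ n, (forest f).Adj (p n) (p (n + 1)) := fun n =>
      le_iSup (fun u => invasionGraph ulamHarris (edgeWeight f) u) v (hp.2.2 n)
    have hr : ∀ n, (forest f).Reachable [] (p n) := by
      intro n
      induction n with
      | zero => rw [hp.1]; exact hv
      | succ n ih => exact ih.trans (hadj n).reachable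
    refine iInf₂_le_of_le p ⟨hp.1, hp.2.1, fun n => MGraph_adj.2 ⟨hadj n, hr n⟩⟩ ?_
    exact iSup_le fun n => EReal.coe_le_coe_iff.2 (hlt n).le
  · refine le_iInf₂ fun p hp => le_of_forall_gt fun c hc => ?_
    obtain ⟨z, hz1, hz2⟩ := EReal.lt_iff_exists_real_btwn.1 hc
    refine (thr_le (hf.clusterInf_iff_infinite.2 ?_)).trans_lt hz2
    refine Set.infinite_of_injective_forall_mem hp.2.1 fun n => ?_
    induction n with
    | zero => rw [hp.1]; exact mem_cluster_self _ _
    | succ n ih =>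
      refine cluster_step ih (forest_le (MGraph_adj.1 (hp.2.2 n)).1) ?_
      exact EReal.coe_lt_coe_iff.1 ((le_iSup (fun n =>
        (edgeWeight f (p n) (p (n + 1)) : EReal)) n).trans_lt hz1)

/-! ## The vertices of `M_v(ν)` -/

/-- All edges on the path from `v` to its descendant `l ++ v` lie in `M` and not in `T`. -/
def HangPath (f : List ℕ → ℕ → ℝ) (v : List ℕ) : List ℕ → Prop
  | [] => True
  | j :: l => HangPath f v l ∧ (MGraph f \ TGraph f).Adj (l ++ v) (j :: (l ++ v))

lemma hangPath_append {v l : List ℕ} {i : ℕ} : HangPath f v (l ++ [i]) ↔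
    (MGraph f \ TGraph f).Adj v (i :: v) ∧ HangPath f (i :: v) l := by
  induction l with
  | nil => simp [HangPath]
  | cons j l ih =>
    simp only [List.cons_append, HangPath, ih, List.append_assoc, List.nil_append]
    tauto

/-- The edge from `v` to its parent is removed because it lies in T, and the ambient graph is a
tree, so the component consists of descendants reached by downward paths. -/
lemma hang_reachable_iff {v u : List ℕ} (hv : v ∈ TVerts f) :
    (MGraph f \ TGraph f).Reachable v u ↔ ∃ l, HangPath f v l ∧ l ++ v = u := by
  constructor
  · intro h
    rw [SimpleGraph.reachable_iff_reflTransGen] at h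
    induction h with
    | refl => exact ⟨[], trivial, rfl⟩
    | @tail b c _ hbc ih =>
      obtain ⟨l, hl, rfl⟩ := ih
      rw [SimpleGraph.sdiff_adj] at hbc
      rcases ulamHarris_adj.1 (forest_le (MGraph_adj.1 hbc.1).1) with ⟨i, rfl⟩ | ⟨i, hi⟩
      · exact ⟨i :: l, ⟨hl, (SimpleGraph.sdiff_adj _ _ _ _).2 hbc⟩, rfl⟩
      · cases l with
        | nil =>
          have hvi : v = i :: c := hi
          subst hvi
          exact absurd (TGraph_adj_of_cons_mem hv).symm hbc.2
        | cons j l =>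
          simp only [List.cons_append, List.cons.injEq] at hi
          exact ⟨l, hl.1, hi.2⟩
  · rintro ⟨l, hl, rfl⟩
    induction l with
    | nil => exact SimpleGraph.Reachable.refl _
    | cons j l ih => exact (ih hl.1).trans hl.2.reachable

/-- The path `p` from the root of `g`, which has activation time `y`, stays in the part of the
forest hanging off the root, and its endpoint has activation time at most `ν`. -/
def HangGood (ν : EReal) : List ℕ → (List ℕ → ℕ → ℝ) → ℝ → Prop
  | [], g, y => FinBelow g y
  | i :: p, g, y => FinBelow g y ∧ ((g [] i < y ∧ HangGood ν p (shift [i] g) y) ∨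
      (y ≤ g [] i ∧ (g [] i : EReal) ≤ ν ∧ HangGood ν p (shift [i] g) (g [] i)))

lemma HangGood.finBelow {ν : EReal} {p : List ℕ} {g : List ℕ → ℕ → ℝ} {y : ℝ}
    (h : HangGood ν p g y) : FinBelow g y := by
  cases p with
  | nil => exact h
  | cons i p => exact h.1

/-- The vertex `a` of `M` does not lie in `T` and has activation time `y`. -/
structure HangState (f : List ℕ → ℕ → ℝ) (a : List ℕ) (y : ℝ) : Prop where
  notMem : a ∉ TVerts f
  reach : (forest f).Reachable [] a
  fin : ¬ ClusterInf f y a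
  up : ∀ z, y < z → UpInf f z a
  ne : ∀ l i, f (l ++ a) i ≠ y

lemma HangState.level_eq {a : List ℕ} {y : ℝ} (h : HangState f a y) : level f a = y := by
  apply le_antisymm
  · refine le_of_forall_gt fun c hc => ?_
    obtain ⟨z, hz1, hz2⟩ := EReal.lt_iff_exists_real_btwn.1 hc
    exact (thr_le (Or.inl (h.up z (EReal.coe_lt_coe_iff.1 hz1)))).trans_lt hz2
  · refine le_iInf₂ fun z hz => EReal.coe_le_coe_iff.2 ?_
    by_contra hlt
    exact h.fin (hz.mono (not_le.1 hlt).le)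

lemma HangState.adj_iff {a : List ℕ} {y : ℝ} (h : HangState f a y) (i : ℕ) :
    (MGraph f \ TGraph f).Adj a (i :: a) ↔ (forest f).Adj a (i :: a) := by
  rw [SimpleGraph.sdiff_adj, MGraph_adj]
  exact ⟨fun h' => h'.1.1, fun h' => ⟨⟨h', h.reach⟩, fun hT => h.notMem (mem_TVerts_of_adj hT.symm)⟩⟩

/-- A lighter edge always lies in M, since the cluster of `a` is finite already at level `y`. The
child then shares the cluster of `a` at `y`, and with it the level. -/
lemma HangState.step_lt {a : List ℕ} {y : ℝ} (hf : IsRegular f) (h : HangState f a y) {i : ℕ}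
    (hi : f a i < y) : (forest f).Adj a (i :: a) ∧ HangState f (i :: a) y := by
  have hadj : (forest f).Adj a (i :: a) :=
    hf.forest_adj_iff.2 (Or.inl fun h' => h.fin (h'.mono hi.le))
  refine ⟨hadj, fun h' => h.notMem (mem_TVerts_of_cons h'), h.reach.trans hadj.reachable, ?_,
    fun z hz => ⟨hi.trans hz, Or.inl (h.up z hz)⟩, fun l j => ?_⟩
  · rw [hf.clusterInf_iff_infinite, hf.treeCluster_cons hi, ← hf.clusterInf_iff_infinite]
    exact h.fin
  · simpa using h.ne (l ++ [i]) j

/-- Above level `y` the upper end of the edge has an infinite cluster, so only the invasion of the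
lower end can bring the edge in. -/
lemma HangState.forest_adj_iff_of_gt {a : List ℕ} {y : ℝ} (hf : IsRegular f)
    (h : HangState f a y) {i : ℕ} (hi : y < f a i) :
    (forest f).Adj a (i :: a) ↔ FinBelow (shift (i :: a) f) (f a i) := by
  rw [hf.forest_adj_iff]
  exact ⟨fun h' => h'.resolve_left fun h'' => h'' (Or.inl (h.up _ hi)), Or.inr⟩

lemma IsRegular.ne_of_descendant (hf : IsRegular f) (a l : List ℕ) (i j : ℕ) :
    f (l ++ i :: a) j ≠ f a i := by
  intro h
  have := congrArg List.length (hf.inj _ _ _ _ h).1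
  simp only [List.length_append, List.length_cons] at this
  omega

/-- A child entered from its own finite side has the weight of the connecting edge as its level: at
that weight it sees only its subtree, and just above it also an infinite cluster through its parent.
-/
lemma IsRegular.hangState_child (hf : IsRegular f) {a : List ℕ} {i : ℕ}
    (hnot : i :: a ∉ TVerts f) (hreach : (forest f).Reachable [] a)
    (hfin : FinBelow (shift (i :: a) f) (f a i))
    (hup : ∀ z, f a i < z → UpInf f z a ∨
      ∃ j, j ≠ i ∧ f a j < z ∧ ¬ FinBelow (shift (j :: a) f) z) :
    HangState f (i :: a) (f a i) := by
  refine ⟨hnot, hreach.trans (hf.forest_adj_iff.2 (Or.inr hfin)).reachable, ?_,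
    fun z hz => ⟨hz, hup z hz⟩, fun l j => hf.ne_of_descendant a l i j⟩
  rw [hf.clusterInf_iff_infinite, treeCluster_child_infinite_iff]
  exact not_not.2 hfin

lemma HangState.step_gt {a : List ℕ} {y : ℝ} (hf : IsRegular f) (h : HangState f a y) {i : ℕ}
    (hi : y < f a i) (hfin : FinBelow (shift (i :: a) f) (f a i)) :
    HangState f (i :: a) (f a i) :=
  hf.hangState_child (fun h' => h.notMem (mem_TVerts_of_cons h')) h.reach hfin
    fun z hz => Or.inl (h.up z (hi.trans hz))

/-- Levels never decrease along a hanging path, so bounding the activation time of the endpoint by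
`ν` bounds every level met on the way. This justifies imposing the bound at each step of `HangGood`.
-/
lemma HangState.le_activationTime (hf : IsRegular f) {p : List ℕ} {a : List ℕ} {y : ℝ}
    (h : HangState f a y) (hp : HangPath f a p.reverse) :
    (y : EReal) ≤ activationTime f (p.reverse ++ a) := by
  induction p generalizing a y with
  | nil =>
    rw [List.reverse_nil, List.nil_append, hf.activationTime_eq h.reach, h.level_eq]
  | cons i p ih =>
    rw [List.reverse_cons, hangPath_append] at hp
    rw [List.reverse_cons, List.append_assoc, List.singleton_append]
    rcases lt_or_gt_of_ne (h.ne [] i) with hi | hi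
    · exact ih (h.step_lt hf hi).2 hp.2
    · have hfin := (h.forest_adj_iff_of_gt hf hi).1 ((h.adj_iff i).1 hp.1)
      exact (EReal.coe_le_coe_iff.2 (le_of_lt hi)).trans (ih (h.step_gt hf hi hfin) hp.2)

lemma HangState.hangPath_iff (hf : IsRegular f) {ν : EReal} {p : List ℕ} {a : List ℕ} {y : ℝ}
    (h : HangState f a y) (hy : (y : EReal) ≤ ν) :
    (HangPath f a p.reverse ∧ activationTime f (p.reverse ++ a) ≤ ν) ↔
      HangGood ν p (shift a f) y := by
  have hfinB : FinBelow (shift a f) y := by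
    by_contra hc
    exact h.fin (Or.inr hc)
  induction p generalizing a y with
  | nil =>
    rw [List.reverse_nil, List.nil_append, hf.activationTime_eq h.reach, h.level_eq]
    exact ⟨fun _ => hfinB, fun _ => ⟨trivial, hy⟩⟩
  | cons i p ih =>
    rw [List.reverse_cons, hangPath_append, List.append_assoc, List.singleton_append, HangGood,
      shift_singleton_shift, shift_apply_nil, and_assoc, h.adj_iff]
    have hsub : ∀ {b z}, HangState f b z → FinBelow (shift b f) z := fun hb => by
      by_contra hc
      exact hb.fin (Or.inr hc)
    -- The field `ne` rules out a tie; the two strict cases are those where the level is kept and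
    -- where it is reset.
    rcases lt_or_gt_of_ne (h.ne [] i) with hi | hi
    · change f a i < y at hi
      obtain ⟨h1, h2⟩ := h.step_lt hf hi
      have ih' := ih h2 hy (hsub h2)
      exact ⟨fun h' => ⟨hfinB, Or.inl ⟨hi, ih'.1 h'.2⟩⟩, fun h' => ⟨h1, ih'.2 (h'.2.elim
        (fun h3 => h3.2) fun h3 => absurd hi (not_lt.2 h3.1))⟩⟩
    · change y < f a i at hi
      rw [h.forest_adj_iff_of_gt hf hi]
      constructor
      · rintro ⟨h1, h2, h3⟩
        have hs := h.step_gt hf hi h1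
        have hle := (hs.le_activationTime hf h2).trans h3
        exact ⟨hfinB, Or.inr ⟨hi.le, hle, (ih hs hle h1).1 ⟨h2, h3⟩⟩⟩
      · rintro ⟨-, h3 | ⟨-, hle, h3⟩⟩
        · exact absurd h3.1 (not_lt.2 hi.le)
        · exact ⟨h3.finBelow, (ih (h.step_gt hf hi h3.finBelow) hle h3.finBelow).2 h3⟩

/-- A child of `v` outside T has an infinite cluster at the upper end of its edge, so it enters M
only through its own finite cluster, and its level is the weight of the edge. -/
lemma IsRegular.hangPath_cons_iff (hf : IsRegular f) {ν : EReal} {p : List ℕ} {v : List ℕ} {i : ℕ}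
    (hv : v ∈ TVerts f) :
    (HangPath f v (i :: p).reverse ∧ activationTime f ((i :: p).reverse ++ v) ≤ ν) ↔
      ClusterInf f (f v i) v ∧ (f v i : EReal) ≤ ν ∧
        HangGood ν p (shift (i :: v) f) (f v i) := by
  rw [List.reverse_cons, hangPath_append, List.append_assoc, List.singleton_append,
    SimpleGraph.sdiff_adj, MGraph_adj]
  have hT : (TGraph f).Adj v (i :: v) ↔ ¬ ClusterInf f (f v i) v := by
    rw [← hf.cons_mem_TVerts_iff hv]
    exact ⟨mem_TVerts_of_adj, TGraph_adj_of_cons_mem⟩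
  rw [hT, not_not, hf.forest_adj_iff]
  have hr := forest_reachable hv
  have hs : ClusterInf f (f v i) v → FinBelow (shift (i :: v) f) (f v i) →
      HangState f (i :: v) (f v i) := fun hc hfin => by
    refine hf.hangState_child ?_ hr hfin fun z hz => ?_
    · rw [hf.cons_mem_TVerts_iff hv, not_not]
      exact hc
    -- The infinite part at level `f v i` cannot use the child `i`, whose own edge is closed at that
    -- level.
    · rcases (clusterInf_iff (hf.tendsto v)).1 hc with h | ⟨j, h1, h2⟩
      · exact Or.inl (h.mono hz.le)
      · exact Or.inr ⟨j, fun hj => by subst hj; exact lt_irrefl _ h1, h1.trans hz,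
          fun h => h2 (h.anti hz.le)⟩
  constructor
  · rintro ⟨⟨⟨⟨h1, -⟩, hc⟩, h2⟩, h3⟩
    have hfin := h1.resolve_left (not_not.2 hc)
    have hle := ((hs hc hfin).le_activationTime hf h2).trans h3
    exact ⟨hc, hle, ((hs hc hfin).hangPath_iff hf hle).1 ⟨h2, h3⟩⟩
  · rintro ⟨hc, hle, h⟩
    have h' := ((hs hc h.finBelow).hangPath_iff hf hle).2 h
    exact ⟨⟨⟨⟨Or.inr h.finBelow, hr⟩, hc⟩, h'.1⟩, h'.2⟩

end Forest

/-! ### Counting hanging vertices by depth -/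

lemma tsum_list (F : List ℕ → ℝ≥0∞) : ∑' p, F p = F [] + ∑' i, ∑' p, F (i :: p) := by
  classical
  have hinj : Function.Injective fun q : ℕ × List ℕ => q.1 :: q.2 := by
    rintro ⟨i, p⟩ ⟨j, q⟩ h
    simpa using h
  rw [ENNReal.tsum_eq_add_tsum_ite [], ← ENNReal.tsum_prod, ← hinj.tsum_eq]
  · simp
  · intro p hp
    cases p with
    | nil => simp at hp
    | cons i p => exact ⟨(i, p), rfl⟩

open Classical in
/-- The number of vertices at depth `n` that hang off the root of `g`. -/
def hangCount (ν : EReal) (n : ℕ) (g : List ℕ → ℕ → ℝ) (y : ℝ) : ℝ≥0∞ :=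
  ∑' p : List ℕ, if p.length = n ∧ HangGood ν p g y then 1 else 0

open Classical in
/-- The number of vertices that hang off the root of `g`. -/
def hangTotal (ν : EReal) (g : List ℕ → ℕ → ℝ) (y : ℝ) : ℝ≥0∞ :=
  ∑' p : List ℕ, if HangGood ν p g y then 1 else 0

lemma hangTotal_eq_tsum (ν : EReal) (g : List ℕ → ℕ → ℝ) (y : ℝ) :
    hangTotal ν g y = ∑' n, hangCount ν n g y := by
  classical
  simp only [hangTotal, hangCount]
  rw [ENNReal.tsum_comm]
  refine tsum_congr fun p => ?_
  rw [tsum_eq_single p.length]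
  · simp
  · intro n hn
    simp [hn.symm]

open Classical in
lemma hangCount_zero (ν : EReal) (g : List ℕ → ℕ → ℝ) (y : ℝ) :
    hangCount ν 0 g y = if FinBelow g y then 1 else 0 := by
  rw [hangCount, tsum_list]
  simp [HangGood]

open Classical in
lemma hangCount_succ (ν : EReal) (n : ℕ) (g : List ℕ → ℕ → ℝ) (y : ℝ) :
    hangCount ν (n + 1) g y = ∑' i, if FinBelow g y then
      (if g [] i < y then hangCount ν n (shift [i] g) y
        else if (g [] i : EReal) ≤ ν then hangCount ν n (shift [i] g) (g [] i) else 0) else 0 := by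
  rw [hangCount, tsum_list]
  simp only [List.length_nil, Nat.right_eq_add, Nat.add_eq_zero_iff, one_ne_zero, and_false, false_and,
    if_false, zero_add, List.length_cons, Nat.add_right_cancel_iff, HangGood]
  refine tsum_congr fun i => ?_
  by_cases h1 : FinBelow g y
  · by_cases h2 : g [] i < y
    · simp [h1, h2, hangCount, not_le.2 h2]
    · by_cases h3 : (g [] i : EReal) ≤ ν
      · simp [h1, h2, h3, hangCount, not_lt.1 h2]
      · simp [h1, h2, h3]
  · simp [h1]

open Classical in
-- The first term is `v` itself, and the sum runs over its hanging children. Paths are reversed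
-- because `HangGood` reads them from the top, whereas addresses start with the deepest index.
lemma IsRegular.hangingSize_eq {f : List ℕ → ℕ → ℝ} (hf : IsRegular f) {v : List ℕ}
    (hv : v ∈ TVerts f) (ν : EReal) :
    hangingSize f v ν = (if level f v ≤ ν then 1 else 0) +
      ∑' i, if ClusterInf f (f v i) v ∧ (f v i : EReal) ≤ ν then
        hangTotal ν (shift (i :: v) f) (f v i) else 0 := by
  have hset : hangingVerts f v ν = (fun p : List ℕ => p.reverse ++ v) ''
      {p | HangPath f v p.reverse ∧ activationTime f (p.reverse ++ v) ≤ ν} := by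
    ext u
    simp only [hangingVerts, Set.mem_ofPred_eq, hang_reachable_iff hv, Set.mem_image]
    constructor
    · rintro ⟨⟨l, hl, rfl⟩, h⟩
      exact ⟨l.reverse, by simpa using ⟨hl, h⟩, by simp⟩
    · rintro ⟨p, ⟨h1, h2⟩, rfl⟩
      exact ⟨⟨_, h1, rfl⟩, h2⟩
  rw [hangingSize, hset, Function.Injective.encard_image, ← ENNReal.tsum_set_one,
    tsum_subtype _ (fun _ => (1 : ℝ≥0∞)), tsum_list]
  · congr 1
    · simp [Set.indicator, HangPath, hf.activationTime_eq (forest_reachable hv)]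
    · refine tsum_congr fun i => ?_
      simp only [Set.indicator, Set.mem_ofPred_eq, hf.hangPath_cons_iff hv, hangTotal]
      by_cases h1 : ClusterInf f (f v i) v ∧ (f v i : EReal) ≤ ν
      · simp [h1]
      · rw [if_neg h1]
        refine ENNReal.tsum_eq_zero.2 fun p => if_neg fun h => h1 ⟨h.1, h.2.1⟩
  · intro p q h
    exact List.reverse_injective (List.append_cancel_right h)

/-! ## Resampling coordinates of a product measure -/

section Resample

variable {ι κ X : Type*} [MeasurableSpace X] (μ : Measure X) [IsProbabilityMeasure μ]

/-- Replacing the coordinates in `s` by distinct coordinates of an independent copy keeps the law.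
On cylinder sets, injectivity of `k` on `s` splits the preimage into a product of two cylinders. -/
lemma measurePreserving_glue (s : Set ι) [DecidablePred (· ∈ s)] {k : ι → κ} (hk : Set.InjOn k s) :
    MeasurePreserving (fun (p : (ι → X) × (κ → X)) i => if i ∈ s then p.2 (k i) else p.1 i)
      ((Measure.infinitePi fun _ => μ).prod (Measure.infinitePi fun _ => μ))
      (Measure.infinitePi fun _ => μ) := by
  classical
  have hmeas : Measurable fun (p : (ι → X) × (κ → X)) i =>
      if i ∈ s then p.2 (k i) else p.1 i := by
    refine measurable_pi_lambda _ fun i => ?_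
    by_cases hi : i ∈ s
    · simp only [hi, if_true]; fun_prop
    · simp only [hi, if_false]; fun_prop
  refine ⟨hmeas, Measure.eq_infinitePi _ fun S t ht => ?_⟩
  rw [Measure.map_apply hmeas (.pi S.countable_toSet fun _ _ => ht _)]
  rcases isEmpty_or_nonempty ι with hι | hι
  · have : S = ∅ := Finset.eq_empty_of_isEmpty S
    subst this
    simp
  have hpre : (fun (p : (ι → X) × (κ → X)) i => if i ∈ s then p.2 (k i) else p.1 i) ⁻¹'
      (Set.pi S t) = (Set.pi (S.filter (· ∉ s) : Finset ι) t) ×ˢ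
        (Set.pi ((S.filter (· ∈ s)).image k : Finset κ) fun c => t (Function.invFunOn k s c)) := by
    ext ⟨f, g⟩
    simp only [Set.mem_preimage, Set.mem_pi, Set.mem_prod, Finset.mem_coe, Finset.mem_filter,
      Finset.mem_image]
    constructor
    · intro h
      refine ⟨fun i hi => by simpa [hi.2] using h i hi.1, ?_⟩
      rintro _ ⟨i, hi, rfl⟩
      rw [hk.leftInvOn_invFunOn hi.2]
      simpa [hi.2] using h i hi.1
    · rintro ⟨h1, h2⟩ i hi
      by_cases his : i ∈ s
      · have := h2 (k i) ⟨i, ⟨hi, his⟩, rfl⟩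
        rw [hk.leftInvOn_invFunOn his] at this
        simpa [his] using this
      · simpa [his] using h1 i ⟨hi, his⟩
  rw [hpre, Measure.prod_prod, Measure.infinitePi_pi _ (fun i _ => ht i),
    Measure.infinitePi_pi _ (fun i _ => ht _), Finset.prod_image, mul_comm]
  · rw [← Finset.prod_filter_mul_prod_filter_not S (· ∈ s)]
    congr 1
    refine Finset.prod_congr rfl fun i hi => ?_
    rw [hk.leftInvOn_invFunOn (Finset.mem_filter.1 hi).2]
  · intro i hi j hj h
    exact hk (Finset.mem_filter.1 hi).2 (Finset.mem_filter.1 hj).2 h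

lemma lintegral_resample_coordinate [DecidableEq ι] (i : ι) {Φ : (ι → X) → ℝ≥0∞}
    (hΦ : Measurable Φ) :
    ∫⁻ f, Φ f ∂(Measure.infinitePi fun _ => μ) =
      ∫⁻ f, ∫⁻ s, Φ (Function.update f i s) ∂μ ∂(Measure.infinitePi fun _ => μ) := by
  have h := measurePreserving_glue (κ := Unit) μ ({i} : Set ι) (k := fun _ => ())
    (by intro a ha b hb _; rw [ha, hb])
  have hup : Measurable fun p : (ι → X) × X => Φ (Function.update p.1 i p.2) :=
    hΦ.comp measurable_update'
  have hm : Measurable fun p : (ι → X) × (Unit → X) =>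
      Φ fun j => if j ∈ ({i} : Set ι) then p.2 () else p.1 j := hΦ.comp h.measurable
  rw [← h.lintegral_comp hΦ, lintegral_prod _ hm.aemeasurable]
  refine lintegral_congr fun f => ?_
  rw [← (measurePreserving_eval_infinitePi (fun _ : Unit => μ) ()).lintegral_comp
    (f := fun s => Φ (Function.update f i s)) (hup.comp measurable_prodMk_left)]
  refine lintegral_congr fun g => ?_
  congr 1
  funext j
  by_cases hj : j = i
  · subst hj; simp
  · simp [hj]

end Resample

/-! ## The law of the weights at one vertex -/

lemma exp_pdf_eq (r : ℝ) : gammaPDF 1 1 r = (Set.Ici 0).indicator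
    (fun s => ENNReal.ofReal (Real.exp (-s))) r := by
  have := exponentialPDF_eq 1 r
  rw [exponentialPDF, exponentialPDFReal] at this
  rw [gammaPDF, this]
  by_cases h : 0 ≤ r <;> simp [Set.indicator, h]

lemma lintegral_exp {φ : ℝ → ℝ≥0∞} (hφ : Measurable φ) :
    ∫⁻ s, φ s ∂(expMeasure 1) = ∫⁻ s in Set.Ioi 0, ENNReal.ofReal (Real.exp (-s)) * φ s := by
  rw [expMeasure, gammaMeasure, lintegral_withDensity_eq_lintegral_mul _
    (f := gammaPDF 1 1) (measurable_gammaPDFReal 1 1).ennreal_ofReal hφ, setLIntegral_congr (Ioi_ae_eq_Ici),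
    ← lintegral_indicator measurableSet_Ici]
  refine lintegral_congr fun s => ?_
  simp only [Pi.mul_apply, exp_pdf_eq, Set.indicator]
  split_ifs <;> simp

instance : IsProbabilityMeasure (expMeasure 1) := isProbabilityMeasure_expMeasure one_pos

lemma lintegral_exp_neg_Ioi (r : ℝ) :
    ∫⁻ s in Set.Ioi r, ENNReal.ofReal (Real.exp (-s)) = ENNReal.ofReal (Real.exp (-r)) := by
  rw [← ofReal_integral_eq_lintegral_ofReal, integral_exp_neg_Ioi]
  · simpa [IntegrableOn] using integrableOn_exp_mul_Ioi (a := -1) (by norm_num) r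
  · exact ae_of_all _ fun s => (Real.exp_pos _).le

lemma expMeasure_Ici {r : ℝ} (hr : 0 ≤ r) :
    expMeasure 1 (Set.Ici r) = ENNReal.ofReal (Real.exp (-r)) := by
  rw [expMeasure, gammaMeasure, withDensity_apply _ measurableSet_Ici,
    ← setLIntegral_congr Ioi_ae_eq_Ici, ← lintegral_exp_neg_Ioi]
  refine setLIntegral_congr_fun measurableSet_Ioi fun s hs => ?_
  rw [exp_pdf_eq, Set.indicator_of_mem (show s ∈ Set.Ici 0 from hr.trans (le_of_lt hs))]

/-- The hazard rate of a mean-one exponential variable is one: its density at r equals its tail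
probability at r, so Tonelli exchanges the value at p + s for the integral up to it. This is the
compensator formula for a single gap. -/
lemma lintegral_exp_add {φ : ℝ → ℝ≥0∞} (hφ : Measurable φ) (p : ℝ) :
    ∫⁻ s, φ (p + s) ∂(expMeasure 1) =
      ∫⁻ s, ∫⁻ t in Set.Ioc p (p + s), φ t ∂volume ∂(expMeasure 1) := by
  have hm : MeasurableSet {q : ℝ × ℝ | p < q.2 ∧ q.2 ≤ p + q.1} :=
    (measurableSet_lt measurable_const measurable_snd).inter
      (measurableSet_le measurable_snd (measurable_const.add measurable_fst))
  have h1 : ∀ s, ∫⁻ t in Set.Ioc p (p + s), φ t =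
      ∫⁻ t, {q : ℝ × ℝ | p < q.2 ∧ q.2 ≤ p + q.1}.indicator (fun q => φ q.2) (s, t) := fun s => by
    rw [← lintegral_indicator measurableSet_Ioc]
    rfl
  have h0 : Measurable fun s => φ (p + s) := hφ.comp (measurable_const_add p)
  rw [lintegral_congr h1, lintegral_lintegral_swap
    (f := fun s t => {q : ℝ × ℝ | p < q.2 ∧ q.2 ≤ p + q.1}.indicator (fun q => φ q.2) (s, t))
    ((hφ.comp measurable_snd).indicator hm).aemeasurable, lintegral_exp h0, ← lintegral_indicator measurableSet_Ioi,
    ← lintegral_sub_right_eq_self _ p]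
  refine lintegral_congr fun t => ?_
  by_cases ht : p < t
  · have h2 : ∀ s, {q : ℝ × ℝ | p < q.2 ∧ q.2 ≤ p + q.1}.indicator (fun q => φ q.2) (s, t) =
        φ t * (Set.Ici (t - p)).indicator 1 s := fun s => by
      by_cases hs : t ≤ p + s
      · rw [Set.indicator_of_mem (show (s, t) ∈ {q : ℝ × ℝ | p < q.2 ∧ q.2 ≤ p + q.1} from ⟨ht, hs⟩),
          Set.indicator_of_mem (show s ∈ Set.Ici (t - p) by simp; linarith)]
        simp
      · rw [Set.indicator_of_notMem (fun h => hs h.2),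
          Set.indicator_of_notMem (fun h => hs (by simp at h; linarith))]
        simp
    simp_rw [h2]
    rw [lintegral_const_mul _ (measurable_one.indicator measurableSet_Ici),
      lintegral_indicator_one measurableSet_Ici, expMeasure_Ici (by linarith),
      Set.indicator_of_mem (show t - p ∈ Set.Ioi 0 by simpa using ht), mul_comm]
    simp
  · rw [Set.indicator_of_notMem (by simpa using ht)]
    simp [Set.indicator, ht]

/-- The partial sums of a sequence. -/
def partialSums (g : ℕ → ℝ) (i : ℕ) : ℝ := ∑ j ∈ Finset.range (i + 1), g j

lemma measurable_partialSums : Measurable partialSums :=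
  measurable_pi_lambda _ fun _ => Finset.measurable_sum _ fun j _ => measurable_pi_apply j

/-- The law of the atoms of a rate one Poisson process. -/
def blockLaw : Measure (ℕ → ℝ) := (Measure.infinitePi fun _ : ℕ => expMeasure 1).map partialSums

instance : IsProbabilityMeasure blockLaw :=
  Measure.isProbabilityMeasure_map measurable_partialSums.aemeasurable

/-- The atom before the `i`-th one, or zero. -/
def prevAtom (b : ℕ → ℝ) : ℕ → ℝ
  | 0 => 0
  | i + 1 => b i

lemma measurable_prevAtom (i : ℕ) : Measurable fun b => prevAtom b i := by
  cases i with
  | zero => exact measurable_const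
  | succ i => exact measurable_pi_apply i

lemma prevAtom_partialSums (g : ℕ → ℝ) (i : ℕ) :
    prevAtom (partialSums g) i = ∑ j ∈ Finset.range i, g j := by
  cases i <;> simp [prevAtom, partialSums]

lemma partialSums_update_of_lt (g : ℕ → ℝ) {i j : ℕ} (h : j < i) (s : ℝ) :
    partialSums (Function.update g i s) j = partialSums g j :=
  Finset.sum_congr rfl fun k hk => Function.update_of_ne (by simp at hk; omega) _ _

lemma partialSums_update_self (g : ℕ → ℝ) (i : ℕ) (s : ℝ) :
    partialSums (Function.update g i s) i = prevAtom (partialSums g) i + s := by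
  rw [prevAtom_partialSums, partialSums, Finset.sum_range_succ, Function.update_self]
  congr 1
  exact Finset.sum_congr rfl fun k hk => Function.update_of_ne (by simp at hk; omega) _ _

lemma prevAtom_congr {b b' : ℕ → ℝ} {i : ℕ} (h : ∀ j < i, b j = b' j) :
    prevAtom b i = prevAtom b' i := by
  cases i with
  | zero => rfl
  | succ i => exact h i (Nat.lt_succ_self i)

/-- Resampling the i-th gap leaves the earlier atoms unchanged, and `Φ` sees only those besides its
second argument. -/
lemma lintegral_block_gap (i : ℕ) {Φ : (ℕ → ℝ) → ℝ → ℝ≥0∞}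
    (hΦ : Measurable (Function.uncurry Φ)) (hdep : ∀ b b' t, (∀ j < i, b j = b' j) →
      Φ b t = Φ b' t) :
    ∫⁻ b, Φ b (b i) ∂blockLaw = ∫⁻ b, ∫⁻ s, Φ b (prevAtom b i + s) ∂(expMeasure 1) ∂blockLaw := by
  have h1 : Measurable fun b : ℕ → ℝ => Φ b (b i) :=
    hΦ.comp (measurable_id.prodMk (measurable_pi_apply i))
  have h2 : Measurable fun b : ℕ → ℝ => ∫⁻ s, Φ b (prevAtom b i + s) ∂(expMeasure 1) := by
    have h3 : Measurable fun q : (ℕ → ℝ) × ℝ => (q.1, prevAtom q.1 i + q.2) :=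
      measurable_fst.prodMk (((measurable_prevAtom i).comp measurable_fst).add measurable_snd)
    exact Measurable.lintegral_prod_right' (f := fun q : (ℕ → ℝ) × ℝ =>
      Φ q.1 (prevAtom q.1 i + q.2)) (hΦ.comp h3)
  rw [blockLaw, lintegral_map h1 measurable_partialSums, lintegral_map h2 measurable_partialSums,
    lintegral_resample_coordinate (expMeasure 1) i
      (Φ := fun g => Φ (partialSums g) (partialSums g i)) (h1.comp measurable_partialSums)]
  refine lintegral_congr fun g => lintegral_congr fun s => ?_
  rw [partialSums_update_self]
  exact hdep _ _ _ fun j hj => partialSums_update_of_lt g hj s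

lemma measurable_lintegral_Ioc_prevAtom (i : ℕ) {Φ : (ℕ → ℝ) → ℝ → ℝ≥0∞}
    (hΦ : Measurable (Function.uncurry Φ)) :
    Measurable (Function.uncurry fun (b : ℕ → ℝ) (c : ℝ) =>
      ∫⁻ t in Set.Ioc (prevAtom b i) c, Φ b t) := by
  have hm : MeasurableSet {q : ((ℕ → ℝ) × ℝ) × ℝ | prevAtom q.1.1 i < q.2 ∧ q.2 ≤ q.1.2} :=
    (measurableSet_lt ((measurable_prevAtom i).comp (measurable_fst.comp measurable_fst))
      measurable_snd).inter
      (measurableSet_le measurable_snd (measurable_snd.comp measurable_fst))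
  have : (Function.uncurry fun (b : ℕ → ℝ) (c : ℝ) =>
    ∫⁻ t in Set.Ioc (prevAtom b i) c, Φ b t) = fun q : (ℕ → ℝ) × ℝ => ∫⁻ t,
      {q : ((ℕ → ℝ) × ℝ) × ℝ | prevAtom q.1.1 i < q.2 ∧ q.2 ≤ q.1.2}.indicator
        (fun q => Φ q.1.1 q.2) (q, t) := by
    funext ⟨b, c⟩
    rw [Function.uncurry_apply_pair, ← lintegral_indicator measurableSet_Ioc]
    rfl
  rw [this]
  refine Measurable.lintegral_prod_right' (Measurable.indicator ?_ hm)
  exact hΦ.comp ((measurable_fst.comp measurable_fst).prodMk measurable_snd)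

/-- The compensator formula for the atoms of a Poisson process. -/
lemma lintegral_block (i : ℕ) {Φ : (ℕ → ℝ) → ℝ → ℝ≥0∞}
    (hΦ : Measurable (Function.uncurry Φ)) (hdep : ∀ b b' t, (∀ j < i, b j = b' j) →
      Φ b t = Φ b' t) :
    ∫⁻ b, Φ b (b i) ∂blockLaw =
      ∫⁻ b, ∫⁻ t in Set.Ioc (prevAtom b i) (b i), Φ b t ∂volume ∂blockLaw := by
  -- The integral from the previous atom to `c` is again determined by the earlier atoms and `c`, so
  -- the gap lemma rewrites both sides and the one-gap identity compares them.
  have hΨ := measurable_lintegral_Ioc_prevAtom i hΦ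
  rw [lintegral_block_gap i hΦ hdep, lintegral_block_gap i hΨ]
  · refine lintegral_congr fun b => ?_
    exact lintegral_exp_add (hΦ.comp measurable_prodMk_left) _
  · intro b b' t h
    simp only [prevAtom_congr h, hdep b b' _ h]

lemma lintegral_block_zero {φ : ℝ → ℝ≥0∞} (hφ : Measurable φ) :
    ∫⁻ b, φ (b 0) ∂blockLaw = ∫⁻ s, φ s ∂(expMeasure 1) := by
  rw [lintegral_block_gap 0 (Φ := fun _ t => φ t) (hφ.comp measurable_snd) (fun _ _ _ _ => rfl)]
  simp [prevAtom]

lemma lintegral_block_succ (i : ℕ) {Φ : ℝ → ℝ → ℝ≥0∞} (hΦ : Measurable (Function.uncurry Φ)) :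
    ∫⁻ b, Φ (b i) (b (i + 1)) ∂blockLaw =
      ∫⁻ b, ∫⁻ s, Φ (b i) (b i + s) ∂(expMeasure 1) ∂blockLaw := by
  have h : Measurable fun q : (ℕ → ℝ) × ℝ => (q.1 i, q.2) := by fun_prop
  exact lintegral_block_gap (i + 1) (Φ := fun b t => Φ (b i) t) (hΦ.comp h)
    (fun b b' t h => by rw [h i (Nat.lt_succ_self i)])

lemma lintegral_pow_div_factorial {y : ℝ} (hy : 0 ≤ y) (n : ℕ) :
    ∫⁻ t in Set.Ioo 0 y, ENNReal.ofReal (t ^ n / (n.factorial : ℝ)) =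
      ENNReal.ofReal (y ^ (n + 1) / ((n + 1).factorial : ℝ)) := by
  rw [setLIntegral_congr Ioo_ae_eq_Ioc, ← ofReal_integral_eq_lintegral_ofReal,
    ← intervalIntegral.integral_of_le hy, intervalIntegral.integral_div, integral_pow]
  · congr 1
    rw [Nat.factorial_succ]
    push_cast
    field_simp
    simp
  · exact (Continuous.integrableOn_Ioc (by fun_prop)).integrable
  · filter_upwards [ae_restrict_mem measurableSet_Ioc] with t ht
    have := ht.1.le
    positivity

/-- The `i`-th atom has a Gamma distribution. -/
lemma lintegral_block_gamma (i : ℕ) {φ : ℝ → ℝ≥0∞} (hφ : Measurable φ) :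
    ∫⁻ b, φ (b i) ∂blockLaw = ∫⁻ t in Set.Ioi 0,
      ENNReal.ofReal (t ^ i / (i.factorial : ℝ) * Real.exp (-t)) * φ t := by
  induction i generalizing φ with
  | zero =>
    rw [lintegral_block_zero hφ, lintegral_exp hφ]
    simp
  | succ i ih =>
    have hS : Measurable fun a : ℝ => ∫⁻ s, φ (a + s) ∂(expMeasure 1) :=
      Measurable.lintegral_prod_right' (f := fun q : ℝ × ℝ => φ (q.1 + q.2))
        (hφ.comp (measurable_fst.add measurable_snd))
    rw [lintegral_block_succ i (Φ := fun _ t => φ t) (hφ.comp measurable_snd), ih hS]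
    have hm : MeasurableSet {q : ℝ × ℝ | 0 < q.1 ∧ q.1 < q.2} :=
      (measurableSet_lt measurable_const measurable_fst).inter
        (measurableSet_lt measurable_fst measurable_snd)
    -- Since e^(-a) e^(-(t-a)) = e^(-t), the joint density of consecutive atoms a < t depends on a
    -- only through a^i / i!, and Tonelli leaves the integral of this power over (0, t).
    have h1 : ∀ a, (Set.Ioi (0 : ℝ)).indicator (fun a =>
        ENNReal.ofReal (a ^ i / (i.factorial : ℝ) * Real.exp (-a)) *
          ∫⁻ s, φ (a + s) ∂(expMeasure 1)) a =
        ∫⁻ t, {q : ℝ × ℝ | 0 < q.1 ∧ q.1 < q.2}.indicator (fun q =>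
          ENNReal.ofReal (q.1 ^ i / (i.factorial : ℝ)) *
            (ENNReal.ofReal (Real.exp (-q.2)) * φ q.2)) (a, t) := by
      intro a
      by_cases ha : 0 < a
      · rw [Set.indicator_of_mem (show a ∈ Set.Ioi 0 from ha),
          lintegral_exp (φ := fun s => φ (a + s)) (hφ.comp (measurable_const_add a)), ← lintegral_indicator measurableSet_Ioi,
          ← lintegral_sub_right_eq_self _ a, ENNReal.ofReal_mul (by positivity), mul_assoc,
          ← lintegral_const_mul', ← lintegral_const_mul']
        · refine lintegral_congr fun t => ?_
          by_cases ht : a < t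
          · rw [Set.indicator_of_mem (show t - a ∈ Set.Ioi 0 by simpa using ht),
              Set.indicator_of_mem (show (a, t) ∈ {q : ℝ × ℝ | 0 < q.1 ∧ q.1 < q.2} from ⟨ha, ht⟩)]
            have : Real.exp (-t) = Real.exp (-a) * Real.exp (-(t - a)) := by
              rw [← Real.exp_add]; congr 1; ring
            rw [this, ENNReal.ofReal_mul (Real.exp_pos _).le]
            simp [mul_assoc]
          · rw [Set.indicator_of_notMem (by simpa using ht),
              Set.indicator_of_notMem (fun h => ht h.2)]
            simp
        · exact ENNReal.ofReal_ne_top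
        · exact ENNReal.ofReal_ne_top
      · rw [Set.indicator_of_notMem (by simpa using ha)]
        simp [Set.indicator, ha]
    have hM : Measurable fun q : ℝ × ℝ => {q : ℝ × ℝ | 0 < q.1 ∧ q.1 < q.2}.indicator (fun q =>
          ENNReal.ofReal (q.1 ^ i / (i.factorial : ℝ)) *
            (ENNReal.ofReal (Real.exp (-q.2)) * φ q.2)) (q.1, q.2) :=
      Measurable.indicator (by fun_prop) hm
    rw [← lintegral_indicator measurableSet_Ioi, lintegral_congr h1,
      lintegral_lintegral_swap hM.aemeasurable, ← lintegral_indicator measurableSet_Ioi]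
    refine lintegral_congr fun t => ?_
    by_cases ht : 0 < t
    · rw [Set.indicator_of_mem (show t ∈ Set.Ioi 0 from ht)]
      have h2 : ∀ a, {q : ℝ × ℝ | 0 < q.1 ∧ q.1 < q.2}.indicator (fun q =>
          ENNReal.ofReal (q.1 ^ i / (i.factorial : ℝ)) *
            (ENNReal.ofReal (Real.exp (-q.2)) * φ q.2)) (a, t) =
          (Set.Ioo 0 t).indicator (fun a => ENNReal.ofReal (a ^ i / (i.factorial : ℝ))) a *
            (ENNReal.ofReal (Real.exp (-t)) * φ t) := fun a => by
        by_cases ha : 0 < a ∧ a < t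
        · rw [Set.indicator_of_mem (show (a, t) ∈ {q : ℝ × ℝ | 0 < q.1 ∧ q.1 < q.2} from ha),
            Set.indicator_of_mem (show a ∈ Set.Ioo 0 t from ha)]
        · rw [Set.indicator_of_notMem (show (a, t) ∉ {q : ℝ × ℝ | 0 < q.1 ∧ q.1 < q.2} from ha),
            Set.indicator_of_notMem (show a ∉ Set.Ioo 0 t from ha), zero_mul]
      simp_rw [h2]
      rw [lintegral_mul_const _ (Measurable.indicator (by fun_prop) measurableSet_Ioo),
        lintegral_indicator measurableSet_Ioo, lintegral_pow_div_factorial ht.le, ← mul_assoc,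
        ← ENNReal.ofReal_mul (by positivity)]
    · rw [Set.indicator_of_notMem (by simpa using ht)]
      have h2 : ∀ a, {q : ℝ × ℝ | 0 < q.1 ∧ q.1 < q.2}.indicator (fun q =>
          ENNReal.ofReal (q.1 ^ i / (i.factorial : ℝ)) *
            (ENNReal.ofReal (Real.exp (-q.2)) * φ q.2)) (a, t) = 0 := fun a =>
        Set.indicator_of_notMem (fun h => ht (lt_trans h.1 h.2)) _
      simp [h2]


/-! ### Poisson counts of the atoms below a level -/

/-- The sequence is positive, strictly increasing and unbounded. -/
structure IsBlock (b : ℕ → ℝ) : Prop where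
  pos : 0 < b 0
  strictMono : StrictMono b
  tendsto : Tendsto b atTop atTop

lemma expMeasure_Iic_zero : expMeasure 1 (Set.Iic 0) = 0 := by
  rw [expMeasure, gammaMeasure, withDensity_apply _ measurableSet_Iic,
    ← setLIntegral_congr Iio_ae_eq_Iic]
  refine (setLIntegral_congr_fun (g := 0) measurableSet_Iio fun s hs => ?_).trans (by simp)
  rw [exp_pdf_eq, Set.indicator_of_notMem (by simpa using hs)]
  rfl

lemma ae_block_prevAtom_lt : ∀ᵐ b ∂blockLaw, ∀ n, prevAtom b n < b n := by
  have hm : MeasurableSet {b : ℕ → ℝ | ∀ n, prevAtom b n < b n} := by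
    rw [Set.ofPred_forall]
    exact MeasurableSet.iInter fun n => measurableSet_lt (measurable_prevAtom n)
      (measurable_pi_apply n)
  rw [blockLaw, ae_map_iff measurable_partialSums.aemeasurable hm]
  have h : ∀ᵐ g ∂(Measure.infinitePi fun _ : ℕ => expMeasure 1), ∀ n, 0 < g n := by
    rw [ae_all_iff]
    intro n
    have h1 : ∀ᵐ s ∂(expMeasure 1), 0 < s := by
      rw [ae_iff]
      simp only [not_lt]
      exact expMeasure_Iic_zero
    exact (measurePreserving_eval_infinitePi (fun _ : ℕ => expMeasure 1)
      n).quasiMeasurePreserving.ae h1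
  filter_upwards [h] with g hg n
  rw [prevAtom_partialSums, partialSums, Finset.sum_range_succ]
  exact lt_add_of_pos_right _ (hg n)

lemma ae_block_strictMono : ∀ᵐ b ∂blockLaw, 0 < b 0 ∧ StrictMono b := by
  filter_upwards [ae_block_prevAtom_lt] with b hb
  exact ⟨hb 0, strictMono_nat_of_lt_succ fun n => hb (n + 1)⟩

lemma blockLaw_atom (i : ℕ) (c : ℝ) : blockLaw {b | b i = c} = 0 := by
  have h := lintegral_block_gamma i (φ := Set.indicator {c} 1)
    (measurable_one.indicator (measurableSet_singleton c))
  have h1 : ∫⁻ b, Set.indicator {c} 1 (b i) ∂blockLaw = blockLaw {b | b i = c} := by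
    rw [← lintegral_indicator_one (measurableSet_eq_fun (measurable_pi_apply i) measurable_const)]
    rfl
  rw [← h1, h]
  refine le_antisymm ((setLIntegral_le_lintegral _ _).trans (le_of_eq ?_)) bot_le
  rw [lintegral_eq_zero_iff (by fun_prop (disch := measurability))]
  have : ∀ᵐ t : ℝ, t ≠ c := by simp [ae_iff]
  filter_upwards [this] with t ht
  simp [ht]

/-- The number of terms of the sequence less than `y`. -/
def atomCount (y : ℝ) (b : ℕ → ℝ) : ℕ := sInf {n | y ≤ b n}

lemma IsBlock.lt_atomCount_iff {b : ℕ → ℝ} (hb : IsBlock b) {y : ℝ} {i : ℕ} :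
    i < atomCount y b ↔ b i < y := by
  have hne : {n | y ≤ b n}.Nonempty := (hb.tendsto.eventually_ge_atTop y).exists
  constructor
  · intro h
    by_contra hc
    exact absurd (Nat.sInf_le (show i ∈ {n | y ≤ b n} from not_lt.1 hc)) (not_le.2 h)
  · intro h
    by_contra hc
    exact absurd (h.trans_le (Nat.sInf_mem hne)) (not_lt.2 (hb.strictMono.monotone (not_lt.1 hc)))

lemma measurable_atomCount (y : ℝ) : Measurable (atomCount y) := by
  refine measurable_to_countable' fun n => ?_
  have hle : ∀ m, MeasurableSet {b : ℕ → ℝ | y ≤ b m} := fun m =>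
    measurableSet_le measurable_const (measurable_pi_apply m)
  have hlt : ∀ m, MeasurableSet {b : ℕ → ℝ | b m < y} := fun m =>
    measurableSet_lt (measurable_pi_apply m) measurable_const
  -- The second set is the default case: if no term reaches `y`, the infimum of the empty set is
  -- zero.
  have hset : atomCount y ⁻¹' {n} = {b | y ≤ b n ∧ ∀ m, m < n → b m < y} ∪
      {b | n = 0 ∧ ∀ m, b m < y} := by
    ext b
    simp only [Set.mem_preimage, Set.mem_singleton_iff, Set.mem_union, Set.mem_ofPred_eq]
    constructor
    · rintro rfl
      by_cases hne : {n | y ≤ b n}.Nonempty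
      · exact Or.inl ⟨Nat.sInf_mem hne, fun m hm => not_le.1 fun h => Nat.notMem_of_lt_sInf hm h⟩
      · refine Or.inr ⟨?_, fun m => not_le.1 fun h => hne ⟨m, h⟩⟩
        rw [atomCount, Set.not_nonempty_iff_eq_empty.1 hne, Nat.sInf_empty]
    · rintro (⟨h1, h2⟩ | ⟨rfl, h⟩)
      · refine le_antisymm (Nat.sInf_le h1) (not_lt.1 fun hlt => ?_)
        have hmem : y ≤ b (atomCount y b) := Nat.sInf_mem (s := {n | y ≤ b n}) ⟨n, h1⟩
        exact absurd (h2 _ hlt) (not_lt.2 hmem)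
      · have : {n | y ≤ b n} = ∅ := Set.eq_empty_iff_forall_notMem.2 fun m hm =>
          absurd (h m) (not_lt.2 hm)
        rw [atomCount, this, Nat.sInf_empty]
  rw [hset]
  refine MeasurableSet.union ?_ ?_
  · refine (hle n).inter ?_
    change MeasurableSet {b : ℕ → ℝ | ∀ m, m < n → b m < y}
    simp only [Set.ofPred_forall]
    exact MeasurableSet.iInter fun m => MeasurableSet.iInter fun _ => hlt m
  · refine (MeasurableSet.const _).inter ?_
    change MeasurableSet {b : ℕ → ℝ | ∀ m, b m < y}
    rw [Set.ofPred_forall]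
    exact MeasurableSet.iInter hlt

/-- Exactly `n` terms of an increasing sequence are less than `y`. -/
def countSet (y : ℝ) : ℕ → Set (ℕ → ℝ)
  | 0 => {b | y ≤ b 0}
  | n + 1 => {b | b n < y ∧ y ≤ b (n + 1)}

lemma measurableSet_countSet (y : ℝ) (n : ℕ) : MeasurableSet (countSet y n) := by
  cases n with
  | zero => exact measurableSet_le measurable_const (measurable_pi_apply 0)
  | succ n =>
    have h1 : MeasurableSet {b : ℕ → ℝ | b n < y} :=
      measurableSet_lt (measurable_pi_apply n) measurable_const
    exact h1.inter (measurableSet_le measurable_const (measurable_pi_apply (n + 1)))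

lemma atomCount_of_mem_countSet {b : ℕ → ℝ} (hb : StrictMono b) {y : ℝ} {n : ℕ}
    (h : b ∈ countSet y n) : atomCount y b = n := by
  cases n with
  | zero => exact Nat.le_zero.1 (Nat.sInf_le h)
  | succ n =>
    refine le_antisymm (Nat.sInf_le h.2) (Nat.succ_le_of_lt ?_)
    by_contra hc
    have hmem : y ≤ b (atomCount y b) := Nat.sInf_mem (s := {n | y ≤ b n}) ⟨n + 1, h.2⟩
    exact absurd (h.1.trans_le hmem) (not_lt.2 (hb.monotone (not_lt.1 hc)))

/-- If the last atom before `y` is at a, the next gap must be at least y - a, which has probability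
e^(a-y). Integrating this against the Gamma density of that atom gives the Poisson weight. -/
lemma blockLaw_countSet {y : ℝ} (hy : 0 ≤ y) (n : ℕ) :
    blockLaw (countSet y n) = ENNReal.ofReal (Real.exp (-y) * y ^ n / (n.factorial : ℝ)) := by
  cases n with
  | zero =>
    have h := lintegral_block_zero (φ := (Set.Ici y).indicator 1)
      (measurable_one.indicator measurableSet_Ici)
    rw [lintegral_indicator_one measurableSet_Ici, expMeasure_Ici hy] at h
    rw [← lintegral_indicator_one (measurableSet_countSet y 0)]
    refine Eq.trans h ?_
    simp
  | succ n =>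
    have hm : MeasurableSet {q : ℝ × ℝ | q.1 < y ∧ y ≤ q.2} :=
      (measurableSet_lt measurable_fst measurable_const).inter
        (measurableSet_le measurable_const measurable_snd)
    have h := lintegral_block_succ n (Φ := fun s t => {q : ℝ × ℝ | q.1 < y ∧ y ≤ q.2}.indicator 1
      (s, t)) (measurable_one.indicator hm)
    rw [← lintegral_indicator_one (measurableSet_countSet y (n + 1))]
    refine Eq.trans h ?_
    have h2 : ∀ a, ∫⁻ s, {q : ℝ × ℝ | q.1 < y ∧ y ≤ q.2}.indicator (1 : ℝ × ℝ → ℝ≥0∞) (a, a + s)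
        ∂(expMeasure 1) = (Set.Iio y).indicator (fun a => ENNReal.ofReal (Real.exp (a - y))) a := by
      intro a
      by_cases ha : a < y
      · rw [Set.indicator_of_mem (show a ∈ Set.Iio y from ha),
          show a - y = -(y - a) by ring, ← expMeasure_Ici (by linarith),
          ← lintegral_indicator_one measurableSet_Ici]
        refine lintegral_congr fun s => ?_
        by_cases hs : y ≤ a + s
        · rw [Set.indicator_of_mem (show (a, a + s) ∈ {q : ℝ × ℝ | q.1 < y ∧ y ≤ q.2} from ⟨ha, hs⟩),
            Set.indicator_of_mem (show s ∈ Set.Ici (y - a) by simp; linarith)]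
          rfl
        · rw [Set.indicator_of_notMem (show (a, a + s) ∉ {q : ℝ × ℝ | q.1 < y ∧ y ≤ q.2} from
              fun h => hs h.2),
            Set.indicator_of_notMem (show s ∉ Set.Ici (y - a) by simp; linarith)]
      · rw [Set.indicator_of_notMem (show a ∉ Set.Iio y from ha)]
        simp [Set.indicator, ha]
    simp_rw [h2]
    rw [lintegral_block_gamma n (Measurable.indicator (by fun_prop) measurableSet_Iio)]
    have h3 : ∀ t, ENNReal.ofReal (t ^ n / (n.factorial : ℝ) * Real.exp (-t)) *
        (Set.Iio y).indicator (fun a => ENNReal.ofReal (Real.exp (a - y))) t =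
        (Set.Iio y).indicator (fun t => ENNReal.ofReal (Real.exp (-y)) *
          ENNReal.ofReal (t ^ n / (n.factorial : ℝ))) t := by
      intro t
      by_cases ht : t < y
      · rw [Set.indicator_of_mem (show t ∈ Set.Iio y from ht),
          Set.indicator_of_mem (show t ∈ Set.Iio y from ht),
          ← ENNReal.ofReal_mul' (Real.exp_pos _).le, ← ENNReal.ofReal_mul (Real.exp_pos _).le,
          mul_assoc, ← Real.exp_add, mul_comm, show -t + (t - y) = -y by ring]
      · rw [Set.indicator_of_notMem (show t ∉ Set.Iio y from ht),
          Set.indicator_of_notMem (show t ∉ Set.Iio y from ht), mul_zero]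
    simp_rw [h3]
    rw [lintegral_indicator measurableSet_Iio, Measure.restrict_restrict measurableSet_Iio,
      Set.inter_comm, Set.Ioi_inter_Iio, lintegral_const_mul _ (by fun_prop),
      lintegral_pow_div_factorial hy, ← ENNReal.ofReal_mul (Real.exp_pos _).le, mul_div_assoc]

lemma tsum_poisson (y : ℝ) (hy : 0 ≤ y) :
    ∑' n : ℕ, ENNReal.ofReal (Real.exp (-y) * y ^ n / (n.factorial : ℝ)) = 1 := by
  have h : HasSum (fun n : ℕ => Real.exp (-y) * y ^ n / (n.factorial : ℝ)) 1 := by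
    have := (NormedSpace.expSeries_div_hasSum_exp (𝔸 := ℝ) y).mul_left (Real.exp (-y))
    rw [← Real.exp_eq_exp_ℝ, ← Real.exp_add, neg_add_cancel, Real.exp_zero] at this
    simpa [mul_div_assoc] using this
  rw [← ENNReal.ofReal_tsum_of_nonneg (fun n => by positivity) h.summable, h.tsum_eq,
    ENNReal.ofReal_one]

/-- The events are almost surely disjoint and the Poisson weights sum to one. This excludes an
accumulation of atoms, and so yields divergence of the sequence. -/
lemma ae_mem_countSet {y : ℝ} (hy : 0 ≤ y) : ∀ᵐ b ∂blockLaw, ∃ n, b ∈ countSet y n := by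
  have hdisj : Pairwise fun m n => AEDisjoint blockLaw (countSet y m) (countSet y n) := by
    intro m n hmn
    refine measure_mono_null ?_ (ae_iff.1 ae_block_strictMono)
    rintro b ⟨h1, h2⟩ hb
    exact hmn ((atomCount_of_mem_countSet hb.2 h1).symm.trans (atomCount_of_mem_countSet hb.2 h2))
  have h := measure_iUnion₀ hdisj fun n => (measurableSet_countSet y n).nullMeasurableSet
  simp_rw [blockLaw_countSet hy, tsum_poisson y hy] at h
  have := (prob_compl_eq_zero_iff (MeasurableSet.iUnion (measurableSet_countSet y))).2 h
  filter_upwards [compl_mem_ae_iff.2 this] with b hb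
  simpa using hb

lemma ae_isBlock : ∀ᵐ b ∂blockLaw, IsBlock b := by
  have h : ∀ᵐ b ∂blockLaw, ∀ k : ℕ, ∃ n, b ∈ countSet k n :=
    ae_all_iff.2 fun k => ae_mem_countSet (Nat.cast_nonneg k)
  filter_upwards [ae_block_strictMono, h] with b hb1 hb2
  refine ⟨hb1.1, hb1.2, tendsto_atTop_atTop_of_monotone hb1.2.monotone fun x => ?_⟩
  obtain ⟨k, hk⟩ := exists_nat_ge x
  obtain ⟨n, hn⟩ := hb2 k
  refine ⟨n, hk.trans ?_⟩
  cases n with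
  | zero => exact hn
  | succ n => exact hn.2

lemma blockLaw_atomCount {y : ℝ} (hy : 0 ≤ y) (n : ℕ) : blockLaw {b | atomCount y b = n} =
    ENNReal.ofReal (Real.exp (-y) * y ^ n / (n.factorial : ℝ)) := by
  rw [← blockLaw_countSet hy]
  refine measure_congr ?_
  filter_upwards [ae_isBlock, ae_mem_countSet hy] with b hb1 hb2
  obtain ⟨m, hm⟩ := hb2
  have := atomCount_of_mem_countSet hb1.strictMono hm
  refine propext ⟨fun h => ?_, fun h => atomCount_of_mem_countSet hb1.strictMono h⟩
  obtain rfl : m = n := this.symm.trans h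
  exact hm

lemma map_atomCount {y : ℝ} (hy : 0 ≤ y) :
    blockLaw.map (atomCount y) = poissonMeasure y.toNNReal := by
  refine Measure.ext_of_singleton fun n => ?_
  rw [Measure.map_apply (measurable_atomCount y) (measurableSet_singleton n),
    poissonMeasure_singleton, Real.coe_toNNReal y hy]
  exact blockLaw_atomCount hy n

lemma lintegral_atomCount {y : ℝ} (hy : 0 ≤ y) (F : ℕ → ℝ≥0∞) :
    ∫⁻ b, F (atomCount y b) ∂blockLaw =
      ∑' n, F n * ENNReal.ofReal (Real.exp (-y) * y ^ n / (n.factorial : ℝ)) := by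
  rw [← lintegral_map (f := F) (measurable_of_countable F) (measurable_atomCount y),
    lintegral_countable']
  refine tsum_congr fun n => ?_
  rw [Measure.map_apply (measurable_atomCount y) (measurableSet_singleton n),
    ← blockLaw_atomCount hy n]
  rfl

lemma lintegral_pow_atomCount {y s : ℝ} (hy : 0 ≤ y) (hs : 0 ≤ s) :
    ∫⁻ b, ENNReal.ofReal s ^ atomCount y b ∂blockLaw = ENNReal.ofReal (Real.exp (-(y * (1 - s)))) := by
  rw [lintegral_atomCount hy fun n => ENNReal.ofReal s ^ n]
  have h : ∀ n : ℕ, ENNReal.ofReal s ^ n *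
      ENNReal.ofReal (Real.exp (-y) * y ^ n / (n.factorial : ℝ)) =
      ENNReal.ofReal (Real.exp (-(y * (1 - s)))) *
        ENNReal.ofReal (Real.exp (-(y * s)) * (y * s) ^ n / (n.factorial : ℝ)) := fun n => by
    rw [← ENNReal.ofReal_pow hs, ← ENNReal.ofReal_mul (by positivity),
      ← ENNReal.ofReal_mul (Real.exp_pos _).le]
    congr 1
    have : Real.exp (-y) = Real.exp (-(y * (1 - s))) * Real.exp (-(y * s)) := by
      rw [← Real.exp_add]; congr 1; ring
    rw [this, mul_pow]
    ring
  simp_rw [h]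
  rw [ENNReal.tsum_mul_left, tsum_poisson _ (by positivity), mul_one]

/-- The derivative of the Poisson generating function, obtained by shifting the index; the truncated
exponent at count zero is killed by the factor zero. -/
lemma lintegral_mul_pow_atomCount {y s : ℝ} (hy : 0 ≤ y) (hs : 0 ≤ s) :
    ∫⁻ b, (atomCount y b : ℝ≥0∞) * ENNReal.ofReal s ^ (atomCount y b - 1) ∂blockLaw =
      ENNReal.ofReal (y * Real.exp (-(y * (1 - s)))) := by
  rw [lintegral_atomCount hy fun n => (n : ℝ≥0∞) * ENNReal.ofReal s ^ (n - 1),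
    tsum_eq_zero_add' ENNReal.summable]
  have h : ∀ n : ℕ, ((n + 1 : ℕ) : ℝ≥0∞) * ENNReal.ofReal s ^ (n + 1 - 1) *
      ENNReal.ofReal (Real.exp (-y) * y ^ (n + 1) / ((n + 1).factorial : ℝ)) =
      ENNReal.ofReal y * (ENNReal.ofReal s ^ n *
        ENNReal.ofReal (Real.exp (-y) * y ^ n / (n.factorial : ℝ))) := fun n => by
    rw [← ENNReal.ofReal_natCast, Nat.add_sub_cancel, ← ENNReal.ofReal_pow hs,
      ← ENNReal.ofReal_mul (by positivity), ← ENNReal.ofReal_mul (by positivity),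
      ← ENNReal.ofReal_mul (by positivity), ← ENNReal.ofReal_mul (by positivity)]
    congr 1
    rw [Nat.factorial_succ]
    push_cast
    field_simp
    ring
  simp_rw [h]
  rw [ENNReal.tsum_mul_left, ← lintegral_atomCount hy fun n => ENNReal.ofReal s ^ n,
    lintegral_pow_atomCount hy hs, ← ENNReal.ofReal_mul hy]
  simp

/-! ## The law of the weighted tree -/

/-- The law of the weights of the Poisson-weighted infinite tree. -/
def treeLaw : Measure (List ℕ → ℕ → ℝ) := Measure.infinitePi fun _ => blockLaw

instance : IsProbabilityMeasure treeLaw := by unfold treeLaw; infer_instance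

lemma measurable_shift (v : List ℕ) : Measurable (shift v) :=
  measurable_pi_lambda _ fun u => measurable_pi_apply (u ++ v)

/-! ### Grafting independent subtrees -/

/-- Replace the weights of the subtree of `w`. -/
def graft (w : List ℕ) (f g : List ℕ → ℕ → ℝ) : List ℕ → ℕ → ℝ := fun u =>
  if w <:+ u then g (u.take (u.length - w.length)) else f u

lemma graft_of_not_suffix {w u : List ℕ} (h : ¬ w <:+ u) (f g : List ℕ → ℕ → ℝ) :
    graft w f g u = f u := if_neg h

@[simp] lemma shift_graft (w : List ℕ) (f g : List ℕ → ℕ → ℝ) : shift w (graft w f g) = g := by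
  funext u
  simp [shift, graft]

lemma not_suffix_append {w v : List ℕ} (h1 : ¬ w <:+ v) (h2 : ¬ v <:+ w) (l : List ℕ) :
    ¬ w <:+ l ++ v := fun h => by
  rcases List.suffix_or_suffix_of_suffix h (List.suffix_append l v) with h' | h'
  · exact h1 h'
  · exact h2 h'

lemma shift_graft_of_not_suffix {w v : List ℕ} (h1 : ¬ w <:+ v) (h2 : ¬ v <:+ w)
    (f g : List ℕ → ℕ → ℝ) : shift v (graft w f g) = shift v f := by
  funext l
  exact graft_of_not_suffix (not_suffix_append h1 h2 l) f g

lemma not_cons_suffix_self (i : ℕ) (v : List ℕ) : ¬ i :: v <:+ v := fun h => by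
  have := h.length_le
  simp at this

lemma not_cons_suffix_cons {i j : ℕ} (h : j ≠ i) (v : List ℕ) : ¬ i :: v <:+ j :: v := fun h' => by
  have := h'.eq_of_length (by simp)
  simp only [List.cons.injEq, and_true] at this
  exact h this.symm

lemma shift_graft_sibling {i j : ℕ} (h : j ≠ i) (v : List ℕ) (f g : List ℕ → ℕ → ℝ) :
    shift (j :: v) (graft (i :: v) f g) = shift (j :: v) f :=
  shift_graft_of_not_suffix (not_cons_suffix_cons h v) (not_cons_suffix_cons h.symm v) f g

lemma graft_child_apply (i : ℕ) (v : List ℕ) (f g : List ℕ → ℕ → ℝ) :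
    graft (i :: v) f g v = f v := graft_of_not_suffix (not_cons_suffix_self i v) f g

lemma shift_update_of_not_suffix {w v : List ℕ} (h : ¬ v <:+ w) (f : List ℕ → ℕ → ℝ)
    (b : ℕ → ℝ) : shift v (Function.update f w b) = shift v f := by
  funext l
  refine Function.update_of_ne ?_ _ _
  rintro rfl
  exact h (List.suffix_append l v)

lemma shift_child_update (i : ℕ) (v : List ℕ) (f : List ℕ → ℕ → ℝ) (b : ℕ → ℝ) :
    shift (i :: v) (Function.update f v b) = shift (i :: v) f :=
  shift_update_of_not_suffix (not_cons_suffix_self i v) f b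

lemma measurePreserving_graft (w : List ℕ) :
    MeasurePreserving (fun p : (List ℕ → ℕ → ℝ) × (List ℕ → ℕ → ℝ) => graft w p.1 p.2)
      (treeLaw.prod treeLaw) treeLaw := by
  have hk : Set.InjOn (fun u : List ℕ => u.take (u.length - w.length)) {u | w <:+ u} := by
    rintro _ ⟨l, rfl⟩ _ ⟨l', rfl⟩ h
    have : l = l' := by simpa using h
    rw [this]
  exact measurePreserving_glue blockLaw {u : List ℕ | w <:+ u} hk

/-- The weights of the subtree of `w` are independent of the other weights. -/
lemma lintegral_subtree (w : List ℕ) {Ψ : (List ℕ → ℕ → ℝ) → (List ℕ → ℕ → ℝ) → ℝ≥0∞}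
    (hΨ : Measurable (Function.uncurry Ψ)) (hdep : ∀ f g h, Ψ (graft w f g) h = Ψ f h) :
    ∫⁻ f, Ψ f (shift w f) ∂treeLaw = ∫⁻ f, ∫⁻ g, Ψ f g ∂treeLaw ∂treeLaw := by
  have h1 : Measurable fun f => Ψ f (shift w f) :=
    hΨ.comp (measurable_id.prodMk (measurable_shift w))
  rw [← (measurePreserving_graft w).lintegral_comp h1]
  simp only [shift_graft, hdep]
  exact lintegral_prod _ hΨ.aemeasurable

/-- The weights at `v` are independent of the other weights. -/
lemma lintegral_vertex (v : List ℕ) {Ψ : (ℕ → ℝ) → (List ℕ → ℕ → ℝ) → ℝ≥0∞}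
    (hΨ : Measurable (Function.uncurry Ψ))
    (hdep : ∀ b f b', Ψ b (Function.update f v b') = Ψ b f) :
    ∫⁻ f, Ψ (f v) f ∂treeLaw = ∫⁻ f, ∫⁻ b, Ψ b f ∂blockLaw ∂treeLaw := by
  have h0 : Measurable fun f : List ℕ → ℕ → ℝ => (f v, f) := by fun_prop
  have h1 : Measurable fun f : List ℕ → ℕ → ℝ => Ψ (f v) f := hΨ.comp h0
  rw [treeLaw, lintegral_resample_coordinate blockLaw v h1]
  simp only [Function.update_self, hdep]

lemma lintegral_vertex_swap (v : List ℕ) {Ψ : (ℕ → ℝ) → (List ℕ → ℕ → ℝ) → ℝ≥0∞}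
    (hΨ : Measurable (Function.uncurry Ψ))
    (hdep : ∀ b f b', Ψ b (Function.update f v b') = Ψ b f) :
    ∫⁻ f, Ψ (f v) f ∂treeLaw = ∫⁻ b, ∫⁻ f, Ψ b f ∂treeLaw ∂blockLaw := by
  have h : Measurable (Function.uncurry fun f b => Ψ b f) := hΨ.comp measurable_swap
  rw [lintegral_vertex v hΨ hdep, lintegral_lintegral_swap h.aemeasurable]

/-- Subtrees of distinct siblings are independent: grafting onto one of them does not touch the
others, so they are split off one at a time. -/
lemma lintegral_prod_children (v : List ℕ) (s : Finset ℕ) {F : ℕ → (List ℕ → ℕ → ℝ) → ℝ≥0∞}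
    (hF : ∀ j, Measurable (F j)) :
    ∫⁻ f, ∏ j ∈ s, F j (shift (j :: v) f) ∂treeLaw = ∏ j ∈ s, ∫⁻ g, F j g ∂treeLaw := by
  classical
  induction s using Finset.induction_on with
  | empty => simp
  | insert a s ha ih =>
    have hm : Measurable fun f => ∏ j ∈ s, F j (shift (j :: v) f) :=
      Finset.measurable_prod _ fun j _ => (hF j).comp (measurable_shift _)
    simp_rw [Finset.prod_insert ha]
    rw [lintegral_subtree (a :: v) (Ψ := fun f g => F a g * ∏ j ∈ s, F j (shift (j :: v) f))
      (((hF a).comp measurable_snd).mul (hm.comp measurable_fst))]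
    · simp_rw [lintegral_mul_const _ (hF a)]
      rw [lintegral_const_mul _ hm, ih]
    · intro f g h
      congr 1
      refine Finset.prod_congr rfl fun j hj => ?_
      rw [shift_graft_sibling (by rintro rfl; exact ha hj)]

lemma ae_isBlock_tree : ∀ᵐ f ∂treeLaw, ∀ u, IsBlock (f u) :=
  ae_all_iff.2 fun u =>
    (measurePreserving_eval_infinitePi (fun _ : List ℕ => blockLaw) u).quasiMeasurePreserving.ae
      ae_isBlock

/-! ## Measurability -/

/-- Finiteness is a countable union, over the finite subsets of a countable type, of the event that
nothing outside the subset occurs. -/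
lemma measurableSet_finite {α X : Type*} [Countable α] [MeasurableSpace X] {p : X → α → Prop}
    (hp : ∀ a, MeasurableSet {x | p x a}) : MeasurableSet {x | {a | p x a}.Finite} := by
  classical
  have : {x | {a | p x a}.Finite} = ⋃ F : Finset α, ⋂ a ∈ {a | a ∉ F}, {x | p x a}ᶜ := by
    ext x
    simp only [Set.mem_ofPred_eq, Set.mem_iUnion, Set.mem_iInter, Set.mem_compl_iff]
    exact ⟨fun h => ⟨h.toFinset, fun a ha hx => ha (by simpa using hx)⟩, fun ⟨F, hF⟩ =>
      F.finite_toSet.subset fun a ha => by_contra fun hc => hF a (by simpa using hc) ha⟩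
  rw [this]
  exact MeasurableSet.iUnion fun F => MeasurableSet.biInter (Set.to_countable _)
    fun a _ => (hp a).compl

lemma measurableSet_weight_lt (u : List ℕ) (i : ℕ) :
    MeasurableSet {p : (List ℕ → ℕ → ℝ) × ℝ | p.1 u i < p.2} :=
  measurableSet_lt (by fun_prop) measurable_snd

lemma measurableSet_belowOpen (l : List ℕ) :
    MeasurableSet {p : (List ℕ → ℕ → ℝ) × ℝ | BelowOpen p.1 p.2 l} := by
  induction l with
  | nil => exact MeasurableSet.const True
  | cons i u ih => exact ih.inter (measurableSet_weight_lt u i)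

lemma measurableSet_finBelow :
    MeasurableSet {p : (List ℕ → ℕ → ℝ) × ℝ | FinBelow p.1 p.2} :=
  measurableSet_finite measurableSet_belowOpen

lemma measurable_shift_prod (v : List ℕ) :
    Measurable fun p : (List ℕ → ℕ → ℝ) × ℝ => (shift v p.1, p.2) :=
  ((measurable_shift v).comp measurable_fst).prodMk measurable_snd

lemma measurableSet_upInf (v : List ℕ) :
    MeasurableSet {p : (List ℕ → ℕ → ℝ) × ℝ | UpInf p.1 p.2 v} := by
  induction v with
  | nil => exact MeasurableSet.const False
  | cons i u ih =>
    refine (measurableSet_weight_lt u i).inter (ih.union ?_)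
    change MeasurableSet {p : (List ℕ → ℕ → ℝ) × ℝ | ∃ j, j ≠ i ∧ p.1 u j < p.2 ∧
      ¬ FinBelow (shift (j :: u) p.1) p.2}
    rw [Set.ofPred_exists]
    exact MeasurableSet.iUnion fun j => (MeasurableSet.const _).inter
      ((measurableSet_weight_lt u j).inter
        (measurable_shift_prod (j :: u) measurableSet_finBelow).compl)

lemma measurableSet_clusterInf (v : List ℕ) :
    MeasurableSet {p : (List ℕ → ℕ → ℝ) × ℝ | ClusterInf p.1 p.2 v} :=
  (measurableSet_upInf v).union (measurable_shift_prod v measurableSet_finBelow).compl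

lemma measurable_thr {X : Type*} [MeasurableSpace X] {A : X → ℝ → Prop}
    (hmono : ∀ x y z, y ≤ z → A x y → A x z) (hA : ∀ y, MeasurableSet {x | A x y}) :
    Measurable fun x => thr (A x) := by
  refine measurable_of_Iio fun c => ?_
  have : (fun x => thr (A x)) ⁻¹' Set.Iio c = ⋃ r ∈ {r : ℚ | ((r : ℝ) : EReal) < c},
      {x | A x r} := by
    ext x
    simp only [Set.mem_preimage, Set.mem_Iio, thr_lt_iff, Set.mem_iUnion, Set.mem_ofPred_eq,
      exists_prop]
    constructor
    · rintro ⟨y, hy, hyc⟩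
      obtain ⟨z, hz1, hz2⟩ := EReal.lt_iff_exists_real_btwn.1 hyc
      obtain ⟨r, hr1, hr2⟩ := exists_rat_btwn (EReal.coe_lt_coe_iff.1 hz1)
      exact ⟨r, (EReal.coe_lt_coe_iff.2 hr2).trans hz2, hmono _ _ _ hr1.le hy⟩
    · rintro ⟨r, hr, hx⟩
      exact ⟨r, hx, hr⟩
  rw [this]
  exact MeasurableSet.biUnion (Set.to_countable _) fun r _ => hA r

lemma measurableSet_section {A : Set ((List ℕ → ℕ → ℝ) × ℝ)} (hA : MeasurableSet A) (y : ℝ) :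
    MeasurableSet {f | (f, y) ∈ A} := measurable_prodMk_right hA

lemma measurable_level (v : List ℕ) : Measurable fun f => level f v :=
  measurable_thr (fun _ _ _ h => ClusterInf.mono h)
    fun y => measurableSet_section (measurableSet_clusterInf v) y

lemma measurableSet_invasionMem (v : List ℕ) :
    MeasurableSet {f : List ℕ → ℕ → ℝ | InvasionMem f v} := by
  induction v with
  | nil => exact MeasurableSet.const True
  | cons i u ih =>
    have h : Measurable fun f : List ℕ → ℕ → ℝ => (f, f u i) := by fun_prop
    exact ih.inter (h (measurableSet_clusterInf u)).compl

lemma measurableSet_hangGood (ν : EReal) (p : List ℕ) :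
    MeasurableSet {q : (List ℕ → ℕ → ℝ) × ℝ | HangGood ν p q.1 q.2} := by
  induction p with
  | nil => exact measurableSet_finBelow
  | cons i p ih =>
    have h : Measurable fun q : (List ℕ → ℕ → ℝ) × ℝ => (shift [i] q.1, q.1 [] i) :=
      ((measurable_shift [i]).comp measurable_fst).prodMk (by fun_prop)
    have h1 : Measurable fun q : (List ℕ → ℕ → ℝ) × ℝ => q.1 [] i := by fun_prop
    have h2 : MeasurableSet {q : (List ℕ → ℕ → ℝ) × ℝ | (q.1 [] i : EReal) ≤ ν} :=
      (measurable_coe_real_ereal.comp h1) measurableSet_Iic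
    have h3 : MeasurableSet {q : (List ℕ → ℕ → ℝ) × ℝ | q.2 ≤ q.1 [] i} :=
      measurableSet_le measurable_snd h1
    exact measurableSet_finBelow.inter
      (((measurableSet_weight_lt [] i).inter (measurable_shift_prod [i] ih)).union
        (h3.inter (h2.inter (h ih))))

lemma measurable_hangCount (ν : EReal) (n : ℕ) :
    Measurable (Function.uncurry (hangCount ν n)) := by
  classical
  refine Measurable.tsum fun p => ?_
  exact Measurable.ite ((MeasurableSet.const _).inter (measurableSet_hangGood ν p))
    measurable_const measurable_const

lemma measurable_hangTotal (ν : EReal) : Measurable (Function.uncurry (hangTotal ν)) := by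
  classical
  refine Measurable.tsum fun p => ?_
  exact Measurable.ite (measurableSet_hangGood ν p) measurable_const measurable_const

/-! ## Almost sure properties of the weights -/

lemma upInf_update (f : List ℕ → ℕ → ℝ) (y : ℝ) (v : List ℕ) (b : ℕ → ℝ) (w : List ℕ)
    (hw : v <:+ w) : UpInf (Function.update f w b) y v ↔ UpInf f y v := by
  induction v with
  | nil => rfl
  | cons i u ih =>
    have hne : u ≠ w := by
      rintro rfl
      exact not_cons_suffix_self i u hw
    have hu : u <:+ w := (List.suffix_cons i u).trans hw
    have hs : ∀ j, j ≠ i → shift (j :: u) (Function.update f w b) = shift (j :: u) f := fun j hj =>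
      shift_update_of_not_suffix (fun h => by
        rcases List.suffix_or_suffix_of_suffix h hw with h' | h'
        · exact not_cons_suffix_cons hj.symm u h'
        · exact not_cons_suffix_cons hj u h') f b
    simp only [upInf_cons, ih hu, Function.update_of_ne hne]
    refine and_congr_right fun _ => or_congr_right (exists_congr fun j => and_congr_right fun hj => ?_)
    rw [hs j hj]

lemma upInf_graft (f g : List ℕ → ℕ → ℝ) (y : ℝ) (v w : List ℕ) (hw : v <:+ w) :
    UpInf (graft w f g) y v ↔ UpInf f y v := by
  induction v with
  | nil => rfl
  | cons i u ih =>
    have hne : ¬ w <:+ u := fun h => not_cons_suffix_self i u (hw.trans h)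
    have hu : u <:+ w := (List.suffix_cons i u).trans hw
    have hs : ∀ j, j ≠ i → shift (j :: u) (graft w f g) = shift (j :: u) f := fun j hj =>
      shift_graft_of_not_suffix (fun h => not_cons_suffix_cons hj u (hw.trans h)) (fun h => by
        rcases List.suffix_or_suffix_of_suffix h hw with h' | h'
        · exact not_cons_suffix_cons hj.symm u h'
        · exact not_cons_suffix_cons hj u h') f g
    simp only [upInf_cons, ih hu, graft_of_not_suffix hne]
    refine and_congr_right fun _ => or_congr_right (exists_congr fun j => and_congr_right fun hj => ?_)
    rw [hs j hj]

/-- The atoms at `u` have diffuse laws and are independent of a quantity that ignores the weights at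
`u`. -/
lemma ae_weight_ne (u : List ℕ) (i : ℕ) {F : (List ℕ → ℕ → ℝ) → EReal} (hF : Measurable F)
    (hdep : ∀ f b, F (Function.update f u b) = F f) :
    ∀ᵐ f ∂treeLaw, ((f u i : ℝ) : EReal) ≠ F f := by
  have hm : MeasurableSet {q : (ℕ → ℝ) × (List ℕ → ℕ → ℝ) | ((q.1 i : ℝ) : EReal) = F q.2} :=
    measurableSet_eq_fun (measurable_coe_real_ereal.comp (by fun_prop)) (hF.comp measurable_snd)
  have hm' : MeasurableSet {f : List ℕ → ℕ → ℝ | ((f u i : ℝ) : EReal) = F f} :=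
    measurableSet_eq_fun (measurable_coe_real_ereal.comp (by fun_prop)) hF
  have h := lintegral_vertex u (Ψ := fun b f => {q : (ℕ → ℝ) × (List ℕ → ℕ → ℝ) |
    ((q.1 i : ℝ) : EReal) = F q.2}.indicator 1 (b, f)) (measurable_one.indicator hm)
    (fun b f b' => by simp only [Set.indicator, Set.mem_ofPred_eq, hdep, Pi.one_apply])
  have h0 : ∀ f, ∫⁻ b, {q : (ℕ → ℝ) × (List ℕ → ℕ → ℝ) |
      ((q.1 i : ℝ) : EReal) = F q.2}.indicator 1 (b, f) ∂blockLaw = 0 := by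
    intro f
    refine le_antisymm ?_ bot_le
    -- For infinite `F f` the left side vanishes, so the default value of `toReal` does no harm.
    have hle : ∀ b : ℕ → ℝ, {q : (ℕ → ℝ) × (List ℕ → ℕ → ℝ) |
        ((q.1 i : ℝ) : EReal) = F q.2}.indicator
          (1 : (ℕ → ℝ) × (List ℕ → ℕ → ℝ) → ℝ≥0∞) (b, f) ≤
        {b : ℕ → ℝ | b i = (F f).toReal}.indicator 1 b := by
      intro b
      by_cases hb : ((b i : ℝ) : EReal) = F f
      · have : b i = (F f).toReal := by rw [← hb, EReal.toReal_coe]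
        rw [Set.indicator_of_mem (show b ∈ {b : ℕ → ℝ | b i = (F f).toReal} from this)]
        exact Set.indicator_le_self _ _ _
      · rw [Set.indicator_of_notMem (show (b, f) ∉ {q : (ℕ → ℝ) × (List ℕ → ℕ → ℝ) |
          ((q.1 i : ℝ) : EReal) = F q.2} from hb)]
        exact bot_le
    refine (lintegral_mono hle).trans (le_of_eq ?_)
    rw [lintegral_indicator_one (measurableSet_eq_fun (measurable_pi_apply i) measurable_const)]
    exact blockLaw_atom i _
  simp only [h0, lintegral_zero] at h
  have h2 : treeLaw {f : List ℕ → ℕ → ℝ | ((f u i : ℝ) : EReal) = F f} = 0 := by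
    rw [← lintegral_indicator_one hm']
    exact h
  rw [ae_iff]
  simpa using h2

lemma ae_isRegular : ∀ᵐ f ∂treeLaw, IsRegular f := by
  have h : ∀ᵐ f ∂treeLaw, ∀ u i u' i', u' ≠ u → ((f u i : ℝ) : EReal) ≠ ((f u' i' : ℝ) : EReal) := by
    simp only [ae_all_iff]
    intro u i u' i' hne
    exact ae_weight_ne u i (measurable_coe_real_ereal.comp (by fun_prop))
      (fun f b => by rw [Function.update_of_ne hne])
  filter_upwards [h, ae_isBlock_tree] with f h1 h2
  refine ⟨fun u => (h2 u).strictMono, fun u => (h2 u).tendsto, fun u i u' i' heq => ?_⟩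
  by_cases hne : u' = u
  · subst hne
    exact ⟨rfl, (h2 u').strictMono.injective heq⟩
  · exact absurd (congrArg _ heq) (h1 u i u' i' hne)

/-- No weight coincides with the critical level of an independent part of the tree. -/
def IsOffCritical (f : List ℕ → ℕ → ℝ) : Prop :=
  ∀ v i, ((f v i : ℝ) : EReal) ≠ thr (fun y => UpInf f y v) ∧
    ∀ j, ((f v i : ℝ) : EReal) ≠ thr fun y => ¬ FinBelow (shift (j :: v) f) y

lemma ae_isOffCritical : ∀ᵐ f ∂treeLaw, IsOffCritical f := by
  simp only [IsOffCritical, ae_all_iff]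
  intro v i
  refine (ae_weight_ne v i ?_ ?_).and (ae_all_iff.2 fun j => ae_weight_ne v i ?_ ?_)
  · exact measurable_thr (fun _ _ _ h => UpInf.mono h)
      fun y => measurableSet_section (measurableSet_upInf v) y
  · intro f b
    simp only [upInf_update f _ v b v List.suffix_rfl]
  · exact measurable_thr (fun _ _ _ h h' h'' => h' (h''.anti h))
      fun y => measurableSet_section (measurable_shift_prod (j :: v) measurableSet_finBelow).compl y
  · intro f b
    simp only [shift_child_update]

/-- An infinite cluster at the weight of the edge stays infinite at some smaller level: the
responsible part is independent of the weights at `v`, so that weight avoids its threshold. Hence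
the cluster condition becomes a strict inequality with the level. -/
lemma IsRegular.clusterInf_weight_iff {f : List ℕ → ℕ → ℝ} (hf : IsRegular f)
    (hoff : IsOffCritical f) (v : List ℕ) (i : ℕ) :
    ClusterInf f (f v i) v ↔ level f v < f v i := by
  constructor
  · intro h
    rcases (clusterInf_iff (hf.tendsto v)).1 h with h | ⟨j, hj, h⟩
    · obtain ⟨z, hz, hlt⟩ := thr_lt_iff.1
        (lt_of_le_of_ne (thr_le (A := fun y => UpInf f y v) h) (hoff v i).1.symm)
      exact (thr_le (Or.inl hz)).trans_lt hlt
    · obtain ⟨z, hz, hlt⟩ := thr_lt_iff.1 (lt_of_le_of_ne (thr_le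
        (A := fun y => ¬ FinBelow (shift (j :: v) f) y) h) ((hoff v i).2 j).symm)
      obtain ⟨z', h1, h2⟩ := exists_between hj
      refine lt_of_le_of_lt (thr_le (y := max z z') ?_)
        (EReal.coe_lt_coe_iff.2 (max_lt (EReal.coe_lt_coe_iff.1 hlt) h2))
      exact (clusterInf_iff (hf.tendsto v)).2 (Or.inr ⟨j, h1.trans_le (le_max_right _ _),
        fun h' => hz (h'.anti (le_max_left _ _))⟩)
  · intro h
    obtain ⟨z, hz, hlt⟩ := thr_lt_iff.1 h
    exact hz.mono (EReal.coe_lt_coe_iff.1 hlt).le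

/-! ## Extinction probabilities -/

lemma measurable_prod_count {X : Type*} [MeasurableSpace X] {F : ℕ → X → ℝ≥0∞}
    (hF : ∀ n, Measurable (F n)) (y : ℝ) :
    Measurable fun q : (ℕ → ℝ) × X => F (atomCount y q.1) q.2 := by
  have h : Measurable fun p : ℕ × X => F p.1 p.2 := measurable_from_prod_countable_right hF
  have h' : Measurable fun q : (ℕ → ℝ) × X => (atomCount y q.1, q.2) :=
    ((measurable_atomCount y).comp measurable_fst).prodMk measurable_snd
  exact h.comp h'

/-- Given the root atoms, the open children are the first `atomCount y` ones and their subtrees are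
independent copies of the whole tree. -/
lemma treeLaw_children {A : Set (List ℕ → ℕ → ℝ)} (hA : MeasurableSet A) (y : ℝ) :
    treeLaw {f | ∀ i, f [] i < y → shift [i] f ∈ A} =
      ∫⁻ b, treeLaw A ^ atomCount y b ∂blockLaw := by
  have hFm : ∀ n, Measurable fun f => ∏ j ∈ Finset.range n, A.indicator (1 : (List ℕ → ℕ → ℝ) → ℝ≥0∞)
      (shift [j] f) := fun n =>
    Finset.measurable_prod _ fun j _ => (measurable_one.indicator hA).comp (measurable_shift _)
  have hm : MeasurableSet {f : List ℕ → ℕ → ℝ | ∀ i, f [] i < y → shift [i] f ∈ A} := by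
    rw [Set.ofPred_forall]
    refine MeasurableSet.iInter fun i => ?_
    have h1 : MeasurableSet {f : List ℕ → ℕ → ℝ | f [] i < y} :=
      measurableSet_lt (by fun_prop) measurable_const
    exact h1.imp (measurable_shift [i] hA)
  have h1 : ∀ᵐ f ∂treeLaw, {f | ∀ i, f [] i < y → shift [i] f ∈ A}.indicator 1 f =
      ∏ j ∈ Finset.range (atomCount y (f [])), A.indicator (1 : (List ℕ → ℕ → ℝ) → ℝ≥0∞) (shift [j] f) := by
    filter_upwards [ae_isBlock_tree] with f hf
    by_cases h : ∀ i, f [] i < y → shift [i] f ∈ A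
    · rw [Set.indicator_of_mem (show f ∈ {f | ∀ i, f [] i < y → shift [i] f ∈ A} from h)]
      refine (Finset.prod_eq_one fun j hj => ?_).symm
      rw [Set.indicator_of_mem (h j ((hf []).lt_atomCount_iff.1 (Finset.mem_range.1 hj)))]
      rfl
    · rw [Set.indicator_of_notMem (show f ∉ {f | ∀ i, f [] i < y → shift [i] f ∈ A} from h)]
      push Not at h
      obtain ⟨i, hi, hiA⟩ := h
      exact (Finset.prod_eq_zero (Finset.mem_range.2 ((hf []).lt_atomCount_iff.2 hi))
        (Set.indicator_of_notMem hiA _)).symm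
  have hΨ := measurable_prod_count hFm y
  rw [← lintegral_indicator_one hm, lintegral_congr_ae h1, lintegral_vertex_swap []
    (Ψ := fun b f => ∏ j ∈ Finset.range (atomCount y b), A.indicator (1 : (List ℕ → ℕ → ℝ) → ℝ≥0∞) (shift [j] f))
    hΨ (fun b f b' => by simp only [shift_child_update])]
  refine lintegral_congr fun b => ?_
  rw [lintegral_prod_children [] _ fun _ => measurable_one.indicator hA]
  simp [lintegral_indicator_one hA]

/-- The probability that the cluster of the root at level `y` is finite. -/
def extProb (y : ℝ) : ℝ≥0∞ := treeLaw {f | FinBelow f y}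

lemma extProb_le_one (y : ℝ) : extProb y ≤ 1 := prob_le_one

lemma extProb_ne_top (y : ℝ) : extProb y ≠ ∞ := measure_ne_top _ _

lemma measurableSet_finBelow_section (y : ℝ) : MeasurableSet {f | FinBelow f y} :=
  measurableSet_section measurableSet_finBelow y

lemma extProb_eq_lintegral (y : ℝ) :
    extProb y = ∫⁻ b, extProb y ^ atomCount y b ∂blockLaw := by
  conv_rhs => rw [extProb, ← treeLaw_children (measurableSet_finBelow_section y) y]
  refine measure_congr ?_
  filter_upwards [ae_isBlock_tree] with f hf
  exact propext (finBelow_iff (hf []).tendsto)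

/-- There are no vertices at depth `n` in the cluster of the root. -/
def ExtinctBy (y : ℝ) : ℕ → (List ℕ → ℕ → ℝ) → Prop
  | 0, _ => False
  | n + 1, f => ∀ i, f [] i < y → ExtinctBy y n (shift [i] f)

lemma exists_belowOpen_of_not_extinctBy {y : ℝ} {n : ℕ} {f : List ℕ → ℕ → ℝ}
    (h : ¬ ExtinctBy y n f) : ∃ l : List ℕ, l.length = n ∧ BelowOpen f y l := by
  induction n generalizing f with
  | zero => exact ⟨[], rfl, trivial⟩
  | succ n ih =>
    simp only [ExtinctBy] at h
    push Not at h
    obtain ⟨i, hi, h⟩ := h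
    obtain ⟨l, hl, h'⟩ := ih h
    exact ⟨l ++ [i], by simp [hl], belowOpen_append_singleton.2 ⟨hi, h'⟩⟩

lemma ExtinctBy.succ {y : ℝ} {n : ℕ} {f : List ℕ → ℕ → ℝ} (h : ExtinctBy y n f) :
    ExtinctBy y (n + 1) f := by
  induction n generalizing f with
  | zero => exact h.elim
  | succ n ih => exact fun i hi => ih (h i hi)

/-- Otherwise there would be an open vertex at every depth, hence infinitely many. Thus extinction
is reached in finitely many generations, as needed for approximating the smallest fixed point. -/
lemma exists_extinctBy {y : ℝ} {f : List ℕ → ℕ → ℝ} (h : FinBelow f y) :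
    ∃ n, ExtinctBy y n f := by
  by_contra hc
  push Not at hc
  choose l hl1 hl2 using fun n => exists_belowOpen_of_not_extinctBy (hc n)
  refine Set.infinite_of_injective_forall_mem (f := l) (fun m n hmn => ?_) hl2 h
  rw [← hl1 m, hmn, hl1 n]

lemma measurableSet_extinctBy (y : ℝ) (n : ℕ) : MeasurableSet {f | ExtinctBy y n f} := by
  induction n with
  | zero => exact MeasurableSet.const False
  | succ n ih =>
    change MeasurableSet {f : List ℕ → ℕ → ℝ | ∀ i, f [] i < y → ExtinctBy y n (shift [i] f)}
    rw [Set.ofPred_forall]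
    refine MeasurableSet.iInter fun i => ?_
    have h1 : MeasurableSet {f : List ℕ → ℕ → ℝ | f [] i < y} :=
      measurableSet_lt (by fun_prop) measurable_const
    exact h1.imp (measurable_shift [i] ih)

/-- The extinction probability is the smallest fixed point. -/
lemma extProb_le {y s : ℝ} (hy : 0 ≤ y) (hs : 0 ≤ s) (hfix : Real.exp (-(y * (1 - s))) = s) :
    extProb y ≤ ENNReal.ofReal s := by
  -- The generating function is monotone and fixes `s`, so iterating it from zero never passes `s`.
  have hn : ∀ n, treeLaw {f | ExtinctBy y n f} ≤ ENNReal.ofReal s := by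
    intro n
    induction n with
    | zero => simp [ExtinctBy]
    | succ n ih =>
      have h := treeLaw_children (measurableSet_extinctBy y n) y
      calc treeLaw {f | ExtinctBy y (n + 1) f}
          = ∫⁻ b, treeLaw {f | ExtinctBy y n f} ^ atomCount y b ∂blockLaw := h
        _ ≤ ∫⁻ b, ENNReal.ofReal s ^ atomCount y b ∂blockLaw :=
            lintegral_mono fun b => by gcongr
        _ = ENNReal.ofReal s := by rw [lintegral_pow_atomCount hy hs, hfix]
  have hmono : Monotone fun n => {f | ExtinctBy y n f} :=
    monotone_nat_of_le_succ fun n f hf => ExtinctBy.succ hf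
  have hsub : {f | FinBelow f y} ⊆ ⋃ n, {f | ExtinctBy y n f} := fun f hf => by
    obtain ⟨n, hn⟩ := exists_extinctBy hf
    exact Set.mem_iUnion.2 ⟨n, hn⟩
  refine (measure_mono hsub).trans ?_
  rw [hmono.measure_iUnion]
  exact iSup_le hn

lemma extProb_fixed {y : ℝ} (hy : 0 ≤ y) :
    Real.exp (-(y * (1 - (extProb y).toReal))) = (extProb y).toReal := by
  have h := extProb_eq_lintegral y
  rw [← ENNReal.ofReal_toReal (extProb_ne_top y),
    lintegral_pow_atomCount hy ENNReal.toReal_nonneg] at h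
  have := congrArg ENNReal.toReal h
  rw [ENNReal.toReal_ofReal ENNReal.toReal_nonneg, ENNReal.toReal_ofReal (Real.exp_pos _).le] at this
  exact this.symm

lemma extProb_anti : Antitone extProb := fun _ _ h => measure_mono fun _ hf => hf.anti h

/-! ## Survival probability and dual parameter -/

lemma measurableSet_inGWTree (u : List ℕ) : MeasurableSet {N : List ℕ → ℕ | InGWTree N u} := by
  induction u with
  | nil => exact MeasurableSet.const True
  | cons i u ih =>
    have h : MeasurableSet {N : List ℕ → ℕ | i < N u} :=
      measurableSet_lt measurable_const (measurable_pi_apply u)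
    exact ih.inter h

/-- The numbers of open children are independent Poisson variables, and the Galton-Watson tree they
define is, almost surely, the open cluster of the root. -/
lemma theta_eq {y : ℝ} (hy : 0 ≤ y) : theta y = 1 - (extProb y).toReal := by
  have hmap : (Measure.infinitePi fun _ : List ℕ => poissonMeasure y.toNNReal) =
      treeLaw.map fun f u => atomCount y (f u) := by
    rw [treeLaw, Measure.infinitePi_map_pi _ (fun _ => measurable_atomCount y)]
    simp only [map_atomCount hy]
  have hmeas : Measurable fun (f : List ℕ → ℕ → ℝ) u => atomCount y (f u) :=
    measurable_pi_lambda _ fun u => (measurable_atomCount y).comp (measurable_pi_apply u)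
  have hfin := measurableSet_finite measurableSet_inGWTree
  have hset : {f : List ℕ → ℕ → ℝ | {u | InGWTree (fun u => atomCount y (f u)) u}.Infinite}
      =ᵐ[treeLaw] {f | FinBelow f y}ᶜ := by
    filter_upwards [ae_isBlock_tree] with f hf
    have : ∀ u, InGWTree (fun u => atomCount y (f u)) u ↔ BelowOpen f y u := by
      intro u
      induction u with
      | nil => rfl
      | cons i u ih => exact and_congr ih (hf u).lt_atomCount_iff
    refine propext ?_
    change {u | InGWTree (fun u => atomCount y (f u)) u}.Infinite ↔ ¬ {u | BelowOpen f y u}.Finite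
    simp only [this]
    rfl
  have hinf : MeasurableSet {N : List ℕ → ℕ | {u | InGWTree N u}.Infinite} := hfin.compl
  rw [theta, hmap, measureReal_def, Measure.map_apply hmeas hinf]
  have h2 := measure_congr hset
  have h3 : treeLaw ({f | FinBelow f y}ᶜ : Set (List ℕ → ℕ → ℝ)) = 1 - extProb y :=
    prob_compl_eq_one_sub (measurableSet_finBelow_section y)
  refine (congrArg ENNReal.toReal (h2.trans h3)).trans ?_
  rw [ENNReal.toReal_sub_of_le (extProb_le_one y) ENNReal.one_ne_top, ENNReal.toReal_one]

lemma strictMonoOn_mul_exp_neg : StrictMonoOn (fun t : ℝ => t * Real.exp (-t)) (Set.Iic 1) := by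
  refine strictMonoOn_of_deriv_pos (convex_Iic 1) (by fun_prop) fun t ht => ?_
  rw [interior_Iic] at ht
  have h : HasDerivAt (fun t : ℝ => t * Real.exp (-t))
      (1 * Real.exp (-t) + t * (Real.exp (-t) * (-1))) t :=
    (hasDerivAt_id t).mul ((hasDerivAt_id t).neg.exp)
  rw [h.deriv]
  have : 0 < (1 - t) * Real.exp (-t) := mul_pos (by simpa using ht) (Real.exp_pos _)
  linarith

lemma mul_exp_neg_lt {y z : ℝ} (hy : 1 ≤ y) (hyz : y < z) :
    z * Real.exp (-z) < y * Real.exp (-y) := by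
  -- From 1 + x < e^x at x = z - y, together with z ≤ y (z - y + 1), which says (y - 1)(z - y) ≥ 0.
  have h1 : z < y * Real.exp (z - y) := by
    have h2 := Real.add_one_lt_exp (sub_pos.2 hyz).ne'
    have : y * (z - y + 1) < y * Real.exp (z - y) := mul_lt_mul_of_pos_left h2 (by linarith)
    nlinarith
  have h3 : Real.exp (-y) = Real.exp (z - y) * Real.exp (-z) := by
    rw [← Real.exp_add]; congr 1; ring
  rw [h3, ← mul_assoc]
  exact mul_lt_mul_of_pos_right h1 (Real.exp_pos _)

lemma extProb_toReal_pos {y : ℝ} (hy : 0 ≤ y) : 0 < (extProb y).toReal := by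
  rw [← extProb_fixed hy]
  exact Real.exp_pos _

lemma mul_extProb_fixed {y : ℝ} (hy : 0 ≤ y) : y * (extProb y).toReal *
    Real.exp (-(y * (extProb y).toReal)) = y * Real.exp (-y) := by
  have h := extProb_fixed hy
  set q := (extProb y).toReal
  have : Real.exp (-(y * (1 - q))) = Real.exp (-y) * Real.exp (y * q) := by
    rw [← Real.exp_add]; congr 1; ring
  rw [this] at h
  nth_rewrite 1 [← h]
  rw [mul_assoc, mul_assoc, ← Real.exp_add]
  simp

/-- The intermediate value theorem gives d < 1 with d e^(-d) = y e^(-y). Then d / y is a fixed point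
of the generating function, so it dominates the extinction probability, which is the smallest one.
-/
lemma mul_extProb_lt_one {y : ℝ} (hy : 1 < y) : y * (extProb y).toReal < 1 := by
  have hy0 : 0 < y := by linarith
  have hcont : ContinuousOn (fun t : ℝ => t * Real.exp (-t)) (Set.Icc 0 1) := by fun_prop
  have hlt := mul_exp_neg_lt le_rfl hy
  obtain ⟨d, hd, hdeq⟩ := intermediate_value_Ico (by norm_num) hcont
    (show y * Real.exp (-y) ∈ Set.Ico _ _ from ⟨by simp; positivity, hlt⟩)
  have hdeq' : d * Real.exp (-d) = y * Real.exp (-y) := hdeq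
  have hfix : Real.exp (-(y * (1 - d / y))) = d / y := by
    have h1 : y * (1 - d / y) = y - d := by field_simp
    have h2 : Real.exp (-(y - d)) = Real.exp (-y) * Real.exp d := by
      rw [← Real.exp_add]; congr 1; ring
    rw [h1, h2, eq_div_iff hy0.ne']
    have : Real.exp d * Real.exp (-d) = 1 := by rw [← Real.exp_add]; simp
    calc Real.exp (-y) * Real.exp d * y = (y * Real.exp (-y)) * Real.exp d := by ring
      _ = d * (Real.exp d * Real.exp (-d)) := by rw [← hdeq']; ring
      _ = d := by rw [this, mul_one]
  have h := extProb_le hy0.le (div_nonneg hd.1 hy0.le) hfix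
  have h' : (extProb y).toReal ≤ d / y := ENNReal.toReal_le_of_le_ofReal
    (div_nonneg hd.1 hy0.le) h
  calc y * (extProb y).toReal ≤ y * (d / y) := by gcongr
    _ = d := by field_simp
    _ < 1 := hd.2

lemma dual_eq {y : ℝ} (hy : 1 < y) : dual y = y * (extProb y).toReal := by
  have h1 := mul_extProb_lt_one hy
  have h2 := mul_extProb_fixed (zero_le_one.trans hy.le)
  have : {t | t < 1 ∧ t * Real.exp (-t) = y * Real.exp (-y)} = {y * (extProb y).toReal} := by
    ext t
    constructor
    · rintro ⟨ht1, ht2⟩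
      exact strictMonoOn_mul_exp_neg.injOn (le_of_lt ht1) h1.le (ht2.trans h2.symm)
    · rintro rfl
      exact ⟨h1, h2⟩
  rw [dual, this, csInf_singleton]

lemma extProb_le_exp {y : ℝ} (hy : 1 < y) : (extProb y).toReal ≤ Real.exp (-(y - 1)) := by
  rw [← extProb_fixed (zero_le_one.trans hy.le)]
  have := mul_extProb_lt_one hy
  exact Real.exp_le_exp.2 (by linarith)

/-- A common value q would satisfy both fixed-point equations, forcing a (1 - q) = b (1 - q)
although q < 1. -/
lemma extProb_strictAnti {a b : ℝ} (ha : 1 < a) (hab : a < b) : extProb b < extProb a := by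
  refine lt_of_le_of_ne (extProb_anti hab.le) fun heq => ?_
  have h1 := extProb_fixed (zero_le_one.trans ha.le)
  have h2 := extProb_fixed (zero_le_one.trans (ha.trans hab).le)
  have h3 := mul_extProb_lt_one ha
  have h4 := extProb_toReal_pos (zero_le_one.trans ha.le)
  rw [heq, ← h1, h1] at h2
  rw [← h1] at h2
  have h5 := Real.exp_injective h2
  have h6 : (extProb a).toReal < 1 := by nlinarith
  nlinarith

/-! ## The expected number of hanging vertices -/

/-- The expected number of hanging vertices at depth `n`. -/
def hangMean (ν : EReal) (n : ℕ) (y : ℝ) : ℝ≥0∞ := ∫⁻ g, hangCount ν n g y ∂treeLaw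

lemma measurable_hangMean (ν : EReal) (n : ℕ) : Measurable (hangMean ν n) :=
  Measurable.lintegral_prod_left (f := fun g y => hangCount ν n g y) (measurable_hangCount ν n)

lemma hangMean_zero (ν : EReal) (y : ℝ) : hangMean ν 0 y = extProb y := by
  classical
  rw [hangMean, extProb, ← lintegral_indicator_one (measurableSet_finBelow_section y)]
  refine lintegral_congr fun g => ?_
  rw [hangCount_zero]
  rfl

lemma hangCount_eq_zero {ν : EReal} {n : ℕ} {g : List ℕ → ℕ → ℝ} {y : ℝ} (h : ¬ FinBelow g y) :
    hangCount ν n g y = 0 :=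
  ENNReal.tsum_eq_zero.2 fun _ => if_neg fun h' => h h'.2.finBelow

/-- The contribution of the `i`-th child of the root, when its subtree is `g`. -/
def childCount (ν : EReal) (n : ℕ) (y : ℝ) (t : ℝ) (g : List ℕ → ℕ → ℝ) : ℝ≥0∞ :=
  open Classical in
  if t < y then hangCount ν n g y else if (t : EReal) ≤ ν then hangCount ν n g t else 0

lemma measurable_childCount (ν : EReal) (n : ℕ) (y : ℝ) :
    Measurable (Function.uncurry (childCount ν n y)) := by
  have h1 : Measurable fun q : ℝ × (List ℕ → ℕ → ℝ) => hangCount ν n q.2 y :=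
    (measurable_hangCount ν n).comp (measurable_snd.prodMk measurable_const)
  have h2 : Measurable fun q : ℝ × (List ℕ → ℕ → ℝ) => hangCount ν n q.2 q.1 :=
    (measurable_hangCount ν n).comp (measurable_snd.prodMk measurable_fst)
  have h3 : MeasurableSet {q : ℝ × (List ℕ → ℕ → ℝ) | (q.1 : EReal) ≤ ν} :=
    (measurable_coe_real_ereal.comp measurable_fst) measurableSet_Iic
  exact Measurable.ite (measurableSet_lt measurable_fst measurable_const) h1
    (Measurable.ite h3 h2 measurable_const)

/-- Finiteness of the root cluster factors over the open children. The factor of child `i` is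
dropped because, when that child is open, its count already vanishes unless its cluster is finite;
the remaining product involves only the other, independent subtrees. -/
lemma hangCount_succ_eq {ν : EReal} {n : ℕ} {f : List ℕ → ℕ → ℝ} (hf : IsBlock (f []))
    (y : ℝ) : hangCount ν (n + 1) f y = ∑' i, childCount ν n y (f [] i) (shift [i] f) *
      ∏ j ∈ (Finset.range (atomCount y (f []))).erase i,
        {g | FinBelow g y}.indicator (1 : (List ℕ → ℕ → ℝ) → ℝ≥0∞) (shift [j] f) := by
  rw [hangCount_succ]
  refine tsum_congr fun i => ?_
  rw [← childCount]
  by_cases h : FinBelow f y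
  · rw [if_pos h, Finset.prod_eq_one, mul_one]
    intro j hj
    have := (finBelow_iff hf.tendsto).1 h j
      (hf.lt_atomCount_iff.1 (Finset.mem_range.1 (Finset.mem_of_mem_erase hj)))
    rw [Set.indicator_of_mem (show shift [j] f ∈ {g | FinBelow g y} from this)]
    rfl
  · rw [if_neg h]
    rw [finBelow_iff hf.tendsto] at h
    push Not at h
    obtain ⟨j, hj, hjf⟩ := h
    symm
    by_cases hij : j = i
    · subst hij
      rw [childCount, if_pos hj, hangCount_eq_zero hjf, zero_mul]
    · have h0 : {g | FinBelow g y}.indicator (1 : (List ℕ → ℕ → ℝ) → ℝ≥0∞) (shift [j] f) = 0 :=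
        Set.indicator_of_notMem (show shift [j] f ∉ {g | FinBelow g y} from hjf) _
      rw [Finset.prod_eq_zero (Finset.mem_erase.2 ⟨hij, Finset.mem_range.2
        (hf.lt_atomCount_iff.2 hj)⟩) h0, mul_zero]

lemma lintegral_childCount (ν : EReal) (n : ℕ) (y : ℝ) (s : Finset ℕ) (i : ℕ) (hi : i ∉ s)
    (t : ℝ) : ∫⁻ f, childCount ν n y t (shift [i] f) * ∏ j ∈ s,
        {g | FinBelow g y}.indicator (1 : (List ℕ → ℕ → ℝ) → ℝ≥0∞) (shift [j] f) ∂treeLaw =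
      (open Classical in if t < y then hangMean ν n y else if (t : EReal) ≤ ν then hangMean ν n t
        else 0) * extProb y ^ s.card := by
  classical
  have hK : Measurable (childCount ν n y t) := (measurable_childCount ν n y).comp
    measurable_prodMk_left
  have hI : Measurable ({g | FinBelow g y}.indicator (1 : (List ℕ → ℕ → ℝ) → ℝ≥0∞)) :=
    measurable_one.indicator (measurableSet_finBelow_section y)
  let F : ℕ → (List ℕ → ℕ → ℝ) → ℝ≥0∞ := fun j =>
    if j = i then childCount ν n y t else {g | FinBelow g y}.indicator 1
  have hF : ∀ j, Measurable (F j) := fun j => by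
    by_cases h : j = i
    · simpa only [F, h, if_true] using hK
    · simpa only [F, h, if_false] using hI
  have hne : ∀ j ∈ s, F j = {g | FinBelow g y}.indicator 1 := fun j hj =>
    if_neg (by rintro rfl; exact hi hj)
  have h := lintegral_prod_children [] (insert i s) hF
  simp only [Finset.prod_insert hi] at h
  rw [show F i = childCount ν n y t from if_pos rfl] at h
  rw [Finset.prod_congr rfl (g := fun _ => extProb y) (fun j hj => by
    rw [hne j hj, lintegral_indicator_one (measurableSet_finBelow_section y), extProb]),
    Finset.prod_const] at h
  refine Eq.trans (lintegral_congr fun f => ?_) (h.trans ?_)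
  · congr 1
    exact Finset.prod_congr rfl fun j hj => by rw [hne j hj]
  · congr 1
    simp only [childCount]
    split_ifs <;> simp [hangMean]

/-- The intervals between consecutive atoms tile the positive half-line. -/
lemma IsBlock.tsum_lintegral {b : ℕ → ℝ} (hb : IsBlock b) (G : ℝ → ℝ≥0∞) :
    ∑' i, ∫⁻ t in Set.Ioc (prevAtom b i) (b i), G t = ∫⁻ t in Set.Ioi 0, G t := by
  have hprev : ∀ i j, i < j → b i ≤ prevAtom b j := fun i j h => by
    cases j with
    | zero => omega
    | succ j => exact hb.strictMono.monotone (Nat.lt_succ_iff.1 h)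
  rw [← lintegral_iUnion (fun i => measurableSet_Ioc)]
  · congr 2
    ext t
    simp only [Set.mem_iUnion, Set.mem_Ioc, Set.mem_Ioi]
    constructor
    · rintro ⟨i, h1, -⟩
      refine lt_of_le_of_lt ?_ h1
      cases i with
      | zero => exact le_rfl
      | succ i => exact hb.pos.le.trans (hb.strictMono.monotone (Nat.zero_le i))
    · intro ht
      have hex : ∃ n, t ≤ b n := (hb.tendsto.eventually_ge_atTop t).exists
      classical
      refine ⟨Nat.find hex, ?_, Nat.find_spec hex⟩
      rcases hk : Nat.find hex with _ | k
      · exact ht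
      · exact not_le.1 (Nat.find_min hex (m := k) (by omega))
  · intro i j hij
    rcases lt_or_gt_of_ne hij with h | h
    · exact Set.disjoint_left.2 fun t ht ht' => absurd (ht.2.trans (hprev i j h)) (not_le.2 ht'.1)
    · exact Set.disjoint_left.2 fun t ht ht' => absurd (ht'.2.trans (hprev j i h)) (not_le.2 ht.1)

/-- The levels between `l` and `ν`. -/
def levelSet (l : ℝ) (ν : EReal) : Set ℝ := {t | l < t ∧ (t : EReal) < ν}

lemma measurableSet_levelSet (l : ℝ) (ν : EReal) : MeasurableSet (levelSet l ν) :=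
  measurableSet_Ioi.inter (measurable_coe_real_ereal measurableSet_Iio)

lemma measurableSet_coe_le (ν : EReal) : MeasurableSet {t : ℝ | (t : EReal) ≤ ν} :=
  measurable_coe_real_ereal measurableSet_Iic

lemma ae_mem_levelSet_iff (l : ℝ) (ν : EReal) :
    ∀ᵐ t : ℝ, (l < t ∧ (t : EReal) ≤ ν ↔ t ∈ levelSet l ν) := by
  have : ∀ᵐ t : ℝ, t ≠ ν.toReal := by simp [ae_iff]
  filter_upwards [this] with t ht
  refine and_congr_right fun _ => ⟨fun h => lt_of_le_of_ne h fun heq => ht ?_, le_of_lt⟩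
  rw [← heq, EReal.toReal_coe]

/-- The atoms above `y` form a rate one process independent of the number of atoms below `y`, so the
two expectations factor. -/
lemma lintegral_block_pow (ν : EReal) (y : ℝ) (hy : 0 < y) (q : ℝ≥0∞) {φ : ℝ → ℝ≥0∞}
    (hφ : Measurable φ) :
    ∫⁻ b, ∑' i, (open Classical in if b i < y then 0 else if (b i : EReal) ≤ ν then φ (b i) else 0)
        * q ^ atomCount y b ∂blockLaw =
      (∫⁻ b, q ^ atomCount y b ∂blockLaw) * ∫⁻ t in levelSet y ν, φ t := by
  classical
  let G : ℝ → ℝ≥0∞ := fun t => if t < y then 0 else if (t : EReal) ≤ ν then φ t else 0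
  have hG : Measurable G := Measurable.ite measurableSet_Iio measurable_const
    (Measurable.ite (measurableSet_coe_le ν) hφ measurable_const)
  -- `c i` counts only earlier atoms, as the compensator formula requires, and agrees with
  -- `atomCount y` as soon as the i-th atom is at least `y`.
  let c : ℕ → (ℕ → ℝ) → ℕ := fun i b => ((Finset.range i).filter fun j => b j < y).card
  have hc : ∀ i, Measurable (c i) := fun i => by
    have : c i = fun b => ∑ j ∈ Finset.range i, if b j < y then 1 else 0 := by
      funext b
      exact Finset.card_filter _ _
    rw [this]
    exact Finset.measurable_sum _ fun j _ => Measurable.ite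
      (measurableSet_lt (measurable_pi_apply j) measurable_const) measurable_const measurable_const
  have hpow : Measurable fun n : ℕ => q ^ n := measurable_of_countable _
  have hceq : ∀ b, IsBlock b → ∀ i, y ≤ b i → c i b = atomCount y b := fun b hb i hi => by
    have : (Finset.range i).filter (fun j => b j < y) = Finset.range (atomCount y b) := by
      ext j
      simp only [Finset.mem_filter, Finset.mem_range, hb.lt_atomCount_iff]
      exact ⟨fun h => h.2, fun h => ⟨hb.strictMono.lt_iff_lt.1 (h.trans_le hi), h⟩⟩
    simp [c, this]
  have hΦ : ∀ i, Measurable (Function.uncurry fun (b : ℕ → ℝ) t => G t * q ^ c i b) := fun i =>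
    (hG.comp measurable_snd).mul (hpow.comp ((hc i).comp measurable_fst))
  have h1 : ∀ᵐ b ∂blockLaw, ∀ i, G (b i) * q ^ atomCount y b = G (b i) * q ^ c i b := by
    filter_upwards [ae_isBlock] with b hb i
    by_cases h : b i < y
    · simp [G, h]
    · rw [hceq b hb i (not_lt.1 h)]
  have h2 : ∀ᵐ b ∂blockLaw, ∑' i, ∫⁻ t in Set.Ioc (prevAtom b i) (b i), G t * q ^ c i b =
      q ^ atomCount y b * ∫⁻ t in levelSet y ν, φ t := by
    filter_upwards [ae_isBlock] with b hb
    have h3 : ∀ i, ∫⁻ t in Set.Ioc (prevAtom b i) (b i), G t * q ^ c i b =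
        ∫⁻ t in Set.Ioc (prevAtom b i) (b i), q ^ atomCount y b * G t := fun i => by
      refine setLIntegral_congr_fun measurableSet_Ioc fun t ht => ?_
      by_cases h : t < y
      · simp [G, h]
      · rw [hceq b hb i ((not_lt.1 h).trans ht.2), mul_comm]
    simp_rw [h3]
    rw [hb.tsum_lintegral fun t => q ^ atomCount y b * G t, lintegral_const_mul _ hG]
    congr 1
    rw [← lintegral_indicator measurableSet_Ioi, ← lintegral_indicator (measurableSet_levelSet y ν)]
    have hne : ∀ᵐ t : ℝ, t ≠ y := by simp [ae_iff]
    refine lintegral_congr_ae ?_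
    filter_upwards [hne, ae_mem_levelSet_iff y ν] with t ht hiff
    by_cases h : t ∈ levelSet y ν
    · rw [Set.indicator_of_mem h, Set.indicator_of_mem (show t ∈ Set.Ioi 0 from hy.trans h.1)]
      simp only [G]
      rw [if_neg (not_lt.2 h.1.le), if_pos h.2.le]
    · rw [Set.indicator_of_notMem h]
      by_cases hty : t < y
      · simp [Set.indicator, G, hty]
      · have : ¬ (t : EReal) ≤ ν := fun h' =>
          h (hiff.1 ⟨lt_of_le_of_ne (not_lt.1 hty) ht.symm, h'⟩)
        simp [Set.indicator, G, this]
  have h4 : ∀ i, Measurable fun b : ℕ → ℝ => G (b i) * q ^ c i b := fun i =>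
    (hG.comp (measurable_pi_apply i)).mul (hpow.comp (hc i))
  calc ∫⁻ b, ∑' i, G (b i) * q ^ atomCount y b ∂blockLaw
      = ∫⁻ b, ∑' i, G (b i) * q ^ c i b ∂blockLaw :=
        lintegral_congr_ae (by filter_upwards [h1] with b hb; exact tsum_congr hb)
    _ = ∑' i, ∫⁻ b, G (b i) * q ^ c i b ∂blockLaw := lintegral_tsum fun i => (h4 i).aemeasurable
    _ = ∑' i, ∫⁻ b, ∫⁻ t in Set.Ioc (prevAtom b i) (b i), G t * q ^ c i b ∂volume ∂blockLaw :=
        tsum_congr fun i => lintegral_block i (hΦ i) fun b b' t h => by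
          simp only [c]
          congr 3
          exact Finset.filter_congr fun j hj => by rw [h j (Finset.mem_range.1 hj)]
    _ = ∫⁻ b, ∑' i, ∫⁻ t in Set.Ioc (prevAtom b i) (b i), G t * q ^ c i b ∂volume ∂blockLaw := by
        have hprod : Measurable fun b : ℕ → ℝ => fun i : ℕ => (b, b i) := by fun_prop
        exact (lintegral_tsum fun i => ((measurable_lintegral_Ioc_prevAtom i (hΦ i)).comp
          ((measurable_pi_apply i).comp hprod)).aemeasurable).symm
    _ = _ := by
        have hp : Measurable fun b => q ^ atomCount y b := hpow.comp (measurable_atomCount y)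
        rw [lintegral_congr_ae h2, lintegral_mul_const _ hp]


/-- With N open children and extinction probability q, a light child contributes through E[N
q^(N-1)] = y q, by the fixed-point equation. The heavier children form an independent rate one
process and contribute E[q^N] = q times an integral. -/
lemma hangMean_succ (ν : EReal) (n : ℕ) {y : ℝ} (hy : 0 < y) :
    hangMean ν (n + 1) y = ENNReal.ofReal y * extProb y * hangMean ν n y +
      extProb y * ∫⁻ t in levelSet y ν, hangMean ν n t := by
  classical
  have hI : Measurable ({g | FinBelow g y}.indicator (1 : (List ℕ → ℕ → ℝ) → ℝ≥0∞)) :=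
    measurable_one.indicator (measurableSet_finBelow_section y)
  let Ψ : ℕ → (ℕ → ℝ) → (List ℕ → ℕ → ℝ) → ℝ≥0∞ := fun i b f =>
    childCount ν n y (b i) (shift [i] f) * ∏ j ∈ (Finset.range (atomCount y b)).erase i,
      {g | FinBelow g y}.indicator (1 : (List ℕ → ℕ → ℝ) → ℝ≥0∞) (shift [j] f)
  have hΨ : ∀ i, Measurable (Function.uncurry (Ψ i)) := fun i => by
    have h0 : Measurable fun p : (ℕ → ℝ) × (List ℕ → ℕ → ℝ) => (p.1 i, shift [i] p.2) :=
      ((measurable_pi_apply i).comp measurable_fst).prodMk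
        ((measurable_shift [i]).comp measurable_snd)
    have h1 := (measurable_childCount ν n y).comp h0
    have h2 : ∀ N : ℕ, Measurable fun f : List ℕ → ℕ → ℝ => ∏ j ∈ (Finset.range N).erase i,
        {g | FinBelow g y}.indicator (1 : (List ℕ → ℕ → ℝ) → ℝ≥0∞) (shift [j] f) := fun N =>
      Finset.measurable_prod _ fun j _ => hI.comp (measurable_shift [j])
    exact h1.mul (measurable_prod_count h2 y)
  have hdep : ∀ i b f b', Ψ i b (Function.update f [] b') = Ψ i b f := fun i b f b' => by
    simp only [Ψ, shift_child_update]
  let m : ℝ → ℝ≥0∞ := fun t =>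
    if t < y then 0 else if (t : EReal) ≤ ν then hangMean ν n t else 0
  have hfib : ∀ b, IsBlock b → ∑' i, ∫⁻ f, Ψ i b f ∂treeLaw =
      hangMean ν n y * ((atomCount y b : ℝ≥0∞) * extProb y ^ (atomCount y b - 1)) +
        ∑' i, m (b i) * extProb y ^ atomCount y b := fun b hb => by
    have h1 : ∀ i, ∫⁻ f, Ψ i b f ∂treeLaw =
        (if i ∈ Finset.range (atomCount y b) then
          hangMean ν n y * extProb y ^ (atomCount y b - 1) else 0) +
        m (b i) * extProb y ^ atomCount y b := fun i => by
      simp only [Ψ]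
      rw [lintegral_childCount ν n y _ i (Finset.notMem_erase _ _)]
      by_cases h : b i < y
      · have h' : i ∈ Finset.range (atomCount y b) :=
          Finset.mem_range.2 (hb.lt_atomCount_iff.2 h)
        simp only [m]
        rw [if_pos h, if_pos h', if_pos h, zero_mul, add_zero, Finset.card_erase_of_mem h',
          Finset.card_range]
      · have h' : i ∉ Finset.range (atomCount y b) := fun h' =>
          h (hb.lt_atomCount_iff.1 (Finset.mem_range.1 h'))
        simp only [m]
        rw [if_neg h, if_neg h', if_neg h, zero_add, Finset.erase_eq_of_notMem h',
          Finset.card_range]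
    simp_rw [h1]
    rw [ENNReal.tsum_add, tsum_eq_sum (s := Finset.range (atomCount y b)) fun i hi => if_neg hi,
      Finset.sum_congr rfl fun i hi => if_pos hi, Finset.sum_const, Finset.card_range,
      nsmul_eq_mul]
    ring
  have hmeas : ∀ i, Measurable fun f => Ψ i (f []) f := fun i => by
    have h0 : Measurable fun f : List ℕ → ℕ → ℝ => (f [], f) := by fun_prop
    exact (hΨ i).comp h0
  have hpow : Measurable fun b => extProb y ^ atomCount y b :=
    (measurable_of_countable fun k : ℕ => extProb y ^ k).comp (measurable_atomCount y)
  have hpow' : Measurable fun b => (atomCount y b : ℝ≥0∞) * extProb y ^ (atomCount y b - 1) :=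
    (measurable_of_countable fun k : ℕ => (k : ℝ≥0∞) * extProb y ^ (k - 1)).comp
      (measurable_atomCount y)
  calc hangMean ν (n + 1) y = ∫⁻ f, ∑' i, Ψ i (f []) f ∂treeLaw := by
        refine lintegral_congr_ae ?_
        filter_upwards [ae_isBlock_tree] with f hf
        exact hangCount_succ_eq (hf []) y
    _ = ∑' i, ∫⁻ f, Ψ i (f []) f ∂treeLaw := lintegral_tsum fun i => (hmeas i).aemeasurable
    _ = ∑' i, ∫⁻ b, ∫⁻ f, Ψ i b f ∂treeLaw ∂blockLaw :=
        tsum_congr fun i => lintegral_vertex_swap [] (hΨ i) (hdep i)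
    _ = ∫⁻ b, ∑' i, ∫⁻ f, Ψ i b f ∂treeLaw ∂blockLaw :=
        (lintegral_tsum fun i => (Measurable.lintegral_prod_right (hΨ i)).aemeasurable).symm
    _ = ∫⁻ b, (hangMean ν n y * ((atomCount y b : ℝ≥0∞) * extProb y ^ (atomCount y b - 1)) +
        ∑' i, m (b i) * extProb y ^ atomCount y b) ∂blockLaw := by
        refine lintegral_congr_ae ?_
        filter_upwards [ae_isBlock] with b hb
        exact hfib b hb
    _ = hangMean ν n y * (ENNReal.ofReal y * extProb y) +
        extProb y * ∫⁻ t in levelSet y ν, hangMean ν n t := by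
        rw [lintegral_add_left (hpow'.const_mul _), lintegral_const_mul _ hpow']
        congr 1
        · have h := lintegral_mul_pow_atomCount hy.le (ENNReal.toReal_nonneg (a := extProb y))
          rw [ENNReal.ofReal_toReal (extProb_ne_top y), extProb_fixed hy.le,
            ENNReal.ofReal_mul hy.le, ENNReal.ofReal_toReal (extProb_ne_top y)] at h
          rw [h]
        · rw [lintegral_block_pow ν y hy (extProb y) (measurable_hangMean ν n),
            ← extProb_eq_lintegral]
    _ = _ := by ring

/-! ## The iterated integrals -/

/-- The rate at which new levels appear. -/
def hangRate (y : ℝ) : ℝ≥0∞ := extProb y / (1 - ENNReal.ofReal y * extProb y)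

lemma measurable_extProb : Measurable extProb := extProb_anti.measurable

lemma measurable_hangRate : Measurable hangRate :=
  measurable_extProb.div (measurable_const.sub (ENNReal.measurable_ofReal.mul measurable_extProb))

lemma hangRate_eq {y : ℝ} (hy : 1 < y) :
    ENNReal.ofReal ((1 - theta y) / (1 - dual y)) = hangRate y := by
  have h0 := zero_le_one.trans hy.le
  have h1 := mul_extProb_lt_one hy
  rw [theta_eq h0, dual_eq hy, sub_sub_cancel, ENNReal.ofReal_div_of_pos (by linarith), hangRate,
    ENNReal.ofReal_toReal (extProb_ne_top y), ENNReal.ofReal_sub _ (by positivity),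
    ENNReal.ofReal_mul h0, ENNReal.ofReal_toReal (extProb_ne_top y), ENNReal.ofReal_one]

lemma mul_extProb_lt_one' {y : ℝ} (hy : 1 < y) : ENNReal.ofReal y * extProb y < 1 := by
  rw [← ENNReal.ofReal_toReal (extProb_ne_top y), ← ENNReal.ofReal_mul (by linarith),
    ENNReal.ofReal_lt_one]
  exact mul_extProb_lt_one hy

lemma hangRate_fixed {y : ℝ} (hy : 1 < y) :
    hangRate y = extProb y + ENNReal.ofReal y * extProb y * hangRate y := by
  have h := mul_extProb_lt_one' hy
  set r := ENNReal.ofReal y * extProb y with hr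
  have h1 : (1 - r) ≠ 0 := (tsub_pos_of_lt h).ne'
  have h2 : (1 - r) ≠ ∞ := ENNReal.sub_ne_top ENNReal.one_ne_top
  have h3 : (1 - r) * hangRate y = extProb y := ENNReal.mul_div_cancel h1 h2
  calc hangRate y = (1 - r + r) * hangRate y := by rw [tsub_add_cancel_of_le h.le, one_mul]
    _ = _ := by rw [add_mul, h3]


/-- The domain of integration of the iterated integrals. -/
def chainSet (k : ℕ) (l : ℝ) (ν : EReal) : Set (Fin k → ℝ) :=
  {x | StrictMono x ∧ ∀ i, l < x i ∧ (x i : EReal) < ν}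

lemma measurableSet_chainSet (k : ℕ) (l : ℝ) (ν : EReal) : MeasurableSet (chainSet k l ν) := by
  have h : chainSet k l ν = (⋂ i, ⋂ j, ⋂ _ : i < j, {x | x i < x j}) ∩
      ⋂ i, (fun x => x i) ⁻¹' levelSet l ν := by
    ext x
    simp [chainSet, StrictMono, levelSet]
  rw [h]
  exact (MeasurableSet.iInter fun i => MeasurableSet.iInter fun j => MeasurableSet.iInter fun _ =>
    measurableSet_lt (measurable_pi_apply i) (measurable_pi_apply j)).inter
    (MeasurableSet.iInter fun i => (measurable_pi_apply i) (measurableSet_levelSet l ν))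

lemma nInt_eq (k : ℕ) {l : ℝ} (hl : 1 ≤ l) (ν : EReal) : nInt k l ν =
    ∫⁻ x, (chainSet k l ν).indicator (fun x => ∏ i, hangRate (x i)) x := by
  rw [lintegral_indicator (measurableSet_chainSet k l ν)]
  exact setLIntegral_congr_fun (measurableSet_chainSet k l ν) fun x hx =>
    Finset.prod_congr rfl fun i _ => hangRate_eq (hl.trans_lt (hx.2 i).1)

lemma nInt_zero (l : ℝ) (ν : EReal) : nInt 0 l ν = 1 := by
  have h : {x : Fin 0 → ℝ | StrictMono x ∧ ∀ i, l < x i ∧ (x i : EReal) < ν} = Set.univ :=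
    Set.eq_univ_of_forall fun x => ⟨fun i => i.elim0, fun i => i.elim0⟩
  rw [nInt, h]
  simp [volume_pi]

lemma nInt_antitone (k : ℕ) (ν : EReal) : Antitone fun l => nInt k l ν := fun _ _ h =>
  lintegral_mono_set fun _ hx => ⟨hx.1, fun i => ⟨h.trans_lt (hx.2 i).1, (hx.2 i).2⟩⟩

/-- The smallest variable is integrated last; it becomes the new lower limit for the others. -/
lemma nInt_succ (k : ℕ) {l : ℝ} (hl : 1 ≤ l) (ν : EReal) :
    nInt (k + 1) l ν = ∫⁻ t in levelSet l ν, hangRate t * nInt k t ν := by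
  have hprod : ∀ m, Measurable fun x : Fin m → ℝ => ∏ i, hangRate (x i) := fun m =>
    Finset.measurable_prod _ fun i _ => measurable_hangRate.comp (measurable_pi_apply i)
  have hG : ∀ m l, Measurable ((chainSet m l ν).indicator fun x => ∏ i, hangRate (x i)) :=
    fun m l => (hprod m).indicator (measurableSet_chainSet m l ν)
  have hcons : ∀ (t : ℝ) (z : Fin k → ℝ), (chainSet (k + 1) l ν).indicator
      (fun x => ∏ i, hangRate (x i)) (Fin.cons t z : Fin (k + 1) → ℝ) =
      (levelSet l ν).indicator hangRate t *
        (chainSet k t ν).indicator (fun x => ∏ i, hangRate (x i)) z := fun t z => by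
    have hiff : (Fin.cons t z : Fin (k + 1) → ℝ) ∈ chainSet (k + 1) l ν ↔
        t ∈ levelSet l ν ∧ z ∈ chainSet k t ν := by
      simp only [chainSet, levelSet, Set.mem_ofPred_eq, Fin.strictMono_cons, Fin.forall_fin_succ,
        Fin.cons_zero, Fin.cons_succ]
      constructor
      · rintro ⟨⟨h1, h2⟩, h3, h4⟩
        exact ⟨h3, h2, fun i => ⟨h1 i, (h4 i).2⟩⟩
      · rintro ⟨h3, h2, h4⟩
        exact ⟨⟨fun i => (h4 i).1, h2⟩, h3, fun i => ⟨h3.1.trans (h4 i).1, (h4 i).2⟩⟩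
    by_cases h1 : t ∈ levelSet l ν
    · by_cases h2 : z ∈ chainSet k t ν
      · rw [Set.indicator_of_mem (hiff.2 ⟨h1, h2⟩), Set.indicator_of_mem h1,
          Set.indicator_of_mem h2, Fin.prod_univ_succ]
        simp
      · rw [Set.indicator_of_notMem fun h => h2 (hiff.1 h).2, Set.indicator_of_notMem h2, mul_zero]
    · rw [Set.indicator_of_notMem fun h => h1 (hiff.1 h).1, Set.indicator_of_notMem h1, zero_mul]
  have he := (volume_preserving_piFinSuccAbove (fun _ : Fin (k + 1) => ℝ) 0).symm
  rw [nInt_eq _ hl, ← he.lintegral_comp (hG (k + 1) l)]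
  have hms := (hG (k + 1) l).comp he.measurable
  refine (lintegral_prod _ hms.aemeasurable).trans ?_
  rw [← lintegral_indicator (measurableSet_levelSet l ν)]
  refine lintegral_congr fun t => ?_
  have hsymm : ∀ z : Fin k → ℝ, (MeasurableEquiv.piFinSuccAbove (fun _ : Fin (k + 1) => ℝ) 0).symm
      (t, z) = (Fin.cons t z : Fin (k + 1) → ℝ) := fun z => Fin.insertNth_zero' t z
  refine (lintegral_congr fun z => (congrArg _ (hsymm z)).trans (hcons t z)).trans ?_
  refine (lintegral_const_mul _ (hG k t)).trans ?_
  by_cases h1 : t ∈ levelSet l ν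
  · rw [Set.indicator_of_mem h1, Set.indicator_of_mem h1, nInt_eq k (hl.trans h1.1.le)]
  · rw [Set.indicator_of_notMem h1, Set.indicator_of_notMem h1, zero_mul]

/-- The sum of the iterated integrals. -/
def chainSum (l : ℝ) (ν : EReal) : ℝ≥0∞ := ∑' k, nInt k l ν

lemma chainSum_antitone (ν : EReal) : Antitone fun l => chainSum l ν := fun _ _ h =>
  ENNReal.tsum_le_tsum fun k => nInt_antitone k ν h

lemma measurable_nInt (k : ℕ) (ν : EReal) : Measurable fun l => nInt k l ν :=
  (nInt_antitone k ν).measurable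

lemma measurable_chainSum (ν : EReal) : Measurable fun l => chainSum l ν :=
  (chainSum_antitone ν).measurable

lemma sum_nInt_succ (m : ℕ) {l : ℝ} (hl : 1 ≤ l) (ν : EReal) :
    ∑ k ∈ Finset.range (m + 1), nInt k l ν =
      1 + ∫⁻ t in levelSet l ν, hangRate t * ∑ k ∈ Finset.range m, nInt k t ν := by
  rw [Finset.sum_range_succ', nInt_zero, add_comm]
  congr 1
  simp_rw [Finset.mul_sum]
  rw [lintegral_finsetSum (f := fun k t => hangRate t * nInt k t ν) _
    fun k _ => measurable_hangRate.mul (measurable_nInt k ν)]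
  exact Finset.sum_congr rfl fun k _ => nInt_succ k hl ν

/-- The Volterra equation solved by the sum, which matches the equation for the mean hanging size
divided by `hangRate`. -/
lemma chainSum_eq {l : ℝ} (hl : 1 ≤ l) (ν : EReal) :
    chainSum l ν = 1 + ∫⁻ t in levelSet l ν, hangRate t * chainSum t ν := by
  rw [chainSum, tsum_eq_zero_add' ENNReal.summable, nInt_zero]
  congr 1
  simp_rw [chainSum, ← ENNReal.tsum_mul_left]
  rw [lintegral_tsum (f := fun k t => hangRate t * nInt k t ν)
    fun k => (measurable_hangRate.mul (measurable_nInt k ν)).aemeasurable]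
  exact tsum_congr fun k => nInt_succ k hl ν

/-- The expected size of a hanging cluster. -/
lemma tsum_hangMean (ν : EReal) {y : ℝ} (hy : 1 < y) :
    ∑' n, hangMean ν n y = hangRate y * chainSum y ν := by
  have hmem : ∀ {y : ℝ}, 1 < y → ∀ t ∈ levelSet y ν, (1 : ℝ) < t := fun h t ht => h.trans ht.1
  apply le_antisymm
  -- Both inequalities come from truncated sums, so neither finiteness nor uniqueness of solutions
  -- is needed. Here the sum over depth is truncated, and `hangRate * chainSum` reproduces itself in
  -- the recursion.
  · have key : ∀ m, ∀ y : ℝ, 1 < y →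
        ∑ n ∈ Finset.range m, hangMean ν n y ≤ hangRate y * chainSum y ν := by
      intro m
      induction m with
      | zero => intro y _; simp
      | succ m ih =>
        intro y hy
        have hy0 := zero_lt_one.trans hy
        rw [Finset.sum_range_succ', hangMean_zero]
        simp_rw [hangMean_succ ν _ hy0]
        rw [Finset.sum_add_distrib, ← Finset.mul_sum, ← Finset.mul_sum,
          ← lintegral_finsetSum _ fun n _ => measurable_hangMean ν n]
        have h1 : ∫⁻ t in levelSet y ν, ∑ n ∈ Finset.range m, hangMean ν n t ≤
            ∫⁻ t in levelSet y ν, hangRate t * chainSum t ν :=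
          setLIntegral_mono' (measurableSet_levelSet y ν) fun t ht => ih t (hmem hy t ht)
        calc _ ≤ ENNReal.ofReal y * extProb y * (hangRate y * chainSum y ν) +
              (extProb y * ∫⁻ t in levelSet y ν, hangRate t * chainSum t ν) + extProb y := by
              gcongr
              exact ih y hy
          _ = extProb y * (1 + ∫⁻ t in levelSet y ν, hangRate t * chainSum t ν) +
              ENNReal.ofReal y * extProb y * hangRate y * chainSum y ν := by ring
          _ = (extProb y + ENNReal.ofReal y * extProb y * hangRate y) * chainSum y ν := by
              rw [← chainSum_eq hy.le, add_mul]
          _ = _ := by rw [← hangRate_fixed hy]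
    exact ENNReal.tsum_le_of_sum_range_le fun m => key m y hy
  · have hrec : ∀ y : ℝ, 1 < y → hangRate y * (1 + ∫⁻ t in levelSet y ν, ∑' n, hangMean ν n t) ≤
        ∑' n, hangMean ν n y := by
      intro y hy
      have hy0 := zero_lt_one.trans hy
      -- If the total mean is infinite the bound is trivial; otherwise its multiple by y q can be
      -- subtracted to solve the linear equation.
      by_cases htop : ∑' n, hangMean ν n y = ∞
      · rw [htop]; exact le_top
      have h := tsum_eq_zero_add' (f := fun n => hangMean ν n y) ENNReal.summable
      rw [hangMean_zero] at h
      simp_rw [hangMean_succ ν _ hy0] at h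
      rw [ENNReal.tsum_add, ENNReal.tsum_mul_left, ENNReal.tsum_mul_left,
        ← lintegral_tsum fun n => (measurable_hangMean ν n).aemeasurable] at h
      set H := ∑' n, hangMean ν n y
      set I := ∫⁻ t in levelSet y ν, ∑' n, hangMean ν n t
      have hr := mul_extProb_lt_one' hy
      set r := ENNReal.ofReal y * extProb y
      have h1 : (1 - r) ≠ 0 := (tsub_pos_of_lt hr).ne'
      have h2 : (1 - r) ≠ ∞ := ENNReal.sub_ne_top ENNReal.one_ne_top
      have h3 : r * H ≠ ∞ := ENNReal.mul_ne_top hr.ne_top htop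
      have h4 : extProb y * (1 + I) = H * (1 - r) := by
        rw [ENNReal.mul_sub fun _ _ => htop, mul_one, mul_comm H r]
        refine ENNReal.eq_sub_of_add_eq h3 ?_
        rw [mul_add, mul_one]
        conv_rhs => rw [h]
        ring
      have : hangRate y * (1 + I) = H := by
        rw [hangRate, ENNReal.mul_div_right_comm.symm, h4]
        exact ENNReal.mul_div_cancel_right h1 h2
      exact this.le
    have key : ∀ m, ∀ y : ℝ, 1 < y →
        hangRate y * ∑ k ∈ Finset.range m, nInt k y ν ≤ ∑' n, hangMean ν n y := by
      intro m
      induction m with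
      | zero => intro y _; simp
      | succ m ih =>
        intro y hy
        refine le_trans ?_ (hrec y hy)
        rw [sum_nInt_succ m hy.le]
        gcongr hangRate y * (1 + ?_)
        exact setLIntegral_mono' (measurableSet_levelSet y ν) fun t ht => ih t (hmem hy t ht)
    rw [chainSum, ENNReal.tsum_eq_iSup_nat, ENNReal.mul_iSup]
    exact iSup_le fun m => key m y hy

lemma lintegral_hangTotal (ν : EReal) {y : ℝ} (hy : 1 < y) :
    ∫⁻ g, hangTotal ν g y ∂treeLaw = hangRate y * chainSum y ν := by
  rw [← tsum_hangMean ν hy]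
  simp_rw [hangTotal_eq_tsum]
  have h : ∀ n, Measurable fun g : List ℕ → ℕ → ℝ => hangCount ν n g y := fun n =>
    (measurable_hangCount ν n).comp measurable_prodMk_right
  exact lintegral_tsum fun n => (h n).aemeasurable

/-! ## Finiteness and continuity of the sum -/

/-- The numerator q is at most e^(-(y-1)). Thus y q ≤ y e^(-(y-1)) ≤ l e^(-(l-1)) < 1, which bounds
the denominator away from zero uniformly on [l, ∞). -/
lemma hangRate_le {l y : ℝ} (hl : 1 < l) (hly : l ≤ y) :
    hangRate y ≤ ENNReal.ofReal ((1 - l * Real.exp (-(l - 1)))⁻¹ * Real.exp (-(y - 1))) := by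
  have hy := hl.trans_le hly
  have h1 : l * Real.exp (-(l - 1)) < 1 := by
    have := Real.add_one_lt_exp (sub_pos.2 hl).ne'
    rw [Real.exp_neg, ← div_eq_mul_inv, div_lt_one (Real.exp_pos _)]
    linarith
  have h2 : y * Real.exp (-(y - 1)) ≤ l * Real.exp (-(l - 1)) := by
    have hm : y * Real.exp (-y) ≤ l * Real.exp (-l) := by
      rcases hly.eq_or_lt with rfl | h
      · exact le_rfl
      · exact (mul_exp_neg_lt hl.le h).le
    have he : ∀ t : ℝ, t * Real.exp (-(t - 1)) = t * Real.exp (-t) * Real.exp 1 := fun t => by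
      rw [mul_assoc, ← Real.exp_add]; congr 2; ring
    rw [he, he]
    gcongr
  have h3 := extProb_le_exp hy
  have h4 : y * (extProb y).toReal ≤ l * Real.exp (-(l - 1)) :=
    (mul_le_mul_of_nonneg_left h3 (by linarith)).trans h2
  rw [← hangRate_eq hy, theta_eq (by linarith), dual_eq hy, sub_sub_cancel]
  apply ENNReal.ofReal_le_ofReal
  rw [div_eq_inv_mul]
  have h5 : 0 < 1 - l * Real.exp (-(l - 1)) := by linarith
  gcongr

lemma lintegral_exp_exp {C : ℝ} (hC : 0 ≤ C) (y : ℝ) :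
    ∫⁻ t in Set.Ioi y, ENNReal.ofReal (C * Real.exp (-(t - 1)) *
      Real.exp (C * Real.exp (-(t - 1)))) =
      ENNReal.ofReal (Real.exp (C * Real.exp (-(y - 1))) - 1) := by
  have hd : ∀ t ∈ Set.Ici y, HasDerivAt (fun t : ℝ => -Real.exp (C * Real.exp (-(t - 1))))
      (C * Real.exp (-(t - 1)) * Real.exp (C * Real.exp (-(t - 1)))) t := fun t _ => by
    have h := (((((hasDerivAt_id t).sub_const 1).neg.exp).const_mul C).exp).neg
    refine h.congr_deriv ?_
    simp only [Pi.neg_apply, id]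
    ring
  have hpos : ∀ t ∈ Set.Ioi y, 0 ≤ C * Real.exp (-(t - 1)) *
      Real.exp (C * Real.exp (-(t - 1))) := fun t _ => by positivity
  have hlim : Tendsto (fun t : ℝ => -Real.exp (C * Real.exp (-(t - 1)))) atTop (𝓝 (-1)) := by
    have h1 : Tendsto (fun t : ℝ => Real.exp (-(t - 1))) atTop (𝓝 0) :=
      Real.tendsto_exp_neg_atTop_nhds_zero.comp (tendsto_atTop_add_const_right _ (-1) tendsto_id)
    have h2 := (Real.continuous_exp.tendsto (C * 0)).comp (h1.const_mul C)
    simpa using h2.neg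
  have hint := integrableOn_Ioi_deriv_of_nonneg' hd hpos hlim
  rw [← ofReal_integral_eq_lintegral_ofReal hint ((ae_restrict_iff' measurableSet_Ioi).2
    (ae_of_all _ hpos)), integral_Ioi_of_hasDerivAt_of_nonneg' hd hpos hlim]
  congr 1
  ring

/-- With the rate bounded by C e^(-(t-1)), the function exp(C e^(-(y-1))) is a supersolution of the
Volterra equation: its integral against this bound over (y, ∞) is itself minus one. It therefore
dominates all partial sums. -/
lemma chainSum_ne_top {l : ℝ} (hl : 1 < l) (ν : EReal) : chainSum l ν ≠ ∞ := by
  have hC : 0 ≤ (1 - l * Real.exp (-(l - 1)))⁻¹ := by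
    have := Real.add_one_lt_exp (sub_pos.2 hl).ne'
    rw [inv_nonneg, Real.exp_neg, ← div_eq_mul_inv, sub_nonneg, div_le_one (Real.exp_pos _)]
    linarith
  set C := (1 - l * Real.exp (-(l - 1)))⁻¹ with hCdef
  have key : ∀ m, ∀ y, l ≤ y → ∑ k ∈ Finset.range m, nInt k y ν ≤
      ENNReal.ofReal (Real.exp (C * Real.exp (-(y - 1)))) := by
    intro m
    induction m with
    | zero => intro y _; simp
    | succ m ih =>
      intro y hy
      rw [sum_nInt_succ m (hl.le.trans hy)]
      have h1 : ∫⁻ t in levelSet y ν, hangRate t * ∑ k ∈ Finset.range m, nInt k t ν ≤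
          ∫⁻ t in levelSet y ν, ENNReal.ofReal (C * Real.exp (-(t - 1)) *
            Real.exp (C * Real.exp (-(t - 1)))) := by
        refine setLIntegral_mono' (measurableSet_levelSet y ν) fun t ht => ?_
        have ht' : l ≤ t := hy.trans ht.1.le
        rw [ENNReal.ofReal_mul (by positivity)]
        exact mul_le_mul' (hangRate_le hl ht') (ih t ht')
      have h2 := lintegral_exp_exp hC y
      have h3 : (1 : ℝ) ≤ Real.exp (C * Real.exp (-(y - 1))) := Real.one_le_exp (by positivity)
      calc _ ≤ 1 + ENNReal.ofReal (Real.exp (C * Real.exp (-(y - 1))) - 1) := by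
            rw [← h2]
            gcongr 1 + ?_
            exact h1.trans (lintegral_mono_set fun t ht => ht.1)
        _ = _ := by
            rw [← ENNReal.ofReal_one, ← ENNReal.ofReal_add zero_le_one (by linarith)]
            congr 1
            ring
  exact ne_top_of_le_ne_top ENNReal.ofReal_ne_top
    (ENNReal.tsum_le_of_sum_range_le fun m => key m l le_rfl)

/-- By the Volterra equation the increment is at most the integral of `hangRate * chainSum` over (a,
b], and both factors are bounded on [l₀, ∞). -/
lemma exists_chainSum_le {l₀ : ℝ} (h₀ : 1 < l₀) (ν : EReal) : ∃ K : ℝ≥0∞, K ≠ ∞ ∧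
    ∀ a b, l₀ ≤ a → a ≤ b → chainSum a ν ≤ chainSum b ν + K * ENNReal.ofReal (b - a) := by
  refine ⟨ENNReal.ofReal ((1 - l₀ * Real.exp (-(l₀ - 1)))⁻¹ * Real.exp (-(l₀ - 1))) *
    chainSum l₀ ν, ENNReal.mul_ne_top ENNReal.ofReal_ne_top (chainSum_ne_top h₀ ν),
    fun a b ha hab => ?_⟩
  have h1 : ∫⁻ t in Set.Ioc a b, hangRate t * chainSum t ν ≤
      ENNReal.ofReal ((1 - l₀ * Real.exp (-(l₀ - 1)))⁻¹ * Real.exp (-(l₀ - 1))) *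
        chainSum l₀ ν * ENNReal.ofReal (b - a) := by
    rw [← Real.volume_Ioc, ← setLIntegral_const]
    refine setLIntegral_mono' measurableSet_Ioc fun t ht => ?_
    have ht' : l₀ ≤ t := ha.trans ht.1.le
    refine mul_le_mul' ((hangRate_le h₀ ht').trans (ENNReal.ofReal_le_ofReal ?_))
      (chainSum_antitone ν ht')
    have hC : 0 ≤ (1 - l₀ * Real.exp (-(l₀ - 1)))⁻¹ := by
      have := Real.add_one_lt_exp (sub_pos.2 h₀).ne'
      rw [inv_nonneg, Real.exp_neg, ← div_eq_mul_inv, sub_nonneg, div_le_one (Real.exp_pos _)]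
      linarith
    gcongr
  have hsub : levelSet a ν ⊆ levelSet b ν ∪ Set.Ioc a b := fun t ht => by
    rcases lt_or_ge b t with h | h
    · exact Or.inl ⟨h, ht.2⟩
    · exact Or.inr ⟨ht.1, h⟩
  calc chainSum a ν = 1 + ∫⁻ t in levelSet a ν, hangRate t * chainSum t ν :=
        chainSum_eq (h₀.le.trans ha) ν
    _ ≤ 1 + ((∫⁻ t in levelSet b ν, hangRate t * chainSum t ν) +
          ∫⁻ t in Set.Ioc a b, hangRate t * chainSum t ν) := by
        gcongr 1 + ?_
        exact (lintegral_mono_set hsub).trans (lintegral_union_le _ _ _)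
    _ = chainSum b ν + ∫⁻ t in Set.Ioc a b, hangRate t * chainSum t ν := by
        rw [← add_assoc, ← chainSum_eq (h₀.le.trans (ha.trans hab))]
    _ ≤ _ := by gcongr


/-! ## Disintegration with respect to the level of a vertex -/

/-- Edges of weight less than `y` join `u` to infinitely many vertices, without using its `i`-th
child. -/
def SideInf (f : List ℕ → ℕ → ℝ) (y : ℝ) (i : ℕ) (u : List ℕ) : Prop :=
  UpInf f y u ∨ ∃ j, j ≠ i ∧ f u j < y ∧ ¬ FinBelow (shift (j :: u) f) y

/-- A description of the vertices of `T` that does not refer to the subtree of the vertex. -/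
def InvasionSide (f : List ℕ → ℕ → ℝ) : List ℕ → Prop
  | [] => True
  | i :: u => InvasionSide f u ∧ ¬ SideInf f (f u i) i u

/-- At the level `f u i` the child `i` is itself closed, so excluding it changes nothing. The gain
is a condition that ignores the subtree of `v`. -/
lemma invasionSide_iff {f : List ℕ → ℕ → ℝ} (hf : IsRegular f) (v : List ℕ) :
    InvasionSide f v ↔ InvasionMem f v := by
  induction v with
  | nil => rfl
  | cons i u ih =>
    refine and_congr ih (not_congr ?_)
    rw [clusterInf_iff (hf.tendsto u), SideInf]
    refine or_congr_right (exists_congr fun j => ⟨fun h => h.2, fun h => ⟨?_, h⟩⟩)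
    rintro rfl
    exact lt_irrefl _ h.1

lemma sideInf_graft (f g : List ℕ → ℕ → ℝ) (y : ℝ) (i : ℕ) (u w : List ℕ) (hw : i :: u <:+ w) :
    SideInf (graft w f g) y i u ↔ SideInf f y i u := by
  have hne : ¬ w <:+ u := fun h => not_cons_suffix_self i u (hw.trans h)
  rw [SideInf, SideInf, upInf_graft f g y u w ((List.suffix_cons i u).trans hw),
    graft_of_not_suffix hne]
  refine or_congr_right (exists_congr fun j => and_congr_right fun hj => ?_)
  rw [shift_graft_of_not_suffix (fun h => not_cons_suffix_cons hj u (hw.trans h)) fun h => ?_]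
  rcases List.suffix_or_suffix_of_suffix h hw with h' | h'
  · exact not_cons_suffix_cons hj.symm u h'
  · exact not_cons_suffix_cons hj u h'

lemma sideInf_update (f : List ℕ → ℕ → ℝ) (y : ℝ) (i : ℕ) (u w : List ℕ) (b : ℕ → ℝ)
    (hw : i :: u <:+ w) : SideInf (Function.update f w b) y i u ↔ SideInf f y i u := by
  have hne : u ≠ w := by
    rintro rfl
    exact not_cons_suffix_self i u hw
  rw [SideInf, SideInf, upInf_update f y u b w ((List.suffix_cons i u).trans hw),
    Function.update_of_ne hne]
  refine or_congr_right (exists_congr fun j => and_congr_right fun hj => ?_)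
  rw [shift_update_of_not_suffix fun h => ?_]
  rcases List.suffix_or_suffix_of_suffix h hw with h' | h'
  · exact not_cons_suffix_cons hj.symm u h'
  · exact not_cons_suffix_cons hj u h'

lemma invasionSide_graft (f g : List ℕ → ℕ → ℝ) (v w : List ℕ) (hw : v <:+ w) :
    InvasionSide (graft w f g) v ↔ InvasionSide f v := by
  induction v with
  | nil => rfl
  | cons i u ih =>
    have hne : ¬ w <:+ u := fun h => not_cons_suffix_self i u (hw.trans h)
    rw [InvasionSide, InvasionSide, ih ((List.suffix_cons i u).trans hw),
      graft_of_not_suffix hne, sideInf_graft f g _ i u w hw]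

lemma invasionSide_update (f : List ℕ → ℕ → ℝ) (v w : List ℕ) (b : ℕ → ℝ) (hw : v <:+ w) :
    InvasionSide (Function.update f w b) v ↔ InvasionSide f v := by
  induction v with
  | nil => rfl
  | cons i u ih =>
    have hne : u ≠ w := by
      rintro rfl
      exact not_cons_suffix_self i u hw
    rw [InvasionSide, InvasionSide, ih ((List.suffix_cons i u).trans hw),
      Function.update_of_ne hne, sideInf_update f _ i u w b hw]

lemma measurableSet_sideInf (i : ℕ) (u : List ℕ) :
    MeasurableSet {p : (List ℕ → ℕ → ℝ) × ℝ | SideInf p.1 p.2 i u} := by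
  refine (measurableSet_upInf u).union ?_
  change MeasurableSet {p : (List ℕ → ℕ → ℝ) × ℝ | ∃ j, j ≠ i ∧ p.1 u j < p.2 ∧
    ¬ FinBelow (shift (j :: u) p.1) p.2}
  rw [Set.ofPred_exists]
  exact MeasurableSet.iUnion fun j => (MeasurableSet.const _).inter
    ((measurableSet_weight_lt u j).inter
      (measurable_shift_prod (j :: u) measurableSet_finBelow).compl)

lemma measurableSet_invasionSide (v : List ℕ) :
    MeasurableSet {f : List ℕ → ℕ → ℝ | InvasionSide f v} := by
  induction v with
  | nil => exact MeasurableSet.const True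
  | cons i u ih =>
    have h : Measurable fun f : List ℕ → ℕ → ℝ => (f, f u i) := by fun_prop
    exact ih.inter (h (measurableSet_sideInf i u)).compl

/-- The level of `v` if only its children in `s` are used and `b` contains their weights. -/
def blockLevel (v : List ℕ) (s : Set ℕ) (b : ℕ → ℝ) (f : List ℕ → ℕ → ℝ) : EReal :=
  thr fun y => UpInf f y v ∨ ∃ j ∈ s, b j < y ∧ ¬ FinBelow (shift (j :: v) f) y

lemma level_eq_blockLevel {f : List ℕ → ℕ → ℝ} {v : List ℕ} (hf : Tendsto (f v) atTop atTop) :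
    level f v = blockLevel v Set.univ (f v) f := by
  simp only [level, blockLevel, clusterInf_iff hf, Set.mem_univ, true_and]

lemma measurable_blockLevel (v : List ℕ) (s : Set ℕ) :
    Measurable (Function.uncurry (blockLevel v s)) := by
  refine measurable_thr (A := fun (p : (ℕ → ℝ) × (List ℕ → ℕ → ℝ)) y => UpInf p.2 y v ∨
    ∃ j ∈ s, p.1 j < y ∧ ¬ FinBelow (shift (j :: v) p.2) y) ?_ fun y => ?_
  · rintro p y z h (h' | ⟨j, hj, h1, h2⟩)
    · exact Or.inl (h'.mono h)
    · exact Or.inr ⟨j, hj, h1.trans_le h, fun h3 => h2 (h3.anti h)⟩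
  · refine MeasurableSet.union
      (measurable_snd (measurableSet_section (measurableSet_upInf v) y)) ?_
    change MeasurableSet {p : (ℕ → ℝ) × (List ℕ → ℕ → ℝ) | ∃ j, j ∈ s ∧ p.1 j < y ∧
      ¬ FinBelow (shift (j :: v) p.2) y}
    rw [Set.ofPred_exists]
    refine MeasurableSet.iUnion fun j => (MeasurableSet.const _).inter (MeasurableSet.inter ?_ ?_)
    · exact measurableSet_lt ((measurable_pi_apply j).comp measurable_fst) measurable_const
    · exact (((measurable_shift (j :: v)).comp measurable_snd)
        (measurableSet_finBelow_section y)).compl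

lemma blockLevel_update (v : List ℕ) (s : Set ℕ) (b : ℕ → ℝ) (f : List ℕ → ℕ → ℝ) (b' : ℕ → ℝ) :
    blockLevel v s b (Function.update f v b') = blockLevel v s b f := by
  simp only [blockLevel, upInf_update f _ v b' v List.suffix_rfl, shift_child_update]

lemma blockLevel_graft {v : List ℕ} {s : Set ℕ} {i : ℕ} (hi : i ∉ s) (b : ℕ → ℝ)
    (f g : List ℕ → ℕ → ℝ) : blockLevel v s b (graft (i :: v) f g) = blockLevel v s b f := by
  simp only [blockLevel, upInf_graft f g _ v (i :: v) (List.suffix_cons i v)]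
  congr 1
  funext y
  refine propext (or_congr_right (exists_congr fun j => and_congr_right fun hj => ?_))
  rw [shift_graft_sibling (by rintro rfl; exact hi hj)]

lemma blockLevel_congr {v : List ℕ} {s : Set ℕ} {b b' : ℕ → ℝ} (h : ∀ j ∈ s, b j = b' j)
    (f : List ℕ → ℕ → ℝ) : blockLevel v s b f = blockLevel v s b' f := by
  rw [blockLevel, blockLevel]
  congr 1
  funext y
  refine propext (or_congr_right (exists_congr fun j => and_congr_right fun hj => ?_))
  rw [h j hj]

/-- Below `t ≤ b i` only children before `i` are open, because the weights increase. -/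
lemma blockLevel_iff_of_le {b : ℕ → ℝ} (hb : StrictMono b) {i : ℕ} {t : ℝ} (ht : t ≤ b i)
    (v : List ℕ) (f : List ℕ → ℕ → ℝ) {y : ℝ} (hy : y < t) :
    (UpInf f y v ∨ ∃ j ∈ Set.univ, b j < y ∧ ¬ FinBelow (shift (j :: v) f) y) ↔
      (UpInf f y v ∨ ∃ j ∈ Set.Iio i, b j < y ∧ ¬ FinBelow (shift (j :: v) f) y) :=
  or_congr_right (exists_congr fun _ => ⟨fun h =>
    ⟨hb.lt_iff_lt.1 ((h.2.1.trans hy).trans_le ht), h.2⟩, fun h => ⟨trivial, h.2⟩⟩)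

/-- A function of the level of a vertex and of the weight of an edge above this level is
determined by the children before the edge. -/
lemma blockLevel_apply_eq {ψ : EReal → ℝ → ℝ≥0∞} (hψ : ∀ (c : EReal) (t : ℝ), ¬ c < (t : EReal) → ψ c t = 0)
    {b : ℕ → ℝ} (hb : StrictMono b) {i : ℕ} {t : ℝ} (ht : t ≤ b i) (v : List ℕ)
    (f : List ℕ → ℕ → ℝ) :
    ψ (blockLevel v Set.univ b f) t = ψ (blockLevel v (Set.Iio i) b f) t := by
  by_cases h : blockLevel v Set.univ b f < t
  · congr 1
    exact thr_congr_of_lt (fun y hy => blockLevel_iff_of_le hb ht v f hy) h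
  · have h2 : ¬ blockLevel v (Set.Iio i) b f < t := fun h' =>
      h ((thr_lt_congr fun y hy => blockLevel_iff_of_le hb ht v f hy).2 h')
    rw [hψ _ _ h, hψ _ _ h2]

/-- The compensator formula summed over the children: the level built from the children before `i`
is predictable for the i-th atom, and on the interval ending at that atom it may be replaced by the
full level wherever `ψ` does not vanish. -/
lemma tsum_lintegral_blockLevel {ψ : EReal → ℝ → ℝ≥0∞} (hψm : Measurable (Function.uncurry ψ))
    (hψ : ∀ (c : EReal) (t : ℝ), ¬ c < (t : EReal) → ψ c t = 0) (hψ0 : ∀ c t, t ≤ 0 → ψ c t = 0)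
    (v : List ℕ) (f : List ℕ → ℕ → ℝ) :
    ∑' i, ∫⁻ b, ψ (blockLevel v (Set.Iio i) b f) (b i) ∂blockLaw =
      ∫⁻ b, ∫⁻ t, ψ (blockLevel v Set.univ b f) t ∂volume ∂blockLaw := by
  have hm : ∀ s, Measurable fun b => blockLevel v s b f := fun s =>
    (measurable_blockLevel v s).comp measurable_prodMk_right
  have hΦ : ∀ i : ℕ, Measurable (Function.uncurry fun (b : ℕ → ℝ) t =>
      ψ (blockLevel v (Set.Iio i) b f) t) := fun i =>
    hψm.comp (((hm _).comp measurable_fst).prodMk measurable_snd)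
  calc ∑' i, ∫⁻ b, ψ (blockLevel v (Set.Iio i) b f) (b i) ∂blockLaw
      = ∑' i, ∫⁻ b, ∫⁻ t in Set.Ioc (prevAtom b i) (b i),
          ψ (blockLevel v (Set.Iio i) b f) t ∂volume ∂blockLaw :=
        tsum_congr fun i => lintegral_block i (hΦ i) fun b b' t h => by
          simp only [blockLevel_congr (s := Set.Iio i) (fun j hj => h j hj) f]
    _ = ∫⁻ b, ∑' i, ∫⁻ t in Set.Ioc (prevAtom b i) (b i),
          ψ (blockLevel v (Set.Iio i) b f) t ∂volume ∂blockLaw := by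
        have hprod : Measurable fun b : ℕ → ℝ => fun i : ℕ => (b, b i) := by fun_prop
        exact (lintegral_tsum fun i => ((measurable_lintegral_Ioc_prevAtom i (hΦ i)).comp
          ((measurable_pi_apply i).comp hprod)).aemeasurable).symm
    _ = ∫⁻ b, ∫⁻ t, ψ (blockLevel v Set.univ b f) t ∂volume ∂blockLaw := by
        refine lintegral_congr_ae ?_
        filter_upwards [ae_isBlock] with b hb
        have h1 : ∀ i, ∫⁻ t in Set.Ioc (prevAtom b i) (b i), ψ (blockLevel v (Set.Iio i) b f) t =
            ∫⁻ t in Set.Ioc (prevAtom b i) (b i), ψ (blockLevel v Set.univ b f) t := fun i =>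
          setLIntegral_congr_fun measurableSet_Ioc fun t ht =>
            (blockLevel_apply_eq hψ hb.strictMono ht.2 v f).symm
        simp_rw [h1]
        rw [hb.tsum_lintegral fun t => ψ (blockLevel v Set.univ b f) t,
          ← lintegral_indicator measurableSet_Ioi]
        refine lintegral_congr fun t => ?_
        by_cases ht : t ∈ Set.Ioi 0
        · rw [Set.indicator_of_mem ht]
        · rw [Set.indicator_of_notMem ht, hψ0 _ _ (not_lt.1 ht)]

/-- The mean of the vertices hanging off `v`, given that `v` lies in `T` and its level. -/
theorem lintegral_hang (v : List ℕ) (ν : EReal) {φ : EReal → ℝ≥0∞} (hφ : Measurable φ)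
    (hφ1 : ∀ c ≤ 1, φ c = 0) :
    ∫⁻ f in {f | InvasionMem f v}, φ (level f v) * ∑' i, (open Classical in
      if level f v < f v i ∧ (f v i : EReal) ≤ ν then
        hangTotal ν (shift (i :: v) f) (f v i) else 0) ∂treeLaw =
    ∫⁻ f in {f | InvasionMem f v}, φ (level f v) *
      ∫⁻ t in {t : ℝ | level f v < t ∧ (t : EReal) ≤ ν}, hangRate t * chainSum t ν ∂volume
        ∂treeLaw := by
  classical
  let J : (List ℕ → ℕ → ℝ) → ℝ≥0∞ := {f | InvasionSide f v}.indicator 1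
  have hJ : Measurable J := measurable_one.indicator (measurableSet_invasionSide v)
  -- `χ` vanishes unless the edge weight exceeds the level, which permits ignoring the later
  -- children, and unless the weight exceeds one, where the mean hanging size is known.
  let χ : EReal → ℝ → ℝ≥0∞ := fun c t => if c < (t : EReal) ∧ (t : EReal) ≤ ν then φ c else 0
  have hχset : MeasurableSet {p : EReal × ℝ | p.1 < (p.2 : EReal) ∧ (p.2 : EReal) ≤ ν} :=
    (measurableSet_lt measurable_fst (measurable_coe_real_ereal.comp measurable_snd)).inter
      ((measurable_coe_real_ereal.comp measurable_snd) measurableSet_Iic)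
  have hχ : Measurable (Function.uncurry χ) :=
    Measurable.ite hχset (hφ.comp measurable_fst) measurable_const
  have hχ1 : ∀ c t, χ c t ≠ 0 → c < (t : EReal) ∧ (t : EReal) ≤ ν ∧ 1 < t := fun c t h => by
    by_cases h1 : c < (t : EReal) ∧ (t : EReal) ≤ ν
    · refine ⟨h1.1, h1.2, ?_⟩
      by_contra ht
      refine h ?_
      simp only [χ, if_pos h1]
      refine hφ1 c (h1.1.le.trans ?_)
      exact_mod_cast not_lt.1 ht
    · exact absurd (if_neg h1) h
  let H : ℝ → ℝ≥0∞ := fun t => hangRate t * chainSum t ν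
  have hH : Measurable H := measurable_hangRate.mul (measurable_chainSum ν)
  let ψ : EReal → ℝ → ℝ≥0∞ := fun c t => χ c t * H t
  have hψm : Measurable (Function.uncurry ψ) := hχ.mul (hH.comp measurable_snd)
  have hψ : ∀ (c : EReal) (t : ℝ), ¬ c < (t : EReal) → ψ c t = 0 := fun c t h => by
    simp only [ψ, χ, h, false_and, if_false, zero_mul]
  have hψ0 : ∀ c t, t ≤ 0 → ψ c t = 0 := fun c t h => by
    have : χ c t = 0 := by
      by_contra h'
      have := (hχ1 c t h').2.2
      linarith
    simp only [ψ, this, zero_mul]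
  have hχ' : ∀ (c : EReal) (t : ℝ), ¬ c < (t : EReal) → χ c t = 0 := fun c t h => by
    simp only [χ, h, false_and, if_false]
  have hblock : ∀ s, Measurable fun f : List ℕ → ℕ → ℝ => blockLevel v s (f v) f := fun s => by
    have h0 : Measurable fun f : List ℕ → ℕ → ℝ => (f v, f) := by fun_prop
    exact (measurable_blockLevel v s).comp h0
  have hterm : ∀ i, Measurable fun f : List ℕ → ℕ → ℝ =>
      J f * (χ (blockLevel v (Set.Iio i) (f v) f) (f v i) *
        hangTotal ν (shift (i :: v) f) (f v i)) := fun i => by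
    have h0 : Measurable fun f : List ℕ → ℕ → ℝ => f v i := by fun_prop
    exact hJ.mul ((hχ.comp ((hblock _).prodMk h0)).mul
      ((measurable_hangTotal ν).comp ((measurable_shift (i :: v)).prodMk h0)))
  have hinv : {f | InvasionMem f v} =ᵐ[treeLaw] {f | InvasionSide f v} := by
    filter_upwards [ae_isRegular] with f hf
    exact propext (invasionSide_iff hf v).symm
  have hind : ∀ F : (List ℕ → ℕ → ℝ) → ℝ≥0∞, ∫⁻ f in {f | InvasionMem f v}, F f ∂treeLaw =
      ∫⁻ f, J f * F f ∂treeLaw := fun F => by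
    rw [setLIntegral_congr hinv, ← lintegral_indicator (measurableSet_invasionSide v)]
    refine lintegral_congr fun f => ?_
    by_cases h : f ∈ {f | InvasionSide f v}
    · simp only [J, Set.indicator_of_mem h, Pi.one_apply, one_mul]
    · simp only [J, Set.indicator_of_notMem h, zero_mul]
  have hΘ : ∀ i, Measurable (Function.uncurry fun (b : ℕ → ℝ) (f : List ℕ → ℕ → ℝ) =>
      J f * ψ (blockLevel v (Set.Iio i) b f) (b i)) := fun i =>
    (hJ.comp measurable_snd).mul (hψm.comp ((measurable_blockLevel v _).prodMk
      ((measurable_pi_apply i).comp measurable_fst)))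
  have hJdep : ∀ f b', J (Function.update f v b') = J f := fun f b' => by
    simp only [J, Set.indicator, Set.mem_ofPred_eq, invasionSide_update f v v b' List.suffix_rfl,
      Pi.one_apply]
  have hint : Measurable fun c => ∫⁻ t, ψ c t := hψm.lintegral_prod_right
  -- Two independences are used: the subtree of child `i` is averaged into `H`, then the weights at
  -- `v` are separated from everything else.
  have hmain : ∀ i, ∫⁻ f, J f * (χ (blockLevel v (Set.Iio i) (f v) f) (f v i) *
      hangTotal ν (shift (i :: v) f) (f v i)) ∂treeLaw =
      ∫⁻ f, ∫⁻ b, J f * ψ (blockLevel v (Set.Iio i) b f) (b i) ∂blockLaw ∂treeLaw := fun i => by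
    have h0 : Measurable fun p : (List ℕ → ℕ → ℝ) × (List ℕ → ℕ → ℝ) => p.1 v i := by fun_prop
    have hm : Measurable (Function.uncurry fun f g : List ℕ → ℕ → ℝ =>
        J f * (χ (blockLevel v (Set.Iio i) (f v) f) (f v i) * hangTotal ν g (f v i))) :=
      (hJ.comp measurable_fst).mul ((hχ.comp (((hblock _).comp measurable_fst).prodMk h0)).mul
        ((measurable_hangTotal ν).comp (measurable_snd.prodMk h0)))
    rw [lintegral_subtree (i :: v) hm]
    · rw [← lintegral_vertex v (hΘ i)]
      · refine lintegral_congr fun f => ?_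
        have hg : Measurable fun g => hangTotal ν g (f v i) :=
          (measurable_hangTotal ν).comp measurable_prodMk_right
        rw [lintegral_const_mul _ (hg.const_mul _), lintegral_const_mul _ hg]
        by_cases h : χ (blockLevel v (Set.Iio i) (f v) f) (f v i) = 0
        · simp only [ψ, h, zero_mul]
        · rw [lintegral_hangTotal ν (hχ1 _ _ h).2.2]
      · intro b f b'
        simp only [hJdep, blockLevel_update]
    · intro f g h
      have h1 : J (graft (i :: v) f g) = J f := by
        simp only [J, Set.indicator, Set.mem_ofPred_eq,
          invasionSide_graft f g v (i :: v) (List.suffix_cons i v), Pi.one_apply]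
      simp only [h1, graft_child_apply, blockLevel_graft (s := Set.Iio i) (lt_irrefl i)]
  calc _ = ∫⁻ f, ∑' i, J f * (χ (blockLevel v (Set.Iio i) (f v) f) (f v i) *
        hangTotal ν (shift (i :: v) f) (f v i)) ∂treeLaw := by
        rw [hind]
        refine lintegral_congr_ae ?_
        filter_upwards [ae_isRegular] with f hf
        rw [ENNReal.tsum_mul_left, ← ENNReal.tsum_mul_left]
        congr 1
        refine tsum_congr fun i => ?_
        rw [← blockLevel_apply_eq hχ' (hf.strictMono v) le_rfl v f,
          ← level_eq_blockLevel (hf.tendsto v)]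
        simp only [χ]
        split_ifs <;> simp
    _ = ∑' i, ∫⁻ f, J f * (χ (blockLevel v (Set.Iio i) (f v) f) (f v i) *
        hangTotal ν (shift (i :: v) f) (f v i)) ∂treeLaw :=
        lintegral_tsum fun i => (hterm i).aemeasurable
    _ = ∑' i, ∫⁻ f, ∫⁻ b, J f * ψ (blockLevel v (Set.Iio i) b f) (b i) ∂blockLaw ∂treeLaw :=
        tsum_congr hmain
    _ = ∫⁻ f, ∑' i, ∫⁻ b, J f * ψ (blockLevel v (Set.Iio i) b f) (b i) ∂blockLaw ∂treeLaw :=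
        (lintegral_tsum fun i => (Measurable.lintegral_prod_left' (hΘ i)).aemeasurable).symm
    _ = ∫⁻ f, ∫⁻ b, J f * ∫⁻ t, ψ (blockLevel v Set.univ b f) t ∂volume ∂blockLaw ∂treeLaw := by
        refine lintegral_congr fun f => ?_
        have hb : ∀ s, Measurable fun b => blockLevel v s b f := fun s =>
          (measurable_blockLevel v s).comp measurable_prodMk_right
        have h1 : ∀ i, ∫⁻ b, J f * ψ (blockLevel v (Set.Iio i) b f) (b i) ∂blockLaw =
            J f * ∫⁻ b, ψ (blockLevel v (Set.Iio i) b f) (b i) ∂blockLaw := fun i =>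
          lintegral_const_mul _ (hψm.comp ((hb _).prodMk (measurable_pi_apply i)))
        simp_rw [h1]
        rw [ENNReal.tsum_mul_left, tsum_lintegral_blockLevel hψm hψ hψ0 v f]
        exact (lintegral_const_mul _ (hint.comp (hb _))).symm
    _ = ∫⁻ f, J f * ∫⁻ t, ψ (blockLevel v Set.univ (f v) f) t ∂volume ∂treeLaw := by
        refine (lintegral_vertex v (Ψ := fun b f => J f *
          ∫⁻ t, ψ (blockLevel v Set.univ b f) t ∂volume) ?_ ?_).symm
        · exact (hJ.comp measurable_snd).mul (hint.comp (measurable_blockLevel v _))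
        · intro b f b'
          simp only [hJdep, blockLevel_update]
    _ = _ := by
        rw [hind]
        refine lintegral_congr_ae ?_
        filter_upwards [ae_isRegular] with f hf
        rw [← level_eq_blockLevel (hf.tendsto v)]
        have hset : MeasurableSet {t : ℝ | level f v < t ∧ (t : EReal) ≤ ν} :=
          (measurable_coe_real_ereal measurableSet_Ioi).inter (measurableSet_coe_le ν)
        rw [← lintegral_const_mul _ hH, ← lintegral_indicator hset]
        congr 1
        refine lintegral_congr fun t => ?_
        simp only [ψ, χ, Set.indicator, Set.mem_ofPred_eq]
        split_ifs <;> simp [H]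


lemma setLIntegral_level_eq (l : ℝ) (ν : EReal) (G : ℝ → ℝ≥0∞) :
    ∫⁻ t in {t : ℝ | (l : EReal) < t ∧ (t : EReal) ≤ ν}, G t = ∫⁻ t in levelSet l ν, G t := by
  refine setLIntegral_congr ?_
  filter_upwards [ae_mem_levelSet_iff l ν] with t ht
  refine propext ?_
  change (l : EReal) < t ∧ (t : EReal) ≤ ν ↔ t ∈ levelSet l ν
  rw [EReal.coe_lt_coe_iff]
  exact ht

/-- The vertex `v` counts one and the rest has mean ∫ `hangRate * chainSum` above the level; by the
Volterra equation the two add up to `chainSum`. -/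
theorem lintegral_hangingSize (v : List ℕ) (ν : EReal) {φ : EReal → ℝ≥0∞} (hφ : Measurable φ)
    (hφ1 : ∀ c, φ c ≠ 0 → ∃ l : ℝ, c = l ∧ 1 < l ∧ (l : EReal) ≤ ν) :
    ∫⁻ f in {f | InvasionMem f v}, φ (level f v) * hangingSize f v ν ∂treeLaw =
      ∫⁻ f in {f | InvasionMem f v}, φ (level f v) * chainSum (level f v).toReal ν ∂treeLaw := by
  classical
  have hm : Measurable fun f => φ (level f v) := hφ.comp (measurable_level v)
  have h1 : ∀ c ≤ 1, φ c = 0 := fun c hc => by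
    by_contra h
    obtain ⟨l, rfl, hl, -⟩ := hφ1 c h
    exact absurd hc (not_le.2 (by exact_mod_cast hl))
  have hL : ∫⁻ f in {f | InvasionMem f v}, φ (level f v) * hangingSize f v ν ∂treeLaw =
      ∫⁻ f in {f | InvasionMem f v}, (φ (level f v) + φ (level f v) * ∑' i,
        if level f v < f v i ∧ (f v i : EReal) ≤ ν then
          hangTotal ν (shift (i :: v) f) (f v i) else 0) ∂treeLaw := by
    refine lintegral_congr_ae ((ae_restrict_iff' (measurableSet_invasionMem v)).2 ?_)
    filter_upwards [ae_isRegular, ae_isOffCritical] with f hf hoff hfv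
    rw [hf.hangingSize_eq (hf.mem_TVerts_iff.2 hfv)]
    by_cases h : φ (level f v) = 0
    · simp [h]
    · obtain ⟨l, hl, -, hlν⟩ := hφ1 _ h
      rw [if_pos (hl ▸ hlν), mul_add, mul_one]
      simp only [hf.clusterInf_weight_iff hoff]
  rw [hL, lintegral_add_left hm, lintegral_hang v ν hφ h1, ← lintegral_add_left hm]
  refine lintegral_congr fun f => ?_
  by_cases h : φ (level f v) = 0
  · simp [h]
  · obtain ⟨l, hl, hl1, -⟩ := hφ1 _ h
    rw [hl, setLIntegral_level_eq, EReal.toReal_coe, chainSum_eq hl1.le, mul_add, mul_one]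

/-! ## Positive probability of the conditioning event -/

lemma treeLaw_subtree (u : List ℕ) {A C : Set (List ℕ → ℕ → ℝ)} (hA : MeasurableSet A)
    (hdep : ∀ f g, graft u f g ∈ A ↔ f ∈ A) (hC : MeasurableSet C) :
    treeLaw {f | f ∈ A ∧ shift u f ∈ C} = treeLaw A * treeLaw C := by
  have hAI : Measurable (A.indicator (1 : (List ℕ → ℕ → ℝ) → ℝ≥0∞)) := measurable_one.indicator hA
  have hCI : Measurable (C.indicator (1 : (List ℕ → ℕ → ℝ) → ℝ≥0∞)) := measurable_one.indicator hC
  have hmeas : MeasurableSet {f | f ∈ A ∧ shift u f ∈ C} := hA.inter ((measurable_shift u) hC)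
  have h := lintegral_subtree u (Ψ := fun f g =>
    A.indicator (1 : (List ℕ → ℕ → ℝ) → ℝ≥0∞) f * C.indicator (1 : (List ℕ → ℕ → ℝ) → ℝ≥0∞) g)
    ((hAI.comp measurable_fst).mul (hCI.comp measurable_snd)) fun f g h => by
      have : A.indicator (1 : (List ℕ → ℕ → ℝ) → ℝ≥0∞) (graft u f g) = A.indicator 1 f := by
        by_cases hf : f ∈ A
        · rw [Set.indicator_of_mem hf, Set.indicator_of_mem ((hdep f g).2 hf)]
          rfl
        · rw [Set.indicator_of_notMem hf, Set.indicator_of_notMem (mt (hdep f g).1 hf)]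
      simp only [this]
  simp_rw [lintegral_const_mul _ hCI] at h
  rw [lintegral_mul_const _ hAI, lintegral_indicator_one hA, lintegral_indicator_one hC] at h
  rw [← h, ← lintegral_indicator_one hmeas]
  refine lintegral_congr fun f => ?_
  by_cases h1 : f ∈ A
  · by_cases h2 : shift u f ∈ C
    · rw [Set.indicator_of_mem h1, Set.indicator_of_mem h2,
        Set.indicator_of_mem (show f ∈ {f | f ∈ A ∧ shift u f ∈ C} from ⟨h1, h2⟩)]
      simp
    · rw [Set.indicator_of_notMem h2, Set.indicator_of_notMem
        (show f ∉ {f | f ∈ A ∧ shift u f ∈ C} from fun h => h2 h.2), mul_zero]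
  · rw [Set.indicator_of_notMem h1, Set.indicator_of_notMem
      (show f ∉ {f | f ∈ A ∧ shift u f ∈ C} from fun h => h1 h.1), zero_mul]

lemma blockLaw_atomCount_pos {y : ℝ} (hy : 0 < y) (n : ℕ) : blockLaw {b | atomCount y b = n} ≠ 0 := by
  rw [blockLaw_atomCount hy.le]
  have : 0 < Real.exp (-y) * y ^ n / (n.factorial : ℝ) := by positivity
  simpa using this

/-- Induction on depth: with positive probability `u` has exactly i + 1 children below `l`, of which
the first i have finite clusters. Then child `i` is the last open one and sees nothing infinite
outside its subtree, independently of the requirement on `u`. -/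
lemma invasionSide_pos {l : ℝ} (hl : 1 < l) (v : List ℕ) :
    treeLaw {f | InvasionSide f v ∧ ¬ UpInf f l v} ≠ 0 := by
  have hl0 : 0 < l := by linarith
  induction v with
  | nil => simp [InvasionSide, UpInf]
  | cons i u ih =>
    let A : Set (List ℕ → ℕ → ℝ) := {f | InvasionSide f u ∧ ¬ UpInf f l u}
    have hA : MeasurableSet A := (measurableSet_invasionSide u).inter
      (measurableSet_section (measurableSet_upInf u) l).compl
    let F : Set (List ℕ → ℕ → ℝ) := {g | FinBelow g l}
    have hF : MeasurableSet F := measurableSet_finBelow_section l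
    let C : Set (List ℕ → ℕ → ℝ) := {g | atomCount l (g []) = i + 1 ∧ ∀ j ∈ Finset.range i,
      shift [j] g ∈ F}
    have hcount : Measurable fun g : List ℕ → ℕ → ℝ => atomCount l (g []) :=
      (measurable_atomCount l).comp (measurable_pi_apply [])
    have hF' : MeasurableSet {g : List ℕ → ℕ → ℝ | ∀ j ∈ Finset.range i, shift [j] g ∈ F} := by
      have : {g : List ℕ → ℕ → ℝ | ∀ j ∈ Finset.range i, shift [j] g ∈ F} =
          ⋂ j ∈ Finset.range i, shift [j] ⁻¹' F := by
        ext g; simp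
      rw [this]
      exact Finset.measurableSet_biInter _ fun j _ => (measurable_shift [j]) hF
    have hC : MeasurableSet C := (hcount (measurableSet_singleton (i + 1))).inter hF'
    have hFI : Measurable (F.indicator (1 : (List ℕ → ℕ → ℝ) → ℝ≥0∞)) := measurable_one.indicator hF
    have hCpos : treeLaw C ≠ 0 := by
      have hI : ∀ g, C.indicator (1 : (List ℕ → ℕ → ℝ) → ℝ≥0∞) g =
          {b : ℕ → ℝ | atomCount l b = i + 1}.indicator (1 : (ℕ → ℝ) → ℝ≥0∞) (g []) *
            ∏ j ∈ Finset.range i, F.indicator (1 : (List ℕ → ℕ → ℝ) → ℝ≥0∞) (shift [j] g) := by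
        intro g
        by_cases h1 : atomCount l (g []) = i + 1
        · rw [Set.indicator_of_mem (show g [] ∈ {b : ℕ → ℝ | atomCount l b = i + 1} from h1)]
          by_cases h2 : ∀ j ∈ Finset.range i, shift [j] g ∈ F
          · rw [Set.indicator_of_mem (show g ∈ C from ⟨h1, h2⟩), Finset.prod_eq_one fun j hj => by
              rw [Set.indicator_of_mem (h2 j hj)]; rfl]
            simp
          · rw [Set.indicator_of_notMem fun h : g ∈ C => h2 h.2]
            push Not at h2
            obtain ⟨j, hj, hjF⟩ := h2
            rw [Finset.prod_eq_zero hj (Set.indicator_of_notMem hjF _), mul_zero]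
        · rw [Set.indicator_of_notMem fun h : g ∈ C => h1 h.1, Set.indicator_of_notMem
            (show g [] ∉ {b : ℕ → ℝ | atomCount l b = i + 1} from h1), zero_mul]
      have hblk : MeasurableSet {b : ℕ → ℝ | atomCount l b = i + 1} :=
        (measurable_atomCount l) (measurableSet_singleton (i + 1))
      have hbI : Measurable ({b : ℕ → ℝ | atomCount l b = i + 1}.indicator
          (1 : (ℕ → ℝ) → ℝ≥0∞)) := measurable_one.indicator hblk
      have hprod : Measurable fun g : List ℕ → ℕ → ℝ => ∏ j ∈ Finset.range i,
          F.indicator (1 : (List ℕ → ℕ → ℝ) → ℝ≥0∞) (shift [j] g) :=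
        Finset.measurable_prod _ fun j _ => hFI.comp (measurable_shift [j])
      rw [← lintegral_indicator_one hC, lintegral_congr hI, lintegral_vertex_swap []
        (Ψ := fun b g => {b : ℕ → ℝ | atomCount l b = i + 1}.indicator (1 : (ℕ → ℝ) → ℝ≥0∞) b *
          ∏ j ∈ Finset.range i, F.indicator (1 : (List ℕ → ℕ → ℝ) → ℝ≥0∞) (shift [j] g))]
      · simp_rw [lintegral_const_mul _ hprod]
        rw [lintegral_mul_const _ hbI, lintegral_indicator_one hblk,
          lintegral_prod_children [] (Finset.range i) (F := fun _ => F.indicator 1) fun _ => hFI]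
        refine mul_ne_zero (blockLaw_atomCount_pos hl0 (i + 1)) (Finset.prod_ne_zero_iff.2 fun j _ => ?_)
        rw [lintegral_indicator_one hF]
        exact (ENNReal.toReal_pos_iff.1 (extProb_toReal_pos hl0.le)).1.ne'
      · exact (hbI.comp measurable_fst).mul (hprod.comp measurable_snd)
      · intro b f b'
        simp only [shift_child_update]
    have hpos : treeLaw {f | f ∈ A ∧ shift u f ∈ C} ≠ 0 := by
      rw [treeLaw_subtree u hA (fun f g => by
        simp only [A, Set.mem_ofPred_eq, upInf_graft f g l u u List.suffix_rfl,
          invasionSide_graft f g u u List.suffix_rfl]) hC]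
      exact mul_ne_zero ih hCpos
    refine fun h0 => hpos (measure_mono_null_ae ?_ h0)
    filter_upwards [ae_isBlock_tree] with f hf hfAC
    obtain ⟨⟨h1, h2⟩, h3, h4⟩ := hfAC
    have hlt : ∀ j, f u j < l ↔ j < i + 1 := fun j => by
      rw [← h3]
      exact ((hf u).lt_atomCount_iff).symm
    have hi : f u i < l := (hlt i).2 (Nat.lt_succ_self i)
    have hno : ¬ ∃ j, j ≠ i ∧ f u j < l ∧ ¬ FinBelow (shift (j :: u) f) l := by
      rintro ⟨j, hji, hj, hnot⟩
      have hj' := (hlt j).1 hj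
      refine hnot ?_
      have h := h4 j (Finset.mem_range.2 (by omega))
      rwa [shift_singleton_shift] at h
    refine ⟨⟨h1, ?_⟩, ?_⟩
    · rintro (h | ⟨j, hji, hj, hnot⟩)
      · exact h2 (h.mono hi.le)
      · exact hno ⟨j, hji, hj.trans hi, fun h => hnot (h.anti hi.le)⟩
    · rintro ⟨-, h | h⟩
      · exact h2 h
      · exact hno h

/-- If nothing infinite is reached upwards at `l`, and the subtree cluster is finite at `a` but
infinite at `l`, the level lies in [a, l]. The subtree event is independent of the rest and has
positive probability because extinction probabilities decrease strictly. -/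
lemma level_pos (v : List ℕ) {a l : ℝ} (ha : 1 < a) (hal : a < l) :
    treeLaw {f | InvasionMem f v ∧ (a : EReal) ≤ level f v ∧ level f v ≤ l} ≠ 0 := by
  have hl := ha.trans hal
  let A : Set (List ℕ → ℕ → ℝ) := {f | InvasionSide f v ∧ ¬ UpInf f l v}
  have hA : MeasurableSet A := (measurableSet_invasionSide v).inter
    (measurableSet_section (measurableSet_upInf v) l).compl
  let C : Set (List ℕ → ℕ → ℝ) := {g | FinBelow g a} \ {g | FinBelow g l}
  have hC : MeasurableSet C := (measurableSet_finBelow_section a).diff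
    (measurableSet_finBelow_section l)
  have hCpos : treeLaw C ≠ 0 := by
    have hsub : {g : List ℕ → ℕ → ℝ | FinBelow g l} ⊆ {g | FinBelow g a} :=
      fun g hg => FinBelow.anti hal.le hg
    rw [measure_sdiff hsub (measurableSet_finBelow_section l).nullMeasurableSet (measure_ne_top _ _)]
    exact (tsub_pos_of_lt (extProb_strictAnti ha hal)).ne'
  have hpos : treeLaw {f | f ∈ A ∧ shift v f ∈ C} ≠ 0 := by
    rw [treeLaw_subtree v hA (fun f g => by
      simp only [A, Set.mem_ofPred_eq, upInf_graft f g l v v List.suffix_rfl,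
        invasionSide_graft f g v v List.suffix_rfl]) hC]
    exact mul_ne_zero (invasionSide_pos hl v) hCpos
  refine fun h0 => hpos (measure_mono_null_ae ?_ h0)
  filter_upwards [ae_isRegular] with f hf hfAC
  obtain ⟨⟨h1, h2⟩, h3, h4⟩ := hfAC
  refine ⟨(invasionSide_iff hf v).1 h1, le_iInf₂ fun y hy => ?_, thr_le (Or.inr h4)⟩
  by_contra hya
  have hya : y < a := EReal.coe_lt_coe_iff.1 (not_le.1 hya)
  rcases hy with h | h
  · exact h2 (h.mono (hya.trans hal).le)
  · exact h (FinBelow.anti hya.le h3)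


/-! ## Transfer to a general probability space -/

lemma measurable_edgeWeight (a b : List ℕ) :
    Measurable fun f : List ℕ → ℕ → ℝ => edgeWeight f a b := by
  have h : ∀ u, Measurable fun f : List ℕ → ℕ → ℝ => parentWeight f u := fun u => by
    cases u with
    | nil => exact measurable_const
    | cons i u =>
      simp only [parentWeight]
      fun_prop
  unfold edgeWeight
  split_ifs
  · exact h b
  · exact h a

lemma measurableSet_primSet (n : ℕ) (b : List ℕ) :
    MeasurableSet {f : List ℕ → ℕ → ℝ | b ∈ primSet ulamHarris (edgeWeight f) [] n} := by
  induction n generalizing b with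
  | zero => exact MeasurableSet.const (b = [])
  | succ n ih =>
    refine (ih b).union ?_
    change MeasurableSet {f : List ℕ → ℕ → ℝ | ∃ a,
      IsMinExit ulamHarris (edgeWeight f) (primSet ulamHarris (edgeWeight f) [] n) a b}
    rw [Set.ofPred_exists]
    refine MeasurableSet.iUnion fun a => (ih a).inter ((ih b).compl.inter
      ((MeasurableSet.const _).inter ?_))
    have himp : ∀ {p : (List ℕ → ℕ → ℝ) → Prop} {q : (List ℕ → ℕ → ℝ) → Prop},
        MeasurableSet {f | p f} → MeasurableSet {f | q f} → MeasurableSet {f | p f → q f} :=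
      fun hp hq => hp.imp hq
    change MeasurableSet {f : List ℕ → ℕ → ℝ | ∀ a' ∈ primSet ulamHarris (edgeWeight f) [] n,
      ∀ b' ∉ primSet ulamHarris (edgeWeight f) [] n, ulamHarris.Adj a' b' →
        edgeWeight f a b ≤ edgeWeight f a' b'}
    rw [Set.ofPred_forall]
    refine MeasurableSet.iInter fun a' => himp (ih a') ?_
    rw [Set.ofPred_forall]
    exact MeasurableSet.iInter fun b' => himp (ih b').compl (himp (MeasurableSet.const _)
      (measurableSet_le (measurable_edgeWeight a b) (measurable_edgeWeight a' b')))

lemma measurableSet_TVerts (v : List ℕ) : MeasurableSet {f : List ℕ → ℕ → ℝ | v ∈ TVerts f} := by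
  have : {f : List ℕ → ℕ → ℝ | v ∈ TVerts f} =
      ⋃ n, {f | v ∈ primSet ulamHarris (edgeWeight f) [] n} := by
    ext f
    simp [TVerts, invasionVerts]
  rw [this]
  exact MeasurableSet.iUnion fun n => measurableSet_primSet n v

/-- The weights are partial sums of the gaps, whose joint law is a product of exponentials; currying
groups the gaps by vertex. -/
lemma IsPWIT.measurePreserving {Ω : Type*} [MeasurableSpace Ω] {P : Measure Ω}
    {W : List ℕ → ℕ → Ω → ℝ} (hW : IsPWIT W P) :
    MeasurePreserving (fun ω u i => W u i ω) P treeLaw := by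
  have hgap : ∀ q : List ℕ × ℕ, Measurable (gap W q.1 q.2) := by
    rintro ⟨u, i⟩
    cases i with
    | zero => exact hW.measurable u 0
    | succ i => exact (hW.measurable u (i + 1)).sub (hW.measurable u i)
  have hsum : ∀ ω u i, W u i ω = partialSums (fun j => gap W u j ω) i := by
    intro ω u i
    induction i with
    | zero => simp [partialSums, gap]
    | succ i ih =>
      rw [partialSums, Finset.sum_range_succ]
      rw [partialSums] at ih
      rw [← ih]
      simp [gap]
  have hG : Measurable fun ω (q : List ℕ × ℕ) => gap W q.1 q.2 ω := measurable_pi_lambda _ hgap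
  have h1 : P.map (fun ω (q : List ℕ × ℕ) => gap W q.1 q.2 ω) =
      Measure.infinitePi fun _ : List ℕ × ℕ => expMeasure 1 := by
    rw [hW.indep.map_fun_eq_infinitePi_map hgap]
    simp only [hW.law]
  have h2 := Measure.infinitePi_map_curry (fun (_ : List ℕ) (_ : ℕ) => expMeasure 1)
  have h3 := Measure.infinitePi_map_pi
    (μ := fun _ : List ℕ => Measure.infinitePi fun _ : ℕ => expMeasure 1)
    (f := fun _ => partialSums) fun _ => measurable_partialSums
  have hp : Measurable fun (x : List ℕ → ℕ → ℝ) u => partialSums (x u) :=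
    measurable_pi_lambda _ fun u => measurable_partialSums.comp (measurable_pi_apply u)
  have hc : Measurable fun x => (fun (x : List ℕ → ℕ → ℝ) u => partialSums (x u))
      (MeasurableEquiv.curry (List ℕ) ℕ ℝ x) := hp.comp (MeasurableEquiv.measurable _)
  have hF : (fun ω u i => W u i ω) = (fun x => (fun (x : List ℕ → ℕ → ℝ) u => partialSums (x u))
      (MeasurableEquiv.curry (List ℕ) ℕ ℝ x)) ∘ fun ω (q : List ℕ × ℕ) => gap W q.1 q.2 ω := by
    funext ω u i
    exact hsum ω u i
  refine ⟨measurable_pi_lambda _ fun u => measurable_pi_lambda _ fun i => hW.measurable u i, ?_⟩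
  rw [hF, ← Measure.map_map hc hG, h1]
  change Measure.map ((fun (x : List ℕ → ℕ → ℝ) u => partialSums (x u)) ∘
    (MeasurableEquiv.curry (List ℕ) ℕ ℝ)) _ = _
  rw [← Measure.map_map hp (MeasurableEquiv.measurable _), h2, h3]
  rfl

/-- The vertex `v` lies in `T` and its level lies in `E`. -/
def levelEvent (v : List ℕ) (E : Set EReal) : Set (List ℕ → ℕ → ℝ) :=
  {f | InvasionMem f v ∧ level f v ∈ E}

lemma measurableSet_levelEvent (v : List ℕ) {E : Set EReal} (hE : MeasurableSet E) :
    MeasurableSet (levelEvent v E) :=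
  (measurableSet_invasionMem v).inter ((measurable_level v) hE)

lemma ae_mem_TVerts_iff (v : List ℕ) : ∀ᵐ f ∂treeLaw, (v ∈ TVerts f ↔ InvasionMem f v) ∧
    (v ∈ TVerts f → activationTime f v = level f v) := by
  filter_upwards [ae_isRegular] with f hf
  exact ⟨hf.mem_TVerts_iff, fun h => hf.activationTime_eq (forest_reachable h)⟩

lemma levelEvent_ae_eq (v : List ℕ) (E : Set EReal) :
    {f | v ∈ TVerts f ∧ activationTime f v ∈ E} =ᵐ[treeLaw] levelEvent v E := by
  filter_upwards [ae_mem_TVerts_iff v] with f hf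
  refine propext ?_
  change v ∈ TVerts f ∧ activationTime f v ∈ E ↔ InvasionMem f v ∧ level f v ∈ E
  rw [← hf.1]
  exact and_congr_right fun h => by rw [hf.2 h]

/-- The definition is an infimum over uncountably many rays, so measurability is obtained through
the almost sure equality with `level` on T. -/
lemma aemeasurable_activationTime (v : List ℕ) : AEMeasurable (fun f => activationTime f v)
    (treeLaw.restrict {f | v ∈ TVerts f}) := by
  refine ⟨fun f => level f v, measurable_level v,
    (ae_restrict_iff' (measurableSet_TVerts v)).2 ?_⟩
  filter_upwards [ae_mem_TVerts_iff v] with f hf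
  exact hf.2

lemma aemeasurable_hangingSize (v : List ℕ) (ν : EReal) :
    AEMeasurable (fun f => hangingSize f v ν) (treeLaw.restrict {f | v ∈ TVerts f}) := by
  classical
  refine ⟨fun f => (if level f v ≤ ν then 1 else 0) + ∑' i,
    if ClusterInf f (f v i) v ∧ (f v i : EReal) ≤ ν then
      hangTotal ν (shift (i :: v) f) (f v i) else 0, ?_,
    (ae_restrict_iff' (measurableSet_TVerts v)).2 ?_⟩
  · refine (Measurable.ite ((measurable_level v) measurableSet_Iic) measurable_const
      measurable_const).add (Measurable.tsum fun i => Measurable.ite ?_ ?_ measurable_const)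
    · have h0 : Measurable fun f : List ℕ → ℕ → ℝ => f v i := by fun_prop
      exact ((measurable_id.prodMk h0) (measurableSet_clusterInf v)).inter
        ((measurable_coe_real_ereal.comp h0) measurableSet_Iic)
    · have h0 : Measurable fun f : List ℕ → ℕ → ℝ => f v i := by fun_prop
      exact (measurable_hangTotal ν).comp ((measurable_shift (i :: v)).prodMk h0)
  · filter_upwards [ae_isRegular] with f hf hfv
    exact hf.hangingSize_eq hfv ν

lemma setLIntegral_levelEvent (v : List ℕ) (ν : EReal) {E : Set EReal} (hE : MeasurableSet E)
    (hE1 : ∀ c ∈ E, ∃ l : ℝ, c = l ∧ 1 < l ∧ (l : EReal) ≤ ν) :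
    ∫⁻ f in levelEvent v E, hangingSize f v ν ∂treeLaw =
      ∫⁻ f in levelEvent v E, chainSum (level f v).toReal ν ∂treeLaw := by
  have hind : ∀ G : (List ℕ → ℕ → ℝ) → ℝ≥0∞, ∫⁻ f in levelEvent v E, G f ∂treeLaw =
      ∫⁻ f in {f | InvasionMem f v}, E.indicator 1 (level f v) * G f ∂treeLaw := fun G => by
    rw [← lintegral_indicator (measurableSet_levelEvent v hE),
      ← lintegral_indicator (measurableSet_invasionMem v)]
    refine lintegral_congr fun f => ?_
    by_cases h1 : f ∈ {f | InvasionMem f v}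
    · rw [Set.indicator_of_mem h1]
      by_cases h2 : level f v ∈ E
      · rw [Set.indicator_of_mem h2, Set.indicator_of_mem (show f ∈ levelEvent v E from ⟨h1, h2⟩)]
        simp
      · rw [Set.indicator_of_notMem h2, Set.indicator_of_notMem
          (show f ∉ levelEvent v E from fun h => h2 h.2), zero_mul]
    · rw [Set.indicator_of_notMem h1, Set.indicator_of_notMem
        (show f ∉ levelEvent v E from fun h => h1 h.1)]
  rw [hind, hind]
  refine lintegral_hangingSize v ν (measurable_one.indicator hE) fun c hc => hE1 c ?_
  exact Set.mem_of_indicator_ne_zero hc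

lemma levelEvent_Ioc_ne_zero (v : List ℕ) {l δ : ℝ} (hl : 1 < l) (hδ : 0 < δ) :
    treeLaw (levelEvent v (Set.Ioc ((l - δ : ℝ) : EReal) (l : EReal))) ≠ 0 := by
  obtain ⟨a, ha, hal⟩ := exists_between (max_lt hl (sub_lt_self l hδ))
  obtain ⟨ha1, ha2⟩ := max_lt_iff.1 ha
  refine fun h0 => level_pos v ha1 hal (measure_mono_null ?_ h0)
  exact fun f hf => ⟨hf.1, (EReal.coe_lt_coe_iff.2 ha2).trans_le hf.2.1, hf.2.2⟩

/-- The average equals the average of `chainSum` over levels in (l - δ, l], which monotonicity and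
the Lipschitz bound squeeze between `chainSum l ν` and the same plus K δ. -/
lemma tendsto_average_hangingSize (v : List ℕ) {l : ℝ} (hl : 1 < l) {ν : EReal}
    (hlν : (l : EReal) ≤ ν) :
    Tendsto (fun δ : ℝ => (treeLaw (levelEvent v (Set.Ioc ((l - δ : ℝ) : EReal) (l : EReal))))⁻¹ *
      ∫⁻ f in levelEvent v (Set.Ioc ((l - δ : ℝ) : EReal) (l : EReal)),
        hangingSize f v ν ∂treeLaw) (𝓝[>] 0) (𝓝 (chainSum l ν)) := by
  obtain ⟨l₀, h1, h2⟩ := exists_between hl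
  obtain ⟨K, hK, hKle⟩ := exists_chainSum_le h1 ν
  have hup : Tendsto (fun δ : ℝ => chainSum l ν + K * ENNReal.ofReal δ) (𝓝[>] 0)
      (𝓝 (chainSum l ν)) := by
    have h3 : Tendsto (fun δ : ℝ => ENNReal.ofReal δ) (𝓝[>] 0) (𝓝 0) := by
      have := (ENNReal.continuous_ofReal.tendsto 0).mono_left (nhdsWithin_le_nhds (s := Set.Ioi 0))
      simpa using this
    have h4 := (ENNReal.Tendsto.const_mul h3 (Or.inr hK)).const_add (chainSum l ν)
    simpa using h4
  have hmem : ∀ᶠ δ : ℝ in 𝓝[>] 0, δ ∈ Set.Ioo 0 (l - l₀) :=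
    Ioo_mem_nhdsGT (sub_pos.2 h2)
  have hbound : ∀ δ ∈ Set.Ioo 0 (l - l₀),
      chainSum l ν ≤ (treeLaw (levelEvent v (Set.Ioc ((l - δ : ℝ) : EReal) (l : EReal))))⁻¹ *
        ∫⁻ f in levelEvent v (Set.Ioc ((l - δ : ℝ) : EReal) (l : EReal)),
          hangingSize f v ν ∂treeLaw ∧
      (treeLaw (levelEvent v (Set.Ioc ((l - δ : ℝ) : EReal) (l : EReal))))⁻¹ *
        ∫⁻ f in levelEvent v (Set.Ioc ((l - δ : ℝ) : EReal) (l : EReal)),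
          hangingSize f v ν ∂treeLaw ≤ chainSum l ν + K * ENNReal.ofReal δ := by
    rintro δ ⟨hδ, hδ'⟩
    have hreal : ∀ c ∈ Set.Ioc ((l - δ : ℝ) : EReal) (l : EReal),
        ∃ r : ℝ, c = r ∧ l - δ < r ∧ r ≤ l := by
      intro c hc
      have hc1 : c ≠ ⊥ := (bot_le.trans_lt hc.1).ne'
      have hc2 : c ≠ ⊤ := (hc.2.trans_lt (EReal.coe_lt_top l)).ne
      lift c to ℝ using ⟨hc2, hc1⟩
      exact ⟨c, rfl, EReal.coe_lt_coe_iff.1 hc.1, EReal.coe_le_coe_iff.1 hc.2⟩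
    have hS := measurableSet_levelEvent v
      (measurableSet_Ioc (a := ((l - δ : ℝ) : EReal)) (b := (l : EReal)))
    rw [setLIntegral_levelEvent v ν measurableSet_Ioc fun c hc => by
      obtain ⟨r, hr, hr1, hr2⟩ := hreal c hc
      exact ⟨r, hr, by linarith, (EReal.coe_le_coe_iff.2 hr2).trans hlν⟩]
    have h0 := levelEvent_Ioc_ne_zero v hl hδ
    set S := levelEvent v (Set.Ioc ((l - δ : ℝ) : EReal) (l : EReal))
    have htop : treeLaw S ≠ ∞ := measure_ne_top _ _
    have hcancel : ∀ c : ℝ≥0∞, (treeLaw S)⁻¹ * (c * treeLaw S) = c := fun c => by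
      rw [mul_comm c, ← mul_assoc, ENNReal.inv_mul_cancel h0 htop, one_mul]
    constructor
    · conv_lhs => rw [← hcancel (chainSum l ν), ← setLIntegral_const]
      refine mul_le_mul_right (setLIntegral_mono' hS fun f hf => ?_) _
      obtain ⟨r, hr, hr1, hr2⟩ := hreal _ hf.2
      rw [hr, EReal.toReal_coe]
      exact chainSum_antitone ν hr2
    · conv_rhs => rw [← hcancel (chainSum l ν + K * ENNReal.ofReal δ), ← setLIntegral_const]
      refine mul_le_mul_right (setLIntegral_mono' hS fun f hf => ?_) _
      obtain ⟨r, hr, hr1, hr2⟩ := hreal _ hf.2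
      rw [hr, EReal.toReal_coe]
      refine (hKle r l (by linarith) hr2).trans ?_
      gcongr
      linarith
  exact tendsto_of_tendsto_of_tendsto_of_le_of_le' tendsto_const_nhds hup
    (hmem.mono fun δ hδ => (hbound δ hδ).1) (hmem.mono fun δ hδ => (hbound δ hδ).2)


end Aggregation

end

/-! ### The theorem on an arbitrary probability space -/

theorem mainTheorem7 {Ω : Type*} [MeasurableSpace Ω] (P : Measure Ω) [IsProbabilityMeasure P]
    (W : List ℕ → ℕ → Ω → ℝ) (hW : Aggregation.IsPWIT W P) (v : List ℕ)
    (inT : Set Ω) (hinT : inT = {ω | v ∈ Aggregation.TVerts fun u i => W u i ω})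
    (x : Ω → EReal) (hx : x = fun ω => Aggregation.activationTime (fun u i => W u i ω) v)
    (N : EReal → Ω → ℝ≥0∞)
    (hN : N = fun ν ω => Aggregation.hangingSize (fun u i => W u i ω) v ν) :
    -- the objects that enter the conditional expectation are measurable
    MeasurableSet inT ∧ AEMeasurable x (P.restrict inT) ∧
    (∀ ν : EReal, 1 < ν → AEMeasurable (N ν) (P.restrict inT)) ∧
    -- disintegration with respect to the law of `x(v)` on the event that `v` lies in `T`
    (∀ (ν : EReal) (B : Set ℝ), MeasurableSet B → (∀ l ∈ B, 1 < l ∧ (l : EReal) ≤ ν) →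
      ∫⁻ ω in inT ∩ {ω | ∃ l ∈ B, x ω = (l : EReal)}, N ν ω ∂P =
        ∫⁻ ω in inT ∩ {ω | ∃ l ∈ B, x ω = (l : EReal)},
          ∑' k, Aggregation.nInt k (x ω).toReal ν ∂P) ∧
    -- the value at every single `l`, as a limit of elementary conditional expectations
    (∀ (l : ℝ) (ν : EReal), 1 < l → (l : EReal) ≤ ν →
      (∀ δ : ℝ, 0 < δ → P (inT ∩ x ⁻¹' Set.Ioc ((l - δ : ℝ) : EReal) (l : EReal)) ≠ 0) ∧
      Tendsto
        (fun δ : ℝ =>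
          ∫⁻ ω, N ν ω ∂P[|inT ∩ x ⁻¹' Set.Ioc ((l - δ : ℝ) : EReal) (l : EReal)])
        (𝓝[>] 0) (𝓝 (∑' k, Aggregation.nInt k l ν))) := by
  subst hinT hx hN
  have hF := hW.measurePreserving
  have hT := Aggregation.measurableSet_TVerts v
  have hFT := hF.restrict_preimage hT
  have hNae : ∀ ν : EReal, AEMeasurable
      (fun f => Aggregation.hangingSize f v ν)
      (Aggregation.treeLaw.restrict {f | v ∈ Aggregation.TVerts f}) :=
    Aggregation.aemeasurable_hangingSize v
  -- events and integrals in terms of the law of the weights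
  have hev : ∀ E : Set EReal, ({ω | v ∈ Aggregation.TVerts fun u i => W u i ω} ∩
      (fun ω => Aggregation.activationTime (fun u i => W u i ω) v) ⁻¹' E : Set Ω) =ᵐ[P]
      (fun ω u i => W u i ω) ⁻¹' Aggregation.levelEvent v E := fun E =>
    hF.quasiMeasurePreserving.preimage_ae_eq (Aggregation.levelEvent_ae_eq v E)
  have hmeasure : ∀ E : Set EReal, MeasurableSet E →
      P ({ω | v ∈ Aggregation.TVerts fun u i => W u i ω} ∩
        (fun ω => Aggregation.activationTime (fun u i => W u i ω) v) ⁻¹' E) =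
      Aggregation.treeLaw (Aggregation.levelEvent v E) := fun E hE => by
    rw [measure_congr (hev E), hF.measure_preimage
      (Aggregation.measurableSet_levelEvent v hE).nullMeasurableSet]
  -- Measurability of the integrands is only available on the event that `v` lies in T, which
  -- contains each level event up to a null set.
  have hsub : ∀ E : Set EReal, Aggregation.treeLaw.restrict (Aggregation.levelEvent v E) ≪
      Aggregation.treeLaw.restrict {f | v ∈ Aggregation.TVerts f} := fun E => by
    refine Measure.absolutelyContinuous_of_le (Measure.restrict_mono_ae ?_)
    filter_upwards [Aggregation.ae_mem_TVerts_iff v] with f hf hfE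
    exact hf.1.2 hfE.1
  have hint : ∀ (E : Set EReal), MeasurableSet E → ∀ G : (List ℕ → ℕ → ℝ) → ℝ≥0∞,
      AEMeasurable G (Aggregation.treeLaw.restrict {f | v ∈ Aggregation.TVerts f}) →
      ∫⁻ ω in {ω | v ∈ Aggregation.TVerts fun u i => W u i ω} ∩
        (fun ω => Aggregation.activationTime (fun u i => W u i ω) v) ⁻¹' E,
        G (fun u i => W u i ω) ∂P =
      ∫⁻ f in Aggregation.levelEvent v E, G f ∂Aggregation.treeLaw := fun E hE G hG => by
    have hres := hF.restrict_preimage (Aggregation.measurableSet_levelEvent v hE)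
    rw [setLIntegral_congr (hev E), ← hres.map_eq, lintegral_map' _ hres.aemeasurable]
    rw [hres.map_eq]
    exact hG.mono_ac (hsub E)
  refine ⟨hF.measurable hT, (Aggregation.aemeasurable_activationTime v).comp_quasiMeasurePreserving
    hFT.quasiMeasurePreserving, fun ν _ => (hNae ν).comp_quasiMeasurePreserving
    hFT.quasiMeasurePreserving, ?_, ?_⟩
  · intro ν B hB hB1
    have hE : MeasurableSet ((fun r : ℝ => (r : EReal)) '' B) :=
      EReal.measurableEmbedding_coe.measurableSet_image' hB
    have hset : {ω | ∃ l ∈ B, Aggregation.activationTime (fun u i => W u i ω) v = (l : EReal)} =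
        (fun ω => Aggregation.activationTime (fun u i => W u i ω) v) ⁻¹'
          ((fun r : ℝ => (r : EReal)) '' B) := by
      ext ω
      exact exists_congr fun l => and_congr_right fun _ => eq_comm
    have hG : AEMeasurable (fun f => Aggregation.chainSum (Aggregation.activationTime f v).toReal ν)
        (Aggregation.treeLaw.restrict {f | v ∈ Aggregation.TVerts f}) :=
      ((Aggregation.measurable_chainSum ν).comp measurable_ereal_toReal).comp_aemeasurable
        (Aggregation.aemeasurable_activationTime v)
    rw [hset]
    refine (hint _ hE _ (hNae ν)).trans ?_
    refine Eq.trans ?_ (hint _ hE _ hG).symm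
    rw [Aggregation.setLIntegral_levelEvent v ν hE]
    · refine setLIntegral_congr_fun_ae (Aggregation.measurableSet_levelEvent v hE) ?_
      filter_upwards [Aggregation.ae_mem_TVerts_iff v] with f hf hfE
      rw [hf.2 (hf.1.2 hfE.1)]
    · rintro _ ⟨l, hl, rfl⟩
      exact ⟨l, rfl, hB1 l hl⟩
  · intro l ν hl hlν
    refine ⟨fun δ hδ => ?_, ?_⟩
    · rw [hmeasure _ measurableSet_Ioc]
      exact Aggregation.levelEvent_Ioc_ne_zero v hl hδ
    · refine (Aggregation.tendsto_average_hangingSize v hl hlν).congr fun δ => ?_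
      rw [ProbabilityTheory.cond, lintegral_smul_measure, hmeasure _ measurableSet_Ioc, smul_eq_mul]
      congr 1
      exact (hint _ measurableSet_Ioc _ (hNae ν)).symm
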